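/- **Model.** For each $n$, let $A=(A_{ij})$ be the adjacency matrix of a random undirected simple graph on $n$ nodes whose entries $A_{ij}$, $i<j$, are independent Bernoulli variables with $$P(A_{ij}=1)=\frac{e^{\mu_0+\beta_{0i}+\beta_{0j}}}{1+e^{\mu_0+\beta_{0i}+\beta_{0j}}},$$ where $\mu_0\in\mathbb R$ and $\boldsymbol\beta_0\in[0,\infty)^n$ may depend on $n$. Let $S=\{i:\beta_{0i}\neq0\}$ be the support of $\boldsymbol\beta_0$, assumed known, and $s_0=|S|$ (both may depend on $n$). Fix $\gamma\in[0,2)$ and $\alpha\in[0,1)$ with $0\le\gamma-\alpha<1$, and reparametrize $$\mu=-\gamma\log n+\mu^\dagger,\qquad \beta_i=\alpha\log n+\beta_i^\dagger\ (i\in S),\qquad \beta_i=0\ (i\notin S).$$ Let the parameter space for $(\mu^\dagger,\boldsymbol\beta_S^\dagger)$ be $[-M_1,M_1]\times[0,M_2]^{s_0}$, where $M_1,M_2>0$ may depend on $n$ and $\max(M_1,M_2)=o(\log n)$. Assume that the true value $(\mu_0^\dagger,\boldsymbol\beta_{0S}^\dagger)$, which may depend on $n$, belongs to this parameter space, and let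 $(\hat\mu^\dagger,\hat{\boldsymbol\beta}_S^\dagger)$ be any maximum likelihood estimator over it (it need not be unique). **Notation.** $a_n=\overline o(b_n)$ means $a_n=O(n^{-c}b_n)$ for some constant $c>0$; $X_n=\overline o_P(b_n)$ means $X_n=O_P(n^{-c}b_n)$ for some constant $c>0$. **Theorem.** (i) If $s_0=\overline o(n^{1-\alpha})$, then $\hat\mu^\dagger-\mu_0^\dagger=\overline o_P(1)$ and $\max_{i\in S}|\hat\beta_i^\dagger-\beta_{0i}^\dagger|=\overline o_P(1)$. (ii) If, for some constant $\eta$ independent of $n$ with $0<\eta<\min(M_1,M_2)$, one has $|\mu_0^\dagger|\le M_1-\eta$ and $\eta\le\beta_{0i}^\dagger\le M_2-\eta$ for all $i\in S$, and if $s_0=\overline o(n^{(1-\alpha)/2})$, then for every fixed finite set $F$ of nodes with $F\subset S$ for all large $n$, $$\Sigma_F^{-1/2}\begin{pmatrix} n^{1-\gamma/2}(\hat\mu^\dagger-\mu_0^\dagger)\\ n^{1/2-(\gamma-\alpha)/2}(\hat\beta_i^\dagger-\beta_{0i}^\dagger)_{i\in F}\end{pmatrix}\ \xrightarrow{d}\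 N(\mathbf 0,I_{1+|F|})\qquad(n\to\infty),$$ where $\Sigma_F$ is the diagonal matrix whose first diagonal entry (for $\mu^\dagger$) and remaining diagonal entries (for $\beta_i^\dagger$, $i\in F$) are, respectively, $$\begin{cases} 2e^{-\mu_0^\dagger}\ \text{ and }\ e^{-\mu_0^\dagger-\beta_{0i}^\dagger} & \text{if }\alpha<\gamma,\\ 2e^{-\mu_0^\dagger}\ \text{ and }\ 2+e^{-\mu_0^\dagger-\beta_{0i}^\dagger}+e^{\mu_0^\dagger+\beta_{0i}^\dagger} & \text{if }\gamma=\alpha\in(0,1),\\ 4+2e^{-\mu_0^\dagger}+2e^{\mu_0^\dagger}\ \text{ and }\ 2+e^{-\mu_0^\dagger-\beta_{0i}^\dagger}+e^{\mu_0^\dagger+\beta_{0i}^\dagger} & \text{if }\gamma=\alpha=0. \end{cases}$$ -/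

import Mathlib

open Filter MeasureTheory ProbabilityTheory
open scoped NNReal Topology Matrix

noncomputable section

namespace SparseBeta

/-! The nodes of a network with `n` nodes are labelled `0, …, n - 1`. A node-indexed vector is a
function on `ℕ`, of which only the entries with index `< n` (or in the support) are ever used. -/

/-- The unordered pairs of distinct nodes of a network with `n` nodes, as pairs `i < j`. -/
def edgePairs (n : ℕ) : Finset (ℕ × ℕ) :=
  (Finset.range n ×ˢ Finset.range n).filter fun e => e.1 < e.2

/-- Edge probability of the sparse `β`-model. -/
def linkProb (μ : ℝ) (β : ℕ → ℝ) (i j : ℕ) : ℝ :=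
  Real.exp (μ + β i + β j) / (1 + Real.exp (μ + β i + β j))

/-- The support of the vector `(β₀, …, βₙ₋₁)`. -/
def supp (n : ℕ) (β : ℕ → ℝ) : Finset ℕ :=
  (Finset.range n).filter fun i => β i ≠ 0

/-- `A` is the adjacency matrix of a random simple undirected graph on `n` nodes that follows the
sparse `β`-model with parameters `(μ, β)`: the entries above the diagonal are independent
Bernoulli variables with success probabilities `linkProb μ β i j`. -/
structure IsSparseBetaModel {Ω : Type*} [MeasurableSpace Ω] (P : Measure Ω) (n : ℕ)
    (μ : ℝ) (β : ℕ → ℝ) (A : Ω → ℕ → ℕ → ℝ) : Prop where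
  measurable : ∀ i < n, ∀ j < n, Measurable fun ω => A ω i j
  zero_or_one : ∀ ω, ∀ i < n, ∀ j < n, A ω i j = 0 ∨ A ω i j = 1
  symm : ∀ ω, ∀ i < n, ∀ j < n, A ω i j = A ω j i
  diag : ∀ ω, ∀ i < n, A ω i i = 0
  prob : ∀ e ∈ edgePairs n, P.real {ω | A ω e.1 e.2 = 1} = linkProb μ β e.1 e.2
  indep : iIndepFun (fun (e : edgePairs n) ω => A ω e.1.1 e.1.2) P

/-- The likelihood of `(μ, β)` when the adjacency matrix `a` is observed. -/
def likelihood (n : ℕ) (a : ℕ → ℕ → ℝ) (μ : ℝ) (β : ℕ → ℝ) : ℝ :=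
  ∏ e ∈ edgePairs n,
    if a e.1 e.2 = 1 then linkProb μ β e.1 e.2 else 1 - linkProb μ β e.1 e.2

/-- The intercept that corresponds to the scale-invariant parameter `m`. -/
def muOf (γ : ℝ) (n : ℕ) (m : ℝ) : ℝ := -γ * Real.log n + m

/-- The node parameters, supported on `S`, that correspond to the scale-invariant parameters
`(b i)`, `i ∈ S`. -/
def betaOf (α : ℝ) (n : ℕ) (S : Finset ℕ) (b : ℕ → ℝ) (i : ℕ) : ℝ :=
  if i ∈ S then α * Real.log n + b i else 0

/-- `(m, (b i)_{i ∈ S})` lies in `[-M₁, M₁] × [0, M₂]^S`. -/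
def InBox (S : Finset ℕ) (M₁ M₂ m : ℝ) (b : ℕ → ℝ) : Prop :=
  m ∈ Set.Icc (-M₁) M₁ ∧ ∀ i ∈ S, b i ∈ Set.Icc 0 M₂

/-- `(m, (b i)_{i ∈ S})` is a maximum likelihood estimate of the scale-invariant parameters with
known support `S` over the parameter space `[-M₁, M₁] × [0, M₂]^S`, for the observed adjacency
matrix `a`. -/
def IsMLE (γ α : ℝ) (n : ℕ) (S : Finset ℕ) (M₁ M₂ : ℝ) (a : ℕ → ℕ → ℝ)
    (m : ℝ) (b : ℕ → ℝ) : Prop :=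
  InBox S M₁ M₂ m b ∧
    ∀ (m' : ℝ) (b' : ℕ → ℝ), InBox S M₁ M₂ m' b' →
      likelihood n a (muOf γ n m') (betaOf α n S b') ≤
        likelihood n a (muOf γ n m) (betaOf α n S b)

/-- `a n = ō(b n)`: `a n = O(n ^ (-c) * b n)` for some constant `c > 0`. -/
def IsLittleOBar (a b : ℕ → ℝ) : Prop :=
  ∃ c : ℝ, 0 < c ∧ a =O[atTop] fun n => (n : ℝ) ^ (-c) * b n

/-- `X n = O_P(b n)` for a positive sequence `b`; the `n`-th variable lives on its own probability
space. -/
def IsBigOP {Ω : ℕ → Type*} [∀ n, MeasurableSpace (Ω n)] (P : ∀ n, Measure (Ω n))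
    (X : ∀ n, Ω n → ℝ) (b : ℕ → ℝ) : Prop :=
  ∀ ε : ℝ, 0 < ε → ∃ C : ℝ, ∀ᶠ n in atTop, (P n).real {ω | C * b n < |X n ω|} ≤ ε

/-- `X n = ō_P(b n)`: `X n = O_P(n ^ (-c) * b n)` for some constant `c > 0`. -/
def IsLittleOBarP {Ω : ℕ → Type*} [∀ n, MeasurableSpace (Ω n)] (P : ∀ n, Measure (Ω n))
    (X : ∀ n, Ω n → ℝ) (b : ℕ → ℝ) : Prop :=
  ∃ c : ℝ, 0 < c ∧ IsBigOP P X fun n => (n : ℝ) ^ (-c) * b n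

/-- `max_{i ∈ S} |x i|`, which is `0` when `S` is empty. -/
def maxAbs (S : Finset ℕ) (x : ℕ → ℝ) : ℝ := ((S.sup fun i => ‖x i‖₊ : ℝ≥0) : ℝ)

/-- The diagonal entries of the asymptotic covariance matrix; the index `none` stands for the
intercept and `some i` for the node `i ∈ F`. -/
def asymVar (γ α m : ℝ) (b : ℕ → ℝ) (F : Finset ℕ) : Option F → ℝ
  | none =>
    if α < γ then 2 * Real.exp (-m)
    else if 0 < γ then 2 * Real.exp (-m)
    else 4 + 2 * Real.exp (-m) + 2 * Real.exp m
  | some i =>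
    if α < γ then Real.exp (-m - b i)
    else 2 + Real.exp (-m - b i) + Real.exp (m + b i)

/-- The vector `(n ^ (1 - γ/2) * x, (n ^ (1/2 - (γ - α)/2) * y i)_{i ∈ F})`. -/
def scaledError (γ α : ℝ) (n : ℕ) (F : Finset ℕ) (x : ℝ) (y : ℕ → ℝ) : Option F → ℝ
  | none => (n : ℝ) ^ (1 - γ / 2) * x
  | some i => (n : ℝ) ^ (1 / 2 - (γ - α) / 2) * y i

/-- `Σ ^ (-1/2)` for the diagonal matrix `Σ` with positive diagonal entries `d`. -/
def diagInvSqrt {ι : Type*} [DecidableEq ι] (d : ι → ℝ) : Matrix ι ι ℝ :=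
  Matrix.diagonal fun k => (Real.sqrt (d k))⁻¹

end SparseBeta

end

/-! An edge with `k` end points in `S` has odds of order n^(kα-γ), up to a factor exp(3 max(M₁, M₂))
= n^o(1) over the whole parameter space. For k ≤ 1 this order is at most 1, so the logistic
derivative has the same order; for k = 2 the odds may be large and only an upper bound survives. A
maximizer over a box obeys a one-sided score condition in each coordinate, and the sign of its error
shows which face it avoids: an estimate above the true value is not on the lower face, so its score
is nonnegative. Consistency therefore needs no interiority.

Take the node `i ∈ S` with the largest error. Its error plus that of any other node has the sign of
the error of `i`, so edges inside `S` contribute, by monotonicity, with the favourable sign up to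
the intercept shift, and the edges from `i` to the complement of `S` supply the curvature
(`LinkBound.node_sum_lower`). For the intercept the curvature comes from the edges outside `S`
(`LinkBound.intercept_sum_lower`). Write u and V for the intercept error and the maximal node error,
U and B for `interceptScale` and `nodeScale`, ρ for `suppRatio`. On typical graphs, which fail with
tiny probability by Bernstein's inequality and a union bound, V ≲ 1/B + u and u ≲ 1/U + ρV up to
small powers of n. Since ρ ≤ n^(-δ) beats those powers, the system closes (`Regime.rates`), which
gives (i).

For (ii), the estimate is eventually within η of the truth on typical graphs, hence interior, and
all scores vanish. The stronger sparsity says ρU ≤ n^(-δ) B, which improves u to order 1/U. The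
intercept score is linearized over edges outside `S` only, and the score of node `i` over edges from
`i` to the complement of `S` only; all other edges enter the remainder (`Regime.param_expansion`).
These cells are disjoint, so the leading terms are independent Bernoulli sums and the limit
covariance is diagonal. A product estimate for characteristic functions
(`norm_integral_exp_sum_sub_le`), the convergence of variances (`tendsto_variance_ratio`) and Lévy's
continuity theorem conclude. -/

namespace SparseBeta

/-! ### Estimates for the logistic function -/

/-- The derivative of the logistic function. -/
noncomputable def logisticDeriv (x : ℝ) : ℝ := x.sigmoid * (1 - x.sigmoid)

lemma linkProb_eq_sigmoid (μ : ℝ) (β : ℕ → ℝ) (i j : ℕ) :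
    linkProb μ β i j = Real.sigmoid (μ + β i + β j) := by
  rw [linkProb, Real.sigmoid_def, Real.exp_neg]
  field_simp
  ring

lemma logisticDeriv_pos (x : ℝ) : 0 < logisticDeriv x :=
  mul_pos (Real.sigmoid_pos x) (by linarith [Real.sigmoid_lt_one x])

lemma logisticDeriv_eq (x : ℝ) : logisticDeriv x = Real.exp x / (1 + Real.exp x) ^ 2 := by
  rw [logisticDeriv, Real.sigmoid_def, Real.exp_neg]
  field_simp
  ring

lemma logisticDeriv_le_exp (x : ℝ) : logisticDeriv x ≤ Real.exp x := by
  rw [logisticDeriv_eq, div_le_iff₀ (by positivity)]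
  nlinarith [Real.exp_pos x, mul_pos (Real.exp_pos x) (Real.exp_pos x)]

/-- In exp x / (1 + exp x)², the assumption `a ≤ 1` keeps the denominator below (2K)². Without it
the derivative could decay for large odds, which is why edges inside the support get no lower bound.
-/
lemma le_logisticDeriv {x a K : ℝ} (ha1 : a ≤ 1) (hK : 1 ≤ K)
    (h1 : a / K ≤ Real.exp x) (h2 : Real.exp x ≤ K * a) :
    a / (4 * K ^ 3) ≤ logisticDeriv x := by
  rw [logisticDeriv_eq]
  have h3 : 1 + Real.exp x ≤ 2 * K := by nlinarith
  have e : a / (4 * K ^ 3) = (a / K) / (2 * K) ^ 2 := by field_simp; ring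
  rw [e]
  gcongr

lemma sigmoid_sub_ge {x y L : ℝ} (hxy : x ≤ y)
    (h : ∀ z ∈ Set.Icc x y, L ≤ logisticDeriv z) :
    L * (y - x) ≤ y.sigmoid - x.sigmoid := by
  refine (convex_Icc x y).mul_sub_le_image_sub_of_le_deriv
    continuous_sigmoid.continuousOn differentiable_sigmoid.differentiableOn ?_
    x ⟨le_rfl, hxy⟩ y ⟨hxy, le_rfl⟩ hxy
  intro z hz
  rw [Real.deriv_sigmoid]
  exact h z (interior_subset hz)

lemma abs_sigmoid_sub_le {x y C : ℝ} (hx : Real.exp x ≤ C) (hy : Real.exp y ≤ C) :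
    |y.sigmoid - x.sigmoid| ≤ C * |y - x| := by
  refine (convex_uIcc x y).norm_image_sub_le_of_norm_hasDerivWithin_le (𝕜 := ℝ)
    (f := Real.sigmoid) (f' := logisticDeriv)
    (fun z _ => (Real.hasDerivAt_sigmoid z).hasDerivWithinAt) ?_ Set.left_mem_uIcc
    Set.right_mem_uIcc
  intro z hz
  rw [Real.norm_eq_abs, abs_of_pos (logisticDeriv_pos z)]
  refine (logisticDeriv_le_exp z).trans ?_
  rcases le_total x y with h | h
  · rw [Set.uIcc_of_le h] at hz
    exact (Real.exp_le_exp.2 hz.2).trans hy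
  · rw [Set.uIcc_of_ge h] at hz
    exact (Real.exp_le_exp.2 hz.2).trans hx

lemma hasDerivAt_logisticDeriv (x : ℝ) :
    HasDerivAt logisticDeriv (logisticDeriv x * (1 - 2 * x.sigmoid)) x := by
  have h := Real.hasDerivAt_sigmoid x
  refine (h.mul (h.const_sub 1)).congr_deriv ?_
  rw [logisticDeriv]
  ring

lemma abs_logisticDeriv_sub_le {x y C : ℝ} (hx : Real.exp x ≤ C) (hy : Real.exp y ≤ C) :
    |logisticDeriv y - logisticDeriv x| ≤ C * |y - x| := by
  refine (convex_uIcc x y).norm_image_sub_le_of_norm_hasDerivWithin_le (𝕜 := ℝ)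
    (f := logisticDeriv)
    (fun z _ => (hasDerivAt_logisticDeriv z).hasDerivWithinAt) ?_ Set.left_mem_uIcc
    Set.right_mem_uIcc
  intro z hz
  have h1 : |1 - 2 * z.sigmoid| ≤ 1 := by
    rw [abs_le]; constructor <;> linarith [Real.sigmoid_lt_one z, Real.sigmoid_pos z]
  rw [Real.norm_eq_abs, abs_mul, abs_of_pos (logisticDeriv_pos z)]
  refine (mul_le_of_le_one_right (logisticDeriv_pos z).le h1).trans
    ((logisticDeriv_le_exp z).trans ?_)
  rcases le_total x y with h | h
  · rw [Set.uIcc_of_le h] at hz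
    exact (Real.exp_le_exp.2 hz.2).trans hy
  · rw [Set.uIcc_of_ge h] at hz
    exact (Real.exp_le_exp.2 hz.2).trans hx

/-- Mean value inequality for the logistic function minus its linear part at `x`. The constant is
controlled by the odds, not by an absolute constant, so the error stays proportional to the small
edge probabilities of a sparse graph. -/
lemma abs_sigmoid_sub_linear_le {x y C : ℝ} (hx : Real.exp x ≤ C) (hy : Real.exp y ≤ C) :
    |y.sigmoid - x.sigmoid - logisticDeriv x * (y - x)| ≤ C * (y - x) ^ 2 := by
  have key := (convex_uIcc x y).norm_image_sub_le_of_norm_hasDerivWithin_le (𝕜 := ℝ)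
    (f := fun z => Real.sigmoid z - logisticDeriv x * z)
    (f' := fun z => logisticDeriv z - logisticDeriv x) (C := C * |y - x|)
    (fun z _ => ((Real.hasDerivAt_sigmoid z).sub
      (by simpa using (hasDerivAt_id z).const_mul (logisticDeriv x))).hasDerivWithinAt) ?_
    Set.left_mem_uIcc Set.right_mem_uIcc
  · rw [Real.norm_eq_abs, Real.norm_eq_abs, mul_assoc, abs_mul_abs_self, ← sq] at key
    refine le_trans (le_of_eq ?_) key
    congr 1
    ring
  · intro z hz
    have hzC : Real.exp z ≤ C := by
      rcases le_total x y with h | h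
      · rw [Set.uIcc_of_le h] at hz
        exact (Real.exp_le_exp.2 hz.2).trans hy
      · rw [Set.uIcc_of_ge h] at hz
        exact (Real.exp_le_exp.2 hz.2).trans hx
    refine (abs_logisticDeriv_sub_le hx hzC).trans ?_
    have hC : 0 ≤ C := (Real.exp_pos x).le.trans hx
    gcongr C * ?_
    exact Set.abs_sub_left_of_mem_uIcc hz

/-! ### Log odds and their uniform bounds over the parameter space -/

/-- Number of end points of an edge in `S`. -/
def endsIn (S : Finset ℕ) (e : ℕ × ℕ) : ℕ :=
  (if e.1 ∈ S then 1 else 0) + (if e.2 ∈ S then 1 else 0)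

/-- Sum of `b` over the end points of an edge in `S`. -/
noncomputable def endSum (S : Finset ℕ) (b : ℕ → ℝ) (e : ℕ × ℕ) : ℝ :=
  (if e.1 ∈ S then b e.1 else 0) + (if e.2 ∈ S then b e.2 else 0)

/-- Order of magnitude of the odds of an edge with `k` end points in the support. -/
noncomputable def edgeRate (γ α : ℝ) (n k : ℕ) : ℝ := (n : ℝ) ^ (k * α - γ)

/-- The log odds of an edge in terms of the scale-invariant parameters. -/
noncomputable def logOdds (γ α : ℝ) (n : ℕ) (S : Finset ℕ) (m : ℝ) (b : ℕ → ℝ) (e : ℕ × ℕ) : ℝ :=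
  muOf γ n m + betaOf α n S b e.1 + betaOf α n S b e.2

lemma logOdds_eq (γ α : ℝ) (n : ℕ) (S : Finset ℕ) (m : ℝ) (b : ℕ → ℝ) (e : ℕ × ℕ) :
    logOdds γ α n S m b e = (endsIn S e * α - γ) * Real.log n + m + endSum S b e := by
  unfold logOdds muOf betaOf endsIn endSum
  split_ifs <;> push_cast <;> ring

lemma logOdds_sub (γ α : ℝ) (n : ℕ) (S : Finset ℕ) (m m' : ℝ) (b b' : ℕ → ℝ) (e : ℕ × ℕ) :
    logOdds γ α n S m b e - logOdds γ α n S m' b' e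
      = (m - m') + endSum S (fun i => b i - b' i) e := by
  rw [logOdds_eq, logOdds_eq]
  unfold endSum
  split_ifs <;> ring

/-- Two-sided bounds, with a factor `κ`, for the odds and the logistic derivative over the
parameter space. -/
def LinkBound (γ α : ℝ) (n : ℕ) (S : Finset ℕ) (M₁ M₂ κ : ℝ) : Prop :=
  ∀ m b, InBox S M₁ M₂ m b → ∀ e : ℕ × ℕ,
    Real.exp (logOdds γ α n S m b e) ≤ κ * edgeRate γ α n (endsIn S e) ∧
    (endsIn S e ≤ 1 → ∀ m' b', InBox S M₁ M₂ m' b' →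
      ∀ z ∈ Set.Icc (logOdds γ α n S m b e) (logOdds γ α n S m' b' e),
        edgeRate γ α n (endsIn S e) / κ ≤ logisticDeriv z)

lemma edgeRate_pos {γ α : ℝ} {n : ℕ} (hn : 0 < n) (k : ℕ) : 0 < edgeRate γ α n k :=
  Real.rpow_pos_of_pos (by exact_mod_cast hn) _

lemma edgeRate_succ (γ α : ℝ) {n : ℕ} (hn : 0 < n) (k : ℕ) :
    edgeRate γ α n (k + 1) = (n : ℝ) ^ α * edgeRate γ α n k := by
  unfold edgeRate
  rw [← Real.rpow_add (by exact_mod_cast hn)]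
  congr 1; push_cast; ring

lemma edgeRate_le_one {γ α : ℝ} (hγ : 0 ≤ γ) (hαγ : α ≤ γ) {n : ℕ} (hn : 0 < n) {k : ℕ}
    (hk : k ≤ 1) : edgeRate γ α n k ≤ 1 := by
  apply Real.rpow_le_one_of_one_le_of_nonpos (by exact_mod_cast hn)
  interval_cases k <;> norm_num <;> linarith

/-- The exponent 3M collects M from the intercept and M from each of the at most two end points in
the support. -/
lemma exp_logOdds_bounds {γ α M₁ M₂ M m : ℝ} {n : ℕ} {S : Finset ℕ} {b : ℕ → ℝ} (hn : 0 < n)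
    (h1 : M₁ ≤ M) (h2 : M₂ ≤ M) (hM : 0 ≤ M) (h : InBox S M₁ M₂ m b) (e : ℕ × ℕ) :
    edgeRate γ α n (endsIn S e) / Real.exp (3 * M) ≤ Real.exp (logOdds γ α n S m b e) ∧
    Real.exp (logOdds γ α n S m b e) ≤ Real.exp (3 * M) * edgeRate γ α n (endsIn S e) := by
  have hn' : (0 : ℝ) < n := by exact_mod_cast hn
  obtain ⟨⟨h3, h4⟩, h5⟩ := h
  have h6 : 0 ≤ endSum S b e ∧ endSum S b e ≤ 2 * M := by
    unfold endSum
    split_ifs with ha hb hb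
    · have := h5 _ ha; have := h5 _ hb; constructor <;> linarith [this.1, this.2, (h5 _ ha).1, (h5 _ ha).2]
    · have := h5 _ ha; constructor <;> linarith [this.1, this.2]
    · have := h5 _ hb; constructor <;> linarith [this.1, this.2]
    · constructor <;> linarith
  have e1 : edgeRate γ α n (endsIn S e) = Real.exp ((endsIn S e * α - γ) * Real.log n) := by
    rw [edgeRate, Real.rpow_def_of_pos hn', mul_comm]
  rw [logOdds_eq, e1, ← Real.exp_sub, ← Real.exp_add, Real.exp_le_exp, Real.exp_le_exp]
  constructor <;> linarith [h6.1, h6.2]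

lemma linkBound_of_le {γ α M₁ M₂ M : ℝ} {n : ℕ} {S : Finset ℕ} (hγ : 0 ≤ γ) (hαγ : α ≤ γ)
    (hn : 0 < n) (h1 : M₁ ≤ M) (h2 : M₂ ≤ M) (hM : 0 ≤ M) :
    LinkBound γ α n S M₁ M₂ (4 * Real.exp (3 * M) ^ 3) := by
  intro m b h e
  obtain ⟨ha, hb⟩ := exp_logOdds_bounds (γ := γ) (α := α) hn h1 h2 hM h e
  have hK : 1 ≤ Real.exp (3 * M) := Real.one_le_exp (by linarith)
  have hr := edgeRate_pos (γ := γ) (α := α) hn (endsIn S e)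
  refine ⟨hb.trans ?_, fun hk m' b' h' z hz => ?_⟩
  · gcongr
    nlinarith [pow_le_pow_right₀ hK (show 1 ≤ 3 by norm_num)]
  · exact le_logisticDeriv (edgeRate_le_one hγ hαγ hn hk) hK
      (ha.trans (Real.exp_le_exp.2 hz.1)) ((Real.exp_le_exp.2 hz.2).trans
        (exp_logOdds_bounds (γ := γ) (α := α) hn h1 h2 hM h' e).2)

/-! ### Log-likelihood and the sign conditions on the score -/

section

/-- One-sided Fermat rule: a maximizer on a face of the box can be compared with points on one side
only, and the difference quotients from that side still fix the sign of the derivative. -/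
lemma nonneg_of_hasDerivAt_of_max_left {g : ℝ → ℝ} {g' lo x : ℝ} (hg : HasDerivAt g g' x)
    (hx : lo < x) (hmax : ∀ y ∈ Set.Icc lo x, g y ≤ g x) : 0 ≤ g' := by
  have h := (hasDerivAt_iff_tendsto_slope.1 hg).mono_left
    (nhdsWithin_mono x (fun y (hy : y < x) => hy.ne) : 𝓝[<] x ≤ 𝓝[≠] x)
  refine ge_of_tendsto h ?_
  filter_upwards [Ioo_mem_nhdsLT hx] with y hy
  rw [slope_def_field]
  exact div_nonneg_of_nonpos (by linarith [hmax y ⟨hy.1.le, hy.2.le⟩]) (by linarith [hy.2])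

lemma nonpos_of_hasDerivAt_of_max_right {g : ℝ → ℝ} {g' hi x : ℝ} (hg : HasDerivAt g g' x)
    (hx : x < hi) (hmax : ∀ y ∈ Set.Icc x hi, g y ≤ g x) : g' ≤ 0 := by
  have h := (hasDerivAt_iff_tendsto_slope.1 hg).mono_left
    (nhdsWithin_mono x (fun y (hy : x < y) => hy.ne') : 𝓝[>] x ≤ 𝓝[≠] x)
  refine le_of_tendsto h ?_
  filter_upwards [Ioo_mem_nhdsGT hx] with y hy
  rw [slope_def_field]
  exact div_nonpos_of_nonpos_of_nonneg (by linarith [hmax y ⟨hy.1.le, hy.2.le⟩])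
    (by linarith [hy.1])

/-- The log-likelihood of the log odds `θ`. -/
noncomputable def logLik (n : ℕ) (a : ℕ → ℕ → ℝ) (θ : ℕ × ℕ → ℝ) : ℝ :=
  ∑ e ∈ edgePairs n, (a e.1 e.2 * θ e - Real.log (1 + Real.exp (θ e)))

lemma likelihood_eq_exp_logLik {n : ℕ} {a : ℕ → ℕ → ℝ}
    (ha : ∀ e ∈ edgePairs n, a e.1 e.2 = 0 ∨ a e.1 e.2 = 1) (μ : ℝ) (β : ℕ → ℝ) :
    likelihood n a μ β = Real.exp (logLik n a fun e => μ + β e.1 + β e.2) := by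
  unfold likelihood logLik
  rw [Real.exp_sum]
  refine Finset.prod_congr rfl fun e he => ?_
  have hp : 0 < 1 + Real.exp (μ + β e.1 + β e.2) := by positivity
  unfold linkProb
  rcases ha e he with h | h
  · rw [h, if_neg (by norm_num), zero_mul, zero_sub, Real.exp_neg, Real.exp_log hp]
    field_simp
    ring
  · rw [h, if_pos rfl, one_mul, Real.exp_sub, Real.exp_log hp]

/-- The direction `k` is the constant 1 for the intercept score and the indicator of the edges at
`i` for the score of node `i`. -/
lemma hasDerivAt_logLik (n : ℕ) (a : ℕ → ℕ → ℝ) (θ k : ℕ × ℕ → ℝ) (x : ℝ) :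
    HasDerivAt (fun t => logLik n a fun e => θ e + (t - x) * k e)
      (∑ e ∈ edgePairs n, (a e.1 e.2 - (θ e).sigmoid) * k e) x := by
  unfold logLik
  refine HasDerivAt.fun_sum fun e _ => ?_
  have h1 : HasDerivAt (fun t => θ e + (t - x) * k e) (k e) x := by
    simpa using (((hasDerivAt_id x).sub_const x).mul_const (k e)).const_add (θ e)
  have h2 := (h1.const_mul (a e.1 e.2)).sub ((h1.exp.const_add 1).log
    (by positivity))
  refine h2.congr_deriv ?_
  simp only [sub_self, zero_mul, add_zero]
  rw [Real.sigmoid_def, Real.exp_neg]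
  field_simp
  ring

/-- Edges incident to the node `i`. -/
def incEdges (n i : ℕ) : Finset (ℕ × ℕ) := (edgePairs n).filter fun e => e.1 = i ∨ e.2 = i

/-- Fitted or true edge probability in terms of the scale-invariant parameters. -/
noncomputable def edgeProb (γ α : ℝ) (n : ℕ) (S : Finset ℕ) (m : ℝ) (b : ℕ → ℝ) (e : ℕ × ℕ) : ℝ :=
  (logOdds γ α n S m b e).sigmoid

variable {γ α M₁ M₂ m : ℝ} {n : ℕ} {S : Finset ℕ} {a : ℕ → ℕ → ℝ} {b : ℕ → ℝ}

lemma IsMLE.logLik_le (h : IsMLE γ α n S M₁ M₂ a m b)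
    (ha : ∀ e ∈ edgePairs n, a e.1 e.2 = 0 ∨ a e.1 e.2 = 1)
    {m' : ℝ} {b' : ℕ → ℝ} (h' : InBox S M₁ M₂ m' b') :
    logLik n a (logOdds γ α n S m' b') ≤ logLik n a (logOdds γ α n S m b) := by
  have := h.2 m' b' h'
  rwa [likelihood_eq_exp_logLik ha, likelihood_eq_exp_logLik ha, Real.exp_le_exp] at this

lemma logLik_intercept_line (t : ℝ) :
    logLik n a (fun e => logOdds γ α n S m b e + (t - m))
      = logLik n a (logOdds γ α n S t b) := by
  congr 1
  funext e
  rw [logOdds_eq, logOdds_eq]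
  ring

lemma logLik_node_line {i : ℕ} (hi : i ∈ S) (t : ℝ) :
    logLik n a (fun e => logOdds γ α n S m b e
        + (t - b i) * (if e.1 = i ∨ e.2 = i then 1 else 0))
      = logLik n a (logOdds γ α n S m (Function.update b i t)) := by
  unfold logLik
  refine Finset.sum_congr rfl fun e he => ?_
  -- There are no loops, so changing `b i` shifts the log odds of an edge at `i` exactly once.
  have hne : e.1 ≠ e.2 := (Finset.mem_filter.1 he).2.ne
  have key : logOdds γ α n S m b e + (t - b i) * (if e.1 = i ∨ e.2 = i then 1 else 0)
      = logOdds γ α n S m (Function.update b i t) e := by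
    rw [logOdds_eq, logOdds_eq]
    unfold endSum
    by_cases h1 : e.1 = i
    · have h2 : e.2 ≠ i := fun h => hne (h1.trans h.symm)
      simp [h1, hi, Function.update_of_ne h2]
      ring
    · by_cases h2 : e.2 = i
      · simp [h2, hi, Function.update_of_ne h1]
        ring
      · simp [h1, h2]
  simp only [key]

lemma inBox_update (h : InBox S M₁ M₂ m b) {i : ℕ} {t : ℝ} (ht : t ∈ Set.Icc 0 M₂) :
    InBox S M₁ M₂ m (Function.update b i t) := by
  refine ⟨h.1, fun j hj => ?_⟩
  by_cases hji : j = i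
  · subst hji; simpa using ht
  · rw [Function.update_of_ne hji]; exact h.2 j hj

/-- Off the lower face, `m` may be decreased within the box, so the derivative of the log-likelihood
cannot be negative. The next lemma and the two node versions below are the other admissible
directions. -/
lemma IsMLE.score_intercept_nonneg (h : IsMLE γ α n S M₁ M₂ a m b)
    (ha : ∀ e ∈ edgePairs n, a e.1 e.2 = 0 ∨ a e.1 e.2 = 1) (hm : -M₁ < m) :
    0 ≤ ∑ e ∈ edgePairs n, (a e.1 e.2 - edgeProb γ α n S m b e) := by
  have hd := hasDerivAt_logLik n a (logOdds γ α n S m b) (fun _ => 1) m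
  simp only [mul_one, logLik_intercept_line] at hd
  exact nonneg_of_hasDerivAt_of_max_left hd hm fun y hy =>
    h.logLik_le ha ⟨⟨hy.1, hy.2.trans h.1.1.2⟩, h.1.2⟩

lemma IsMLE.score_intercept_nonpos (h : IsMLE γ α n S M₁ M₂ a m b)
    (ha : ∀ e ∈ edgePairs n, a e.1 e.2 = 0 ∨ a e.1 e.2 = 1) (hm : m < M₁) :
    ∑ e ∈ edgePairs n, (a e.1 e.2 - edgeProb γ α n S m b e) ≤ 0 := by
  have hd := hasDerivAt_logLik n a (logOdds γ α n S m b) (fun _ => 1) m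
  simp only [mul_one, logLik_intercept_line] at hd
  exact nonpos_of_hasDerivAt_of_max_right hd hm fun y hy =>
    h.logLik_le ha ⟨⟨h.1.1.1.trans hy.1, hy.2⟩, h.1.2⟩

lemma sum_mul_ite_inc (f : ℕ × ℕ → ℝ) (i : ℕ) :
    ∑ e ∈ edgePairs n, f e * (if e.1 = i ∨ e.2 = i then 1 else 0) = ∑ e ∈ incEdges n i, f e := by
  rw [incEdges, Finset.sum_filter]
  exact Finset.sum_congr rfl fun e _ => by split_ifs <;> simp

lemma hasDerivAt_logLik_node {i : ℕ} (hi : i ∈ S) :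
    HasDerivAt (fun t => logLik n a (logOdds γ α n S m (Function.update b i t)))
      (∑ e ∈ incEdges n i, (a e.1 e.2 - edgeProb γ α n S m b e)) (b i) := by
  have hd := hasDerivAt_logLik n a (logOdds γ α n S m b)
    (fun e => if e.1 = i ∨ e.2 = i then 1 else 0) (b i)
  rw [sum_mul_ite_inc] at hd
  simpa only [logLik_node_line hi, edgeProb] using hd

lemma IsMLE.score_node_nonneg (h : IsMLE γ α n S M₁ M₂ a m b)
    (ha : ∀ e ∈ edgePairs n, a e.1 e.2 = 0 ∨ a e.1 e.2 = 1) {i : ℕ} (hi : i ∈ S)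
    (hb : 0 < b i) :
    0 ≤ ∑ e ∈ incEdges n i, (a e.1 e.2 - edgeProb γ α n S m b e) := by
  refine nonneg_of_hasDerivAt_of_max_left (hasDerivAt_logLik_node hi) hb fun y hy => ?_
  simpa using h.logLik_le ha (inBox_update h.1 ⟨hy.1, hy.2.trans (h.1.2 i hi).2⟩)

lemma IsMLE.score_node_nonpos (h : IsMLE γ α n S M₁ M₂ a m b)
    (ha : ∀ e ∈ edgePairs n, a e.1 e.2 = 0 ∨ a e.1 e.2 = 1) {i : ℕ} (hi : i ∈ S)
    (hb : b i < M₂) :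
    ∑ e ∈ incEdges n i, (a e.1 e.2 - edgeProb γ α n S m b e) ≤ 0 := by
  refine nonpos_of_hasDerivAt_of_max_right (hasDerivAt_logLik_node hi) hb fun y hy => ?_
  simpa using h.logLik_le ha (inBox_update h.1 ⟨(h.1.2 i hi).1.trans hy.1, hy.2⟩)

end

/-! ### Counting edges by their end points in the support -/

section

/-- Edges with `k` end points in `S`. -/
def classEdges (n : ℕ) (S : Finset ℕ) (k : ℕ) : Finset (ℕ × ℕ) :=
  (edgePairs n).filter fun e => endsIn S e = k

/-- Edges at the node `i` with `k` end points in `S`. -/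
def incClass (n : ℕ) (S : Finset ℕ) (i k : ℕ) : Finset (ℕ × ℕ) :=
  (incEdges n i).filter fun e => endsIn S e = k

variable {n : ℕ} {S : Finset ℕ}

lemma mem_edgePairs {e : ℕ × ℕ} : e ∈ edgePairs n ↔ e.1 < n ∧ e.2 < n ∧ e.1 < e.2 := by
  simp [edgePairs, and_assoc]

lemma endsIn_le_two (S : Finset ℕ) (e : ℕ × ℕ) : endsIn S e ≤ 2 := by
  unfold endsIn; split_ifs <;> simp

lemma endsIn_eq_zero {e : ℕ × ℕ} : endsIn S e = 0 ↔ e.1 ∉ S ∧ e.2 ∉ S := by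
  unfold endsIn; split_ifs <;> simp_all

lemma endsIn_eq_two {e : ℕ × ℕ} : endsIn S e = 2 ↔ e.1 ∈ S ∧ e.2 ∈ S := by
  unfold endsIn; split_ifs <;> simp_all

lemma sum_edgePairs_eq (n : ℕ) (S : Finset ℕ) (f : ℕ × ℕ → ℝ) :
    ∑ e ∈ edgePairs n, f e = ∑ e ∈ classEdges n S 0, f e + ∑ e ∈ classEdges n S 1, f e
      + ∑ e ∈ classEdges n S 2, f e := by
  unfold classEdges
  rw [Finset.sum_filter, Finset.sum_filter, Finset.sum_filter, ← Finset.sum_add_distrib,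
    ← Finset.sum_add_distrib]
  refine Finset.sum_congr rfl fun e _ => ?_
  have := endsIn_le_two S e
  interval_cases endsIn S e <;> simp

lemma endsIn_pos_of_inc {i : ℕ} (hi : i ∈ S) {e : ℕ × ℕ} (he : e ∈ incEdges n i) :
    endsIn S e ≠ 0 := by
  rw [Ne, endsIn_eq_zero]
  rintro ⟨h1, h2⟩
  rcases (Finset.mem_filter.1 he).2 with h | h
  · exact h1 (h ▸ hi)
  · exact h2 (h ▸ hi)

lemma sum_incEdges_eq {i : ℕ} (hi : i ∈ S) (f : ℕ × ℕ → ℝ) :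
    ∑ e ∈ incEdges n i, f e = ∑ e ∈ incClass n S i 1, f e + ∑ e ∈ incClass n S i 2, f e := by
  unfold incClass
  rw [Finset.sum_filter, Finset.sum_filter, ← Finset.sum_add_distrib]
  refine Finset.sum_congr rfl fun e he => ?_
  have := endsIn_le_two S e
  have := endsIn_pos_of_inc hi he
  interval_cases endsIn S e <;> simp_all

lemma endSum_of_mem_incClass_one {i : ℕ} (hi : i ∈ S) {e : ℕ × ℕ} (he : e ∈ incClass n S i 1)
    (v : ℕ → ℝ) : endSum S v e = v i := by
  simp only [incClass, incEdges, Finset.mem_filter] at he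
  obtain ⟨⟨_, h⟩, h2⟩ := he
  unfold endsIn at h2
  unfold endSum
  rcases h with rfl | rfl <;> split_ifs at h2 ⊢ <;> simp_all

lemma endSum_of_mem_incClass_two {i : ℕ} {e : ℕ × ℕ} (he : e ∈ incClass n S i 2)
    (v : ℕ → ℝ) : ∃ j ∈ S, endSum S v e = v i + v j := by
  simp only [incClass, incEdges, Finset.mem_filter, endsIn_eq_two] at he
  unfold endSum
  obtain ⟨⟨_, h⟩, h2, h3⟩ := he
  rcases h with rfl | rfl
  · exact ⟨_, h3, by simp [h2, h3]⟩
  · exact ⟨_, h2, by simp [h2, h3, add_comm]⟩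

lemma incClass_subset_classEdges (n : ℕ) (S : Finset ℕ) (i k : ℕ) :
    incClass n S i k ⊆ classEdges n S k := by
  intro e he
  simp only [incClass, incEdges, classEdges, Finset.mem_filter] at he ⊢
  exact ⟨he.1.1, he.2⟩

/-- The edge that joins `i` and `j`. -/
def joinEdge (i j : ℕ) : ℕ × ℕ := (min i j, max i j)

lemma joinEdge_injective (i : ℕ) : Function.Injective (joinEdge i) := by
  intro j k h
  simp only [joinEdge, Prod.mk.injEq] at h
  omega

lemma incEdges_eq_image {i : ℕ} (hi : i < n) :
    incEdges n i = ((Finset.range n).erase i).image (joinEdge i) := by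
  ext ⟨x, y⟩
  simp only [incEdges, Finset.mem_filter, mem_edgePairs, Finset.mem_image, Finset.mem_erase,
    Finset.mem_range, joinEdge, Prod.mk.injEq]
  constructor
  · rintro ⟨⟨h1, h2, h3⟩, h | h⟩
    · exact ⟨y, by omega, by omega, by omega⟩
    · exact ⟨x, by omega, by omega, by omega⟩
  · rintro ⟨j, h1, h2, h3⟩
    omega

lemma endsIn_joinEdge (S : Finset ℕ) (i j : ℕ) :
    endsIn S (joinEdge i j) = (if i ∈ S then 1 else 0) + (if j ∈ S then 1 else 0) := by
  unfold endsIn joinEdge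
  rcases le_total i j with h | h <;> simp [h, add_comm]

/-- The other end points are exactly the nodes outside `S`. The count must be exact because it
enters the limit variance; edges inside `S` need upper bounds only. -/
lemma card_incClass_one (hS : S ⊆ Finset.range n) {i : ℕ} (hi : i ∈ S) :
    (incClass n S i 1).card = n - S.card := by
  have hin : i < n := Finset.mem_range.1 (hS hi)
  have : incClass n S i 1 = (Finset.range n \ S).image (joinEdge i) := by
    rw [incClass, incEdges_eq_image hin, Finset.filter_image]
    congr 1
    ext j
    simp only [Finset.mem_filter, Finset.mem_erase, Finset.mem_range, endsIn_joinEdge, hi,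
      if_true, Finset.mem_sdiff]
    constructor
    · rintro ⟨⟨_, h⟩, h2⟩
      exact ⟨h, fun hj => by simp [hj] at h2⟩
    · rintro ⟨h, h2⟩
      exact ⟨⟨fun h3 => h2 (h3 ▸ hi), h⟩, by simp [h2]⟩
  rw [this, Finset.card_image_of_injective _ (joinEdge_injective i), Finset.card_sdiff_of_subset hS,
    Finset.card_range]

lemma card_incClass_two_le (hS : S ⊆ Finset.range n) {i : ℕ} (hi : i ∈ S) :
    (incClass n S i 2).card ≤ S.card := by
  have hin : i < n := Finset.mem_range.1 (hS hi)
  have : incClass n S i 2 ⊆ S.image (joinEdge i) := by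
    rw [incClass, incEdges_eq_image hin, Finset.filter_image]
    refine Finset.image_subset_image fun j hj => ?_
    simp only [Finset.mem_filter, endsIn_joinEdge, hi, if_true] at hj
    by_contra h
    simp [h] at hj
  exact (Finset.card_le_card this).trans Finset.card_image_le

lemma card_classEdges_one_le (hS : S ⊆ Finset.range n) :
    (classEdges n S 1).card ≤ S.card * n := by
  have : classEdges n S 1 ⊆ S.biUnion fun i => incClass n S i 1 := by
    intro e he
    simp only [classEdges, Finset.mem_filter] at he
    have h1 := he.2
    unfold endsIn at h1
    simp only [Finset.mem_biUnion, incClass, incEdges, Finset.mem_filter]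
    by_cases h2 : e.1 ∈ S
    · exact ⟨e.1, h2, ⟨he.1, Or.inl rfl⟩, he.2⟩
    · refine ⟨e.2, ?_, ⟨he.1, Or.inr rfl⟩, he.2⟩
      by_contra h3
      simp [h2, h3] at h1
  refine (Finset.card_le_card this).trans (Finset.card_biUnion_le_card_mul _ _ _ fun i hi => ?_)
  rw [card_incClass_one hS hi]
  exact Nat.sub_le _ _

lemma card_classEdges_two_le : (classEdges n S 2).card ≤ S.card * S.card := by
  rw [← Finset.card_product]
  refine Finset.card_le_card fun e he => ?_
  simp only [classEdges, Finset.mem_filter, endsIn_eq_two] at he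
  exact Finset.mem_product.2 he.2

/-- Swapping coordinates matches increasing with decreasing pairs, and together they make up the
off-diagonal. -/
lemma two_mul_card_filter_lt (t : Finset ℕ) :
    2 * ((t ×ˢ t).filter fun e => e.1 < e.2).card = t.card * (t.card - 1) := by
  have h1 : ((t ×ˢ t).filter fun e => e.1 < e.2).card
      = ((t ×ˢ t).filter fun e => e.2 < e.1).card := by
    refine Finset.card_bij (fun e _ => (e.2, e.1)) ?_ ?_ ?_
    · simp +contextual
    · simp +contextual [Prod.ext_iff]
    · rintro ⟨x, y⟩ h
      exact ⟨(y, x), by simp_all, rfl⟩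
  have h2 : t.offDiag = ((t ×ˢ t).filter fun e => e.1 < e.2)
      ∪ ((t ×ˢ t).filter fun e => e.2 < e.1) := by
    ext ⟨x, y⟩
    simp only [Finset.mem_offDiag, Finset.mem_union, Finset.mem_filter, Finset.mem_product]
    constructor
    · rintro ⟨hx, hy, h⟩
      rcases lt_or_gt_of_ne h with h | h <;> simp [hx, hy, h]
    · rintro (⟨⟨hx, hy⟩, h⟩ | ⟨⟨hx, hy⟩, h⟩)
      · exact ⟨hx, hy, h.ne⟩
      · exact ⟨hx, hy, h.ne'⟩
  have h3 := congrArg Finset.card h2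
  rw [Finset.offDiag_card, Finset.card_union_of_disjoint, ← h1] at h3
  · rw [two_mul, ← h3, Nat.mul_sub, mul_one]
  · rw [Finset.disjoint_filter]
    intro e _ h
    exact h.asymm

lemma two_mul_card_classEdges_zero (hS : S ⊆ Finset.range n) :
    2 * (classEdges n S 0).card = (n - S.card) * (n - S.card - 1) := by
  have h := two_mul_card_filter_lt (Finset.range n \ S)
  rw [Finset.card_sdiff_of_subset hS, Finset.card_range] at h
  rw [← h]
  congr 2
  ext ⟨x, y⟩
  simp only [classEdges, Finset.mem_filter, mem_edgePairs, endsIn_eq_zero, Finset.mem_product,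
    Finset.mem_sdiff, Finset.mem_range]
  tauto

end

/-! ### Deterministic error inequalities from the score conditions -/

section

variable {γ α M₁ M₂ κ : ℝ} {n : ℕ} {S : Finset ℕ} {m m₀ : ℝ} {b b₀ : ℕ → ℝ}

lemma LinkBound.mul_le_edgeProb_sub (hL : LinkBound γ α n S M₁ M₂ κ) (h : InBox S M₁ M₂ m b)
    (h₀ : InBox S M₁ M₂ m₀ b₀) {e : ℕ × ℕ} (he : endsIn S e ≤ 1)
    (hd : 0 ≤ (m - m₀) + endSum S (fun i => b i - b₀ i) e) :
    edgeRate γ α n (endsIn S e) / κ * ((m - m₀) + endSum S (fun i => b i - b₀ i) e)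
      ≤ edgeProb γ α n S m b e - edgeProb γ α n S m₀ b₀ e := by
  rw [← logOdds_sub γ α n S] at hd ⊢
  exact sigmoid_sub_ge (by linarith) ((hL m₀ b₀ h₀ e).2 he m b h)

lemma LinkBound.abs_edgeProb_sub_le (hL : LinkBound γ α n S M₁ M₂ κ) (h : InBox S M₁ M₂ m b)
    (h₀ : InBox S M₁ M₂ m₀ b₀) (e : ℕ × ℕ) :
    |edgeProb γ α n S m b e - edgeProb γ α n S m₀ b₀ e|
      ≤ κ * edgeRate γ α n (endsIn S e) * |(m - m₀) + endSum S (fun i => b i - b₀ i) e| := by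
  rw [← logOdds_sub γ α n S]
  exact abs_sigmoid_sub_le (hL m₀ b₀ h₀ e).1 (hL m b h e).1

lemma LinkBound.abs_edgeProb_sub_linear_le (hL : LinkBound γ α n S M₁ M₂ κ)
    (h : InBox S M₁ M₂ m b) (h₀ : InBox S M₁ M₂ m₀ b₀) (e : ℕ × ℕ) :
    |edgeProb γ α n S m b e - edgeProb γ α n S m₀ b₀ e
        - logisticDeriv (logOdds γ α n S m₀ b₀ e)
          * ((m - m₀) + endSum S (fun i => b i - b₀ i) e)|
      ≤ κ * edgeRate γ α n (endsIn S e)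
        * ((m - m₀) + endSum S (fun i => b i - b₀ i) e) ^ 2 := by
  rw [← logOdds_sub γ α n S]
  exact abs_sigmoid_sub_linear_le (hL m₀ b₀ h₀ e).1 (hL m b h e).1

lemma edgeProb_mono_intercept (h : m₀ ≤ m) (e : ℕ × ℕ) :
    edgeProb γ α n S m₀ b e ≤ edgeProb γ α n S m b e := by
  refine Real.sigmoid_le ?_
  rw [logOdds_eq, logOdds_eq]
  linarith

lemma endSum_zero (e : ℕ × ℕ) : endSum S (fun _ => 0) e = 0 := by
  simp [endSum]

lemma LinkBound.abs_edgeProb_intercept_le (hL : LinkBound γ α n S M₁ M₂ κ)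
    (h : InBox S M₁ M₂ m b) (h₀ : InBox S M₁ M₂ m₀ b) (e : ℕ × ℕ) :
    |edgeProb γ α n S m b e - edgeProb γ α n S m₀ b e|
      ≤ κ * edgeRate γ α n (endsIn S e) * |m - m₀| := by
  simpa [endSum_zero] using hL.abs_edgeProb_sub_le h h₀ e

/-- Passing through the intermediate point `(m, b₀)`, which also lies in the box, separates the gain
from the node parameters from the cost of the intercept shift. -/
lemma LinkBound.node_lower_of_one (hL : LinkBound γ α n S M₁ M₂ κ) (h : InBox S M₁ M₂ m b)
    (h₀ : InBox S M₁ M₂ m₀ b₀) {e : ℕ × ℕ} (he : endsIn S e ≤ 1)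
    (hd : 0 ≤ endSum S (fun i => b i - b₀ i) e) :
    edgeRate γ α n (endsIn S e) / κ * endSum S (fun i => b i - b₀ i) e
        - κ * edgeRate γ α n (endsIn S e) * |m - m₀|
      ≤ edgeProb γ α n S m b e - edgeProb γ α n S m₀ b₀ e := by
  have hmid : InBox S M₁ M₂ m b₀ := ⟨h.1, h₀.2⟩
  have h1 := hL.mul_le_edgeProb_sub h hmid he (by simpa using hd)
  have h2 := abs_le.1 (hL.abs_edgeProb_intercept_le hmid h₀ e)
  rw [sub_self, zero_add] at h1
  linarith [h2.1]

/-- Valid also for edges inside the support, where no lower bound on the derivative is available: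
monotonicity makes the node part nonnegative, and only the intercept shift costs anything. -/
lemma LinkBound.node_lower (hL : LinkBound γ α n S M₁ M₂ κ) (h : InBox S M₁ M₂ m b)
    (h₀ : InBox S M₁ M₂ m₀ b₀) {e : ℕ × ℕ}
    (hd : 0 ≤ endSum S (fun i => b i - b₀ i) e) :
    - (κ * edgeRate γ α n (endsIn S e) * |m - m₀|)
      ≤ edgeProb γ α n S m b e - edgeProb γ α n S m₀ b₀ e := by
  have hmid : InBox S M₁ M₂ m b₀ := ⟨h.1, h₀.2⟩
  have h1 : edgeProb γ α n S m b₀ e ≤ edgeProb γ α n S m b e := by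
    refine Real.sigmoid_le ?_
    have := logOdds_sub γ α n S m m b b₀ e
    linarith
  have h2 := abs_le.1 (hL.abs_edgeProb_intercept_le hmid h₀ e)
  linarith [h2.1]

lemma maxAbs_nonneg (S : Finset ℕ) (v : ℕ → ℝ) : 0 ≤ maxAbs S v := NNReal.coe_nonneg _

lemma abs_le_maxAbs {v : ℕ → ℝ} {i : ℕ} (hi : i ∈ S) : |v i| ≤ maxAbs S v := by
  have := Finset.le_sup (f := fun i => ‖v i‖₊) hi
  exact_mod_cast this

lemma exists_abs_eq_maxAbs (hS : S.Nonempty) (v : ℕ → ℝ) : ∃ i ∈ S, |v i| = maxAbs S v := by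
  obtain ⟨i, hi, h⟩ := Finset.exists_mem_eq_sup S hS (fun i => ‖v i‖₊)
  refine ⟨i, hi, ?_⟩
  rw [maxAbs, h]
  simp

lemma abs_endSum_le (v : ℕ → ℝ) (e : ℕ × ℕ) : |endSum S v e| ≤ endsIn S e * maxAbs S v := by
  unfold endSum endsIn
  split_ifs with h1 h2 h2
  · refine (abs_add_le _ _).trans ?_
    push_cast
    linarith [abs_le_maxAbs (v := v) h1, abs_le_maxAbs (v := v) h2]
  · simpa using abs_le_maxAbs (v := v) h1
  · simpa using abs_le_maxAbs (v := v) h2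
  · simp

lemma LinkBound.pos (hL : LinkBound γ α n S M₁ M₂ κ) (h : InBox S M₁ M₂ m b) (hn : 0 < n) :
    0 < κ := by
  have := (Real.exp_pos _).trans_le (hL m b h (0, 0)).1
  exact pos_of_mul_pos_left this (edgeRate_pos hn _).le

lemma classEdges_ends {k : ℕ} {e : ℕ × ℕ} (he : e ∈ classEdges n S k) : endsIn S e = k :=
  (Finset.mem_filter.1 he).2

lemma incClass_ends {i k : ℕ} {e : ℕ × ℕ} (he : e ∈ incClass n S i k) : endsIn S e = k :=
  (Finset.mem_filter.1 he).2

lemma card_nsmul_le_sum' {ι : Type*} (s : Finset ι) (f : ι → ℝ) (c : ℝ) (h : ∀ x ∈ s, c ≤ f x) :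
    (s.card : ℝ) * c ≤ ∑ x ∈ s, f x := by
  simpa using Finset.card_nsmul_le_sum s f c h

/-- Edges from `i` to the complement of `S` respond to the error of `i` alone and give the main
term. An edge to `j ∈ S` responds to the sum of two errors, which is nonnegative because the error
of `i` is maximal in absolute value. -/
lemma LinkBound.node_sum_lower (hL : LinkBound γ α n S M₁ M₂ κ) (hS : S ⊆ Finset.range n)
    (h : InBox S M₁ M₂ m b) (h₀ : InBox S M₁ M₂ m₀ b₀) {i : ℕ} (hi : i ∈ S)
    (hmax : |b i - b₀ i| = maxAbs S fun i => b i - b₀ i) (hpos : 0 ≤ b i - b₀ i) :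
    ((n : ℝ) - S.card) * edgeRate γ α n 1 / κ * (b i - b₀ i)
        - κ * (((n : ℝ) - S.card) * edgeRate γ α n 1 + S.card * edgeRate γ α n 2) * |m - m₀|
      ≤ ∑ e ∈ incEdges n i, (edgeProb γ α n S m b e - edgeProb γ α n S m₀ b₀ e) := by
  have hn : 0 < n := (Nat.zero_le _).trans_lt (Finset.mem_range.1 (hS hi))
  have hκ := hL.pos h hn
  have hr := edgeRate_pos (γ := γ) (α := α) hn 2
  rw [sum_incEdges_eq hi]
  have h1 := card_nsmul_le_sum' (incClass n S i 1)
    (fun e => edgeProb γ α n S m b e - edgeProb γ α n S m₀ b₀ e)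
    (edgeRate γ α n 1 / κ * (b i - b₀ i) - κ * edgeRate γ α n 1 * |m - m₀|) (by
      intro e he
      have hs := endSum_of_mem_incClass_one hi he (fun i => b i - b₀ i)
      have hk := incClass_ends he
      have := hL.node_lower_of_one h h₀ hk.le (hs.symm ▸ hpos)
      rwa [hs, hk] at this)
  have h2 := card_nsmul_le_sum' (incClass n S i 2)
    (fun e => edgeProb γ α n S m b e - edgeProb γ α n S m₀ b₀ e)
    (- (κ * edgeRate γ α n 2 * |m - m₀|)) (by
      intro e he
      obtain ⟨j, hj, hs⟩ := endSum_of_mem_incClass_two he (fun i => b i - b₀ i)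
      have hk := incClass_ends he
      -- Maximality at `i` prevents the error of `j` from outweighing that of `i`.
      have hj' := abs_le.1 (abs_le_maxAbs (v := fun i => b i - b₀ i) hj)
      rw [abs_of_nonneg hpos] at hmax
      have := hL.node_lower h h₀ (e := e) (by rw [hs]; linarith [hj'.1])
      rwa [hk] at this)
  have hsn : S.card ≤ n := by simpa using Finset.card_le_card hS
  rw [card_incClass_one hS hi, Nat.cast_sub hsn] at h1
  have h3 : ((incClass n S i 2).card : ℝ) ≤ S.card := by
    exact_mod_cast card_incClass_two_le hS hi
  have h4 : ((incClass n S i 2).card : ℝ) * (κ * edgeRate γ α n 2 * |m - m₀|)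
      ≤ S.card * (κ * edgeRate γ α n 2 * |m - m₀|) := by gcongr
  refine le_trans (le_trans (le_of_eq ?_) (sub_le_sub_left h4 (((n : ℝ) - S.card)
    * (edgeRate γ α n 1 / κ * (b i - b₀ i) - κ * edgeRate γ α n 1 * |m - m₀|)))) ?_
  · ring
  · linarith

lemma maxAbs_sub_comm (S : Finset ℕ) (b b₀ : ℕ → ℝ) :
    maxAbs S (fun i => b i - b₀ i) = maxAbs S (fun i => b₀ i - b i) := by
  unfold maxAbs
  congr 2
  funext i
  exact NNReal.eq (norm_sub_rev _ _)

/-- At the node of maximal error, the score condition bounds the change of the expected degree by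
the deviation of the observed degree from its true mean, while `LinkBound.node_sum_lower` bounds
that change from below. -/
lemma LinkBound.maxAbs_node_le (hL : LinkBound γ α n S M₁ M₂ κ) (hS : S ⊆ Finset.range n)
    {a : ℕ → ℕ → ℝ} (ha : ∀ e ∈ edgePairs n, a e.1 e.2 = 0 ∨ a e.1 e.2 = 1)
    (h : IsMLE γ α n S M₁ M₂ a m b) (h₀ : InBox S M₁ M₂ m₀ b₀) {τ : ℝ} (hne : S.Nonempty)
    (hT : ∀ i ∈ S, |∑ e ∈ incEdges n i, (a e.1 e.2 - edgeProb γ α n S m₀ b₀ e)| ≤ τ) :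
    ((n : ℝ) - S.card) * edgeRate γ α n 1 / κ * maxAbs S (fun i => b i - b₀ i)
      ≤ τ + κ * (((n : ℝ) - S.card) * edgeRate γ α n 1 + S.card * edgeRate γ α n 2)
        * |m - m₀| := by
  obtain ⟨i, hi, hmax⟩ := exists_abs_eq_maxAbs hne (fun i => b i - b₀ i)
  have hTi := abs_le.1 (hT i hi)
  rw [← hmax]
  rw [Finset.sum_sub_distrib] at hTi
  rcases lt_trichotomy (b i - b₀ i) 0 with hv | hv | hv
  -- For a negative error the estimate and the truth exchange roles. Then `b i < b₀ i ≤ M₂`, so the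
  -- estimate is off the upper face and its score is nonpositive.
  · have h1 := hL.node_sum_lower hS h₀ h.1 hi (by rw [abs_sub_comm, hmax, maxAbs_sub_comm])
      (by linarith)
    have h2 := h.score_node_nonpos ha hi (by linarith [(h₀.2 i hi).2])
    rw [Finset.sum_sub_distrib] at h1 h2
    rw [abs_of_neg hv, neg_sub, abs_sub_comm m]
    linarith [hTi.1]
  · rw [hv, abs_zero, mul_zero]
    have hτ := (abs_nonneg _).trans (hT i hi)
    have hn : 0 < n := (Nat.zero_le _).trans_lt (Finset.mem_range.1 (hS hi))
    have hsn : (S.card : ℝ) ≤ n := by exact_mod_cast (by simpa using Finset.card_le_card hS)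
    have hκ := hL.pos h₀ hn
    have h2 := edgeRate_pos (γ := γ) (α := α) hn 1
    have h3 := edgeRate_pos (γ := γ) (α := α) hn 2
    have h4 : 0 ≤ (n : ℝ) - S.card := by linarith
    positivity
  · have h1 := hL.node_sum_lower hS h.1 h₀ hi hmax hv.le
    have h2 := h.score_node_nonneg ha hi (by linarith [(h₀.2 i hi).1])
    rw [Finset.sum_sub_distrib] at h1 h2
    rw [abs_of_pos hv]
    linarith [hTi.2]

lemma LinkBound.intercept_lower (hL : LinkBound γ α n S M₁ M₂ κ) (h : InBox S M₁ M₂ m b)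
    (h₀ : InBox S M₁ M₂ m₀ b₀) (hn : 0 < n) (hm : m₀ ≤ m) (e : ℕ × ℕ) :
    - (κ * edgeRate γ α n (endsIn S e) * (endsIn S e * maxAbs S fun i => b i - b₀ i))
      ≤ edgeProb γ α n S m b e - edgeProb γ α n S m₀ b₀ e := by
  have hmid : InBox S M₁ M₂ m b₀ := ⟨h.1, h₀.2⟩
  have h1 := abs_le.1 (hL.abs_edgeProb_sub_le h hmid e)
  rw [sub_self, zero_add] at h1
  have h2 := edgeProb_mono_intercept (γ := γ) (α := α) (n := n) (S := S) (b := b₀) hm e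
  have h3 := abs_endSum_le (S := S) (fun i => b i - b₀ i) e
  have h4 : 0 ≤ κ * edgeRate γ α n (endsIn S e) :=
    mul_nonneg (hL.pos h hn).le (edgeRate_pos hn _).le
  have h5 := mul_le_mul_of_nonneg_left h3 h4
  linarith [h1.1]

/-- Edges outside `S` see the intercept only and give the main term. On the other edges the
intercept shift helps by monotonicity, and the node errors cost at most the number of such edges
times their rate times the maximal error. -/
lemma LinkBound.intercept_sum_lower (hL : LinkBound γ α n S M₁ M₂ κ) (hS : S ⊆ Finset.range n)
    (h : InBox S M₁ M₂ m b) (h₀ : InBox S M₁ M₂ m₀ b₀) (hn : 0 < n) (hm : m₀ ≤ m) :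
    (classEdges n S 0).card * edgeRate γ α n 0 / κ * (m - m₀)
        - κ * (S.card * n * edgeRate γ α n 1 + 2 * (S.card * S.card) * edgeRate γ α n 2)
          * maxAbs S (fun i => b i - b₀ i)
      ≤ ∑ e ∈ edgePairs n, (edgeProb γ α n S m b e - edgeProb γ α n S m₀ b₀ e) := by
  have hκ := hL.pos h hn
  have hV := maxAbs_nonneg S (fun i => b i - b₀ i)
  have hr1 := edgeRate_pos (γ := γ) (α := α) hn 1
  have hr2 := edgeRate_pos (γ := γ) (α := α) hn 2
  rw [sum_edgePairs_eq n S]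
  have h0 := card_nsmul_le_sum' (classEdges n S 0)
    (fun e => edgeProb γ α n S m b e - edgeProb γ α n S m₀ b₀ e)
    (edgeRate γ α n 0 / κ * (m - m₀)) (by
      intro e he
      have hk := classEdges_ends he
      have hz := endsIn_eq_zero.1 hk
      have hs : endSum S (fun i => b i - b₀ i) e = 0 := by simp [endSum, hz.1, hz.2]
      have := hL.mul_le_edgeProb_sub h h₀ (e := e) (by omega) (by rw [hs]; linarith)
      rwa [hs, hk, add_zero] at this)
  have h1 := card_nsmul_le_sum' (classEdges n S 1)
    (fun e => edgeProb γ α n S m b e - edgeProb γ α n S m₀ b₀ e)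
    (- (κ * edgeRate γ α n 1 * maxAbs S fun i => b i - b₀ i)) (by
      intro e he
      have := hL.intercept_lower h h₀ hn hm e
      simpa [classEdges_ends he] using this)
  have h2 := card_nsmul_le_sum' (classEdges n S 2)
    (fun e => edgeProb γ α n S m b e - edgeProb γ α n S m₀ b₀ e)
    (- (κ * edgeRate γ α n 2 * (2 * maxAbs S fun i => b i - b₀ i))) (by
      intro e he
      have := hL.intercept_lower h h₀ hn hm e
      simpa [classEdges_ends he] using this)
  have c1 : ((classEdges n S 1).card : ℝ) ≤ S.card * n := by
    exact_mod_cast card_classEdges_one_le hS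
  have c2 : ((classEdges n S 2).card : ℝ) ≤ S.card * S.card := by
    exact_mod_cast card_classEdges_two_le
  have d1 : ((classEdges n S 1).card : ℝ)
        * (κ * edgeRate γ α n 1 * maxAbs S fun i => b i - b₀ i)
      ≤ S.card * n * (κ * edgeRate γ α n 1 * maxAbs S fun i => b i - b₀ i) := by gcongr
  have d2 : ((classEdges n S 2).card : ℝ)
        * (κ * edgeRate γ α n 2 * (2 * maxAbs S fun i => b i - b₀ i))
      ≤ S.card * S.card * (κ * edgeRate γ α n 2 * (2 * maxAbs S fun i => b i - b₀ i)) := by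
    gcongr
  set V := maxAbs S fun i => b i - b₀ i
  have e1 : (classEdges n S 0).card * edgeRate γ α n 0 / κ * (m - m₀)
      = (classEdges n S 0).card * (edgeRate γ α n 0 / κ * (m - m₀)) := by ring
  have e2 : κ * (S.card * n * edgeRate γ α n 1 + 2 * (S.card * S.card) * edgeRate γ α n 2) * V
      = S.card * n * (κ * edgeRate γ α n 1 * V)
        + S.card * S.card * (κ * edgeRate γ α n 2 * (2 * V)) := by ring
  rw [e1, e2]
  linarith

lemma LinkBound.abs_intercept_le (hL : LinkBound γ α n S M₁ M₂ κ) (hS : S ⊆ Finset.range n)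
    (hn : 0 < n) {a : ℕ → ℕ → ℝ} (ha : ∀ e ∈ edgePairs n, a e.1 e.2 = 0 ∨ a e.1 e.2 = 1)
    (h : IsMLE γ α n S M₁ M₂ a m b) (h₀ : InBox S M₁ M₂ m₀ b₀) {τ : ℝ}
    (hT : |∑ e ∈ edgePairs n, (a e.1 e.2 - edgeProb γ α n S m₀ b₀ e)| ≤ τ) :
    (classEdges n S 0).card * edgeRate γ α n 0 / κ * |m - m₀|
      ≤ τ + κ * (S.card * n * edgeRate γ α n 1 + 2 * (S.card * S.card) * edgeRate γ α n 2)
          * maxAbs S (fun i => b i - b₀ i) := by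
  have hT' := abs_le.1 hT
  rw [Finset.sum_sub_distrib] at hT'
  rcases lt_trichotomy (m - m₀) 0 with hv | hv | hv
  · have h1 := hL.intercept_sum_lower hS h₀ h.1 hn (by linarith)
    have h2 := h.score_intercept_nonpos ha (by linarith [h₀.1.2])
    rw [Finset.sum_sub_distrib] at h1 h2
    rw [maxAbs_sub_comm] at h1
    rw [abs_of_neg hv, neg_sub]
    linarith [hT'.1]
  · rw [hv, abs_zero, mul_zero]
    have hτ := (abs_nonneg _).trans hT
    have hκ := hL.pos h₀ hn
    have h2 := edgeRate_pos (γ := γ) (α := α) hn 1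
    have h3 := edgeRate_pos (γ := γ) (α := α) hn 2
    have h4 := maxAbs_nonneg S (fun i => b i - b₀ i)
    positivity
  · have h1 := hL.intercept_sum_lower hS h.1 h₀ hn (by linarith)
    have h2 := h.score_intercept_nonneg ha (by linarith [h₀.1.1])
    rw [Finset.sum_sub_distrib] at h1 h2
    rw [abs_of_pos hv]
    linarith [hT'.2]

end

/-! ### Concentration and characteristic functions of Bernoulli sums -/

section Bernoulli

variable {Ω : Type*} [MeasurableSpace Ω] {P : Measure Ω} [IsProbabilityMeasure P]

lemma integral_comp_bernoulli {E : Type*} [NormedAddCommGroup E] [NormedSpace ℝ E]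
    [CompleteSpace E] {X : Ω → ℝ} {p : ℝ} (hX : Measurable X) (h01 : ∀ ω, X ω = 0 ∨ X ω = 1)
    (hp : P.real {ω | X ω = 1} = p) (f : ℝ → E) :
    ∫ ω, f (X ω) ∂P = p • f 1 + (1 - p) • f 0 := by
  have hm : MeasurableSet {ω | X ω = 1} := hX (measurableSet_singleton 1)
  have h : (fun ω => f (X ω)) = fun ω => {ω | X ω = 1}.indicator (fun _ => f 1) ω
      + {ω | X ω = 1}ᶜ.indicator (fun _ => f 0) ω := by
    funext ω
    rcases h01 ω with h | h <;> simp [h]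
  rw [h, integral_add ((integrable_const _).indicator hm)
    ((integrable_const _).indicator hm.compl), integral_indicator_const _ hm,
    integral_indicator_const _ hm.compl, probReal_compl_eq_one_sub hm, hp]

/-- Use exp x ≤ 1 + x + x² for |x| ≤ 1 at both values: the linear terms cancel and the quadratic
ones average to t²p(1-p). -/
lemma mgf_centered_bernoulli_le {X : Ω → ℝ} {p : ℝ} (hX : Measurable X)
    (h01 : ∀ ω, X ω = 0 ∨ X ω = 1) (hp : P.real {ω | X ω = 1} = p) {t : ℝ} (ht : |t| ≤ 1) :
    mgf (fun ω => X ω - p) P t ≤ Real.exp (t ^ 2 * (p * (1 - p))) := by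
  have hp0 : 0 ≤ p := hp ▸ measureReal_nonneg
  have hp1 : p ≤ 1 := hp ▸ measureReal_le_one
  have h := integral_comp_bernoulli hX h01 hp (fun x => Real.exp (t * (x - p)))
  rw [mgf, h, smul_eq_mul, smul_eq_mul]
  have b1 : |t * (1 - p)| ≤ 1 := by
    rw [abs_mul, abs_of_nonneg (by linarith : 0 ≤ 1 - p)]
    exact mul_le_one₀ ht (by linarith) (by linarith)
  have b0 : |t * (0 - p)| ≤ 1 := by
    rw [abs_mul, zero_sub, abs_neg, abs_of_nonneg hp0]
    exact mul_le_one₀ ht hp0 hp1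
  have e1 := (abs_le.1 (Real.abs_exp_sub_one_sub_id_le b1)).2
  have e0 := (abs_le.1 (Real.abs_exp_sub_one_sub_id_le b0)).2
  have f1 := mul_le_mul_of_nonneg_left (show Real.exp (t * (1 - p)) ≤
    1 + t * (1 - p) + (t * (1 - p)) ^ 2 by linarith) hp0
  have f0 := mul_le_mul_of_nonneg_left (show Real.exp (t * (0 - p)) ≤
    1 + t * (0 - p) + (t * (0 - p)) ^ 2 by linarith) (by linarith : 0 ≤ 1 - p)
  have := Real.add_one_le_exp (t ^ 2 * (p * (1 - p)))
  refine le_trans (add_le_add f1 f0) (le_trans (le_of_eq ?_) this)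
  ring

variable {ι : Type*} {X : ι → Ω → ℝ} {p : ι → ℝ}

/-- **Bernstein's inequality** for sums of independent Bernoulli variables. -/
lemma bernstein_bernoulli (hX : ∀ i, Measurable (X i)) (h01 : ∀ i ω, X i ω = 0 ∨ X i ω = 1)
    (hp : ∀ i, P.real {ω | X i ω = 1} = p i) (hind : iIndepFun X P) (s : Finset ι) {τ h : ℝ}
    (hτ : 1 ≤ τ) (hs : ∑ i ∈ s, p i * (1 - p i) ≤ τ ^ 2) :
    P.real {ω | h * τ ≤ |∑ i ∈ s, (X i ω - p i)|} ≤ 2 * Real.exp (1 - h) := by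
  have hτ0 : 0 < τ := by linarith
  set Y : ι → Ω → ℝ := fun i ω => X i ω - p i with hY
  have hYm : ∀ i, Measurable (Y i) := fun i => (hX i).sub_const _
  have hYi : iIndepFun Y P := hind.comp (fun i x => x - p i) fun i => measurable_id.sub_const _
  -- The Chernoff parameter is ±1/τ: `1 ≤ τ` keeps it in the range of the one-variable bound, and a
  -- variance of at most τ² keeps the exponent below 1.
  have hmgf : ∀ t, |t| = τ⁻¹ → mgf (∑ i ∈ s, Y i) P t ≤ Real.exp 1 := by
    intro t ht
    rw [hYi.mgf_sum hYm]
    have ht1 : |t| ≤ 1 := ht ▸ inv_le_one_of_one_le₀ hτ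
    calc ∏ i ∈ s, mgf (Y i) P t ≤ ∏ i ∈ s, Real.exp (t ^ 2 * (p i * (1 - p i))) :=
          Finset.prod_le_prod (fun i _ => mgf_nonneg)
            fun i _ => mgf_centered_bernoulli_le (hX i) (h01 i) (hp i) ht1
      _ = Real.exp (t ^ 2 * ∑ i ∈ s, p i * (1 - p i)) := by
          rw [← Real.exp_sum, Finset.mul_sum]
      _ ≤ Real.exp 1 := by
          rw [Real.exp_le_exp, ← sq_abs, ht, inv_pow]
          rw [inv_mul_le_iff₀ (by positivity), mul_one]
          exact hs
  have hint : ∀ t, Integrable (fun ω => Real.exp (t * (∑ i ∈ s, Y i) ω)) P := by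
    intro t
    refine (hYi.integrable_exp_mul_sum hYm fun i _ => ?_)
    refine Integrable.of_bound (C := Real.exp (|t| * (1 + |p i|)))
      ((hYm i).const_mul t).exp.aestronglyMeasurable (ae_of_all _ fun ω => ?_)
    rw [Real.norm_eq_abs, Real.abs_exp, Real.exp_le_exp]
    refine (le_abs_self _).trans ?_
    rw [abs_mul]
    gcongr
    refine (abs_sub _ _).trans ?_
    gcongr
    rcases h01 i ω with h | h <;> simp [h]
  have h1 := measure_ge_le_exp_mul_mgf (μ := P) (X := ∑ i ∈ s, Y i) (h * τ)
    (t := τ⁻¹) (by positivity) (hint _)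
  have h2 := measure_le_le_exp_mul_mgf (μ := P) (X := ∑ i ∈ s, Y i) (-(h * τ))
    (t := -τ⁻¹) (by simpa using hτ0.le) (hint _)
  have e1 : -τ⁻¹ * (h * τ) = -h := by field_simp
  have e2 : - -τ⁻¹ * -(h * τ) = -h := by field_simp
  rw [e1] at h1
  rw [e2] at h2
  have m1 := hmgf τ⁻¹ (abs_of_pos (by positivity))
  have m2 := hmgf (-τ⁻¹) (by rw [abs_neg, abs_of_pos (by positivity)])
  have hsub : {ω | h * τ ≤ |∑ i ∈ s, (X i ω - p i)|} ⊆
      {ω | h * τ ≤ (∑ i ∈ s, Y i) ω} ∪ {ω | (∑ i ∈ s, Y i) ω ≤ -(h * τ)} := by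
    intro ω hω
    simp only [Set.mem_ofPred_eq, Set.mem_union, Finset.sum_apply, hY] at hω ⊢
    rcases le_abs.1 hω with h | h
    · exact Or.inl h
    · exact Or.inr (by linarith)
  refine (measureReal_mono hsub).trans ((measureReal_union_le _ _).trans ?_)
  have e3 : Real.exp (1 - h) = Real.exp (-h) * Real.exp 1 := by rw [← Real.exp_add]; ring_nf
  rw [e3, two_mul]
  exact add_le_add (h1.trans (by gcongr)) (h2.trans (by gcongr))

/-- Telescoping: replace one factor at a time, all other factors having norm at most 1. -/
lemma norm_prod_sub_prod_le {ι : Type*} (s : Finset ι) (f g : ι → ℂ) (hf : ∀ i ∈ s, ‖f i‖ ≤ 1)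
    (hg : ∀ i ∈ s, ‖g i‖ ≤ 1) : ‖∏ i ∈ s, f i - ∏ i ∈ s, g i‖ ≤ ∑ i ∈ s, ‖f i - g i‖ := by
  classical
  induction s using Finset.induction_on with
  | empty => simp
  | insert a s ha ih =>
    rw [Finset.prod_insert ha, Finset.prod_insert ha, Finset.sum_insert ha]
    have h1 := ih (fun i hi => hf i (Finset.mem_insert_of_mem hi))
      (fun i hi => hg i (Finset.mem_insert_of_mem hi))
    have h2 : ‖∏ i ∈ s, f i‖ ≤ 1 := by
      rw [norm_prod]
      exact Finset.prod_le_one (fun _ _ => norm_nonneg _)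
        fun i hi => hf i (Finset.mem_insert_of_mem hi)
    have e : f a * ∏ i ∈ s, f i - g a * ∏ i ∈ s, g i
        = (f a - g a) * ∏ i ∈ s, f i + g a * (∏ i ∈ s, f i - ∏ i ∈ s, g i) := by ring
    rw [e]
    refine (norm_add_le _ _).trans (add_le_add ?_ ?_)
    · rw [norm_mul]; exact mul_le_of_le_one_right (norm_nonneg _) h2
    · rw [norm_mul]
      exact (mul_le_of_le_one_left (norm_nonneg _) (hg a (Finset.mem_insert_self a s))).trans h1

lemma norm_exp_mul_I_sub_le {x : ℝ} (hx : |x| ≤ 1) :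
    ‖Complex.exp (x * Complex.I) - (1 + x * Complex.I - x ^ 2 / 2)‖ ≤ |x| ^ 3 := by
  have hn : ‖(x : ℂ) * Complex.I‖ = |x| := by simp
  have h := Complex.exp_bound (x := x * Complex.I) (by rw [hn]; exact hx) (n := 3) (by norm_num)
  rw [hn] at h
  have e : ∑ m ∈ Finset.range 3, ((x : ℂ) * Complex.I) ^ m / (m.factorial : ℂ)
      = 1 + x * Complex.I - x ^ 2 / 2 := by
    simp [Finset.sum_range_succ, mul_pow, Nat.factorial]
    ring
  rw [e] at h
  refine h.trans (mul_le_of_le_one_right (by positivity) ?_)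
  norm_num [Nat.factorial]

/-- Both terms differ from 1 - c²p(1-p)/2 by at most |c|³p(1-p). Keeping the factor p(1-p) is
essential: after summation the error is a multiple of the total variance even when the probabilities
tend to 0. -/
lemma norm_bernoulli_charFun_sub_le {p c : ℝ} (hp0 : 0 ≤ p) (hp1 : p ≤ 1) (hc : |c| ≤ 1) :
    ‖(p • Complex.exp ((c * (1 - p) : ℝ) * Complex.I)
        + (1 - p) • Complex.exp ((c * (0 - p) : ℝ) * Complex.I))
      - (Real.exp (-(c ^ 2 * (p * (1 - p)) / 2)) : ℂ)‖ ≤ 2 * |c| * (c ^ 2 * (p * (1 - p))) := by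
  have hq0 : 0 ≤ 1 - p := by linarith
  have a1 : |c * (1 - p)| = |c| * (1 - p) := by rw [abs_mul, abs_of_nonneg hq0]
  have a0 : |c * (0 - p)| = |c| * p := by rw [abs_mul, zero_sub, abs_neg, abs_of_nonneg hp0]
  have h1 := norm_exp_mul_I_sub_le (x := c * (1 - p))
    (by rw [a1]; exact mul_le_one₀ hc hq0 (by linarith))
  have h0 := norm_exp_mul_I_sub_le (x := c * (0 - p))
    (by rw [a0]; exact mul_le_one₀ hc hp0 hp1)
  rw [a1] at h1
  rw [a0] at h0
  set q := p * (1 - p) with hq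
  have hqn : 0 ≤ q := mul_nonneg hp0 hq0
  have hq1 : q ≤ 1 := by nlinarith
  have hc2 : c ^ 2 ≤ 1 := by rw [← sq_abs]; exact pow_le_one₀ (abs_nonneg _) hc
  have h2 : |Real.exp (-(c ^ 2 * q / 2)) - 1 - (-(c ^ 2 * q / 2))| ≤ (-(c ^ 2 * q / 2)) ^ 2 := by
    apply Real.abs_exp_sub_one_sub_id_le
    rw [abs_neg, abs_of_nonneg (by positivity)]
    nlinarith [mul_le_one₀ hc2 hqn hq1]
  have h2' : ‖((1 - c ^ 2 * q / 2 - Real.exp (-(c ^ 2 * q / 2)) : ℝ) : ℂ)‖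
      ≤ (c ^ 2 * q / 2) ^ 2 := by
    rw [Complex.norm_real, Real.norm_eq_abs, abs_sub_comm]
    rw [neg_sq] at h2
    refine le_trans (le_of_eq ?_) h2
    congr 1; ring
  have e : (p • Complex.exp ((c * (1 - p) : ℝ) * Complex.I)
        + (1 - p) • Complex.exp ((c * (0 - p) : ℝ) * Complex.I))
      - (Real.exp (-(c ^ 2 * q / 2)) : ℂ)
      = p • (Complex.exp ((c * (1 - p) : ℝ) * Complex.I)
          - (1 + (c * (1 - p) : ℝ) * Complex.I - ((c * (1 - p) : ℝ) : ℂ) ^ 2 / 2))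
        + (1 - p) • (Complex.exp ((c * (0 - p) : ℝ) * Complex.I)
          - (1 + (c * (0 - p) : ℝ) * Complex.I - ((c * (0 - p) : ℝ) : ℂ) ^ 2 / 2))
        + ((1 - c ^ 2 * q / 2 - Real.exp (-(c ^ 2 * q / 2)) : ℝ) : ℂ) := by
    simp only [Complex.real_smul, hq]
    push_cast
    ring
  rw [e]
  refine (norm_add₃_le).trans ?_
  rw [norm_smul, norm_smul, Real.norm_of_nonneg hp0, Real.norm_of_nonneg hq0]
  have g1 := mul_le_mul_of_nonneg_left h1 hp0
  have g0 := mul_le_mul_of_nonneg_left h0 hq0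
  have hcn := abs_nonneg c
  have k1 : p * (|c| * (1 - p)) ^ 3 + (1 - p) * (|c| * p) ^ 3 ≤ |c| ^ 3 * q := by
    have : p * (|c| * (1 - p)) ^ 3 + (1 - p) * (|c| * p) ^ 3
        = |c| ^ 3 * q * ((1 - p) ^ 2 + p ^ 2) := by rw [hq]; ring
    rw [this]
    refine mul_le_of_le_one_right (by positivity) (by nlinarith)
  have k2 : (c ^ 2 * q / 2) ^ 2 ≤ |c| ^ 3 * q := by
    have : (c ^ 2 * q / 2) ^ 2 = |c| ^ 3 * q * (|c| * q / 4) := by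
      rw [← sq_abs c]; ring
    rw [this]
    refine mul_le_of_le_one_right (by positivity) ?_
    nlinarith [mul_le_one₀ hc hqn hq1]
  have k3 : 2 * |c| * (c ^ 2 * q) = |c| ^ 3 * q + |c| ^ 3 * q := by rw [← sq_abs c]; ring
  rw [k3]
  linarith

/-- Quantitative central limit theorem, at the level of characteristic functions, for weighted
sums of independent Bernoulli variables. -/
lemma norm_integral_exp_sum_sub_le [Fintype ι] (hX : ∀ i, Measurable (X i))
    (h01 : ∀ i ω, X i ω = 0 ∨ X i ω = 1) (hp : ∀ i, P.real {ω | X i ω = 1} = p i)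
    (hind : iIndepFun X P) {c : ι → ℝ} {δ : ℝ} (hδ : δ ≤ 1) (hc : ∀ i, |c i| ≤ δ) :
    ‖∫ ω, Complex.exp ((∑ i, c i * (X i ω - p i) : ℝ) * Complex.I) ∂P
        - (Real.exp (-(∑ i, c i ^ 2 * (p i * (1 - p i))) / 2) : ℂ)‖
      ≤ 2 * δ * ∑ i, c i ^ 2 * (p i * (1 - p i)) := by
  set Y : ι → Ω → ℝ := fun i ω => c i * (X i ω - p i) with hY
  have hYm : ∀ i, Measurable (Y i) := fun i => ((hX i).sub_const _).const_mul _
  have hYi : iIndepFun Y P :=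
    hind.comp (fun i x => c i * (x - p i)) fun i => (measurable_id.sub_const _).const_mul _
  have hcf := hYi.charFun_map_fun_sum_eq_prod (fun i => (hYm i).aemeasurable)
  have hcf1 := congrFun hcf 1
  rw [Finset.prod_apply] at hcf1
  have hmap : ∀ Z : Ω → ℝ, Measurable Z →
      charFun (P.map Z) 1 = ∫ ω, Complex.exp (Z ω * Complex.I) ∂P := by
    intro Z hZ
    rw [charFun_apply_real, integral_map hZ.aemeasurable (by fun_prop)]
    simp
  rw [hmap _ (Finset.measurable_sum _ fun i _ => hYm i)] at hcf1
  have hp0 : ∀ i, 0 ≤ p i := fun i => hp i ▸ measureReal_nonneg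
  have hp1 : ∀ i, p i ≤ 1 := fun i => hp i ▸ measureReal_le_one
  have hfac : ∀ i, charFun (P.map (Y i)) 1 = p i • Complex.exp ((c i * (1 - p i) : ℝ) * Complex.I)
        + (1 - p i) • Complex.exp ((c i * (0 - p i) : ℝ) * Complex.I) := by
    intro i
    rw [hmap _ (hYm i)]
    exact integral_comp_bernoulli (hX i) (h01 i) (hp i)
      (fun x => Complex.exp ((c i * (x - p i) : ℝ) * Complex.I))
  have hexp : (Real.exp (-(∑ i, c i ^ 2 * (p i * (1 - p i))) / 2) : ℂ)
      = ∏ i, (Real.exp (-(c i ^ 2 * (p i * (1 - p i)) / 2)) : ℂ) := by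
    rw [← Complex.ofReal_prod, ← Real.exp_sum, Finset.sum_neg_distrib, ← Finset.sum_div, neg_div]
  rw [hcf1, hexp]
  have := fun i => Measure.isProbabilityMeasure_map (μ := P) (hYm i).aemeasurable
  refine (norm_prod_sub_prod_le _ _ _ (fun i _ => ?_) (fun i _ => ?_)).trans ?_
  · simpa using norm_charFun_le (μ := P.map (Y i)) 1
  · rw [Complex.norm_real, Real.norm_eq_abs, Real.abs_exp, Real.exp_le_one_iff, neg_nonpos]
    have := hp0 i; have := hp1 i
    have : 0 ≤ 1 - p i := by linarith
    positivity
  · rw [Finset.mul_sum]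
    refine Finset.sum_le_sum fun i _ => ?_
    rw [hfac]
    refine (norm_bernoulli_charFun_sub_le (hp0 i) (hp1 i) ((hc i).trans hδ)).trans ?_
    have : 0 ≤ c i ^ 2 * (p i * (1 - p i)) :=
      mul_nonneg (sq_nonneg _) (mul_nonneg (hp0 i) (by linarith [hp1 i]))
    gcongr
    exact hc i

end Bernoulli

/-! ### The random graph and its typical realizations -/

section Model

variable {Ω : Type*} [MeasurableSpace Ω] {P : Measure Ω}
  {γ α κ m₀ μ₀ M₁ M₂ : ℝ} {n : ℕ} {S : Finset ℕ} {b₀ β₀ : ℕ → ℝ} {A : Ω → ℕ → ℕ → ℝ}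

lemma linkProb_eq_edgeProb (hS : S = supp n β₀) (hμ : μ₀ = -γ * Real.log n + m₀)
    (hβ : ∀ i ∈ S, β₀ i = α * Real.log n + b₀ i) {e : ℕ × ℕ} (he : e ∈ edgePairs n) :
    linkProb μ₀ β₀ e.1 e.2 = edgeProb γ α n S m₀ b₀ e := by
  have hb : ∀ i < n, β₀ i = betaOf α n S b₀ i := by
    intro i hi
    unfold betaOf
    split_ifs with h
    · exact hβ i h
    · by_contra h0
      exact h (hS ▸ Finset.mem_filter.2 ⟨Finset.mem_range.2 hi, h0⟩)
  have h := mem_edgePairs.1 he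
  rw [linkProb_eq_sigmoid, edgeProb, logOdds, hb _ h.1, hb _ h.2.1, hμ, muOf]

/-- The edges of the random graph `A` are independent Bernoulli variables with parameters
`pr e`. -/
structure IsBernoulliGraph (P : Measure Ω) (n : ℕ) (A : Ω → ℕ → ℕ → ℝ) (pr : ℕ × ℕ → ℝ) : Prop where
  measurable : ∀ e : edgePairs n, Measurable fun ω => A ω e.1.1 e.1.2
  zero_or_one : ∀ (e : edgePairs n) ω, A ω e.1.1 e.1.2 = 0 ∨ A ω e.1.1 e.1.2 = 1
  prob : ∀ e : edgePairs n, P.real {ω | A ω e.1.1 e.1.2 = 1} = pr e.1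
  indep : iIndepFun (fun (e : edgePairs n) ω => A ω e.1.1 e.1.2) P

lemma IsSparseBetaModel.isBernoulliGraph (hA : IsSparseBetaModel P n μ₀ β₀ A)
    (hS : S = supp n β₀) (hμ : μ₀ = -γ * Real.log n + m₀)
    (hβ : ∀ i ∈ S, β₀ i = α * Real.log n + b₀ i) :
    IsBernoulliGraph P n A (edgeProb γ α n S m₀ b₀) where
  measurable e := hA.measurable _ (mem_edgePairs.1 e.2).1 _ (mem_edgePairs.1 e.2).2.1
  zero_or_one e ω := hA.zero_or_one ω _ (mem_edgePairs.1 e.2).1 _ (mem_edgePairs.1 e.2).2.1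
  prob e := (hA.prob _ e.2).trans (linkProb_eq_edgeProb hS hμ hβ e.2)
  indep := hA.indep

lemma IsBernoulliGraph.bernstein [IsProbabilityMeasure P] {pr : ℕ × ℕ → ℝ} (hA : IsBernoulliGraph P n A pr)
    {s : Finset (ℕ × ℕ)} (hs : s ⊆ edgePairs n) {V h : ℝ}
    (hV : ∑ e ∈ s, pr e * (1 - pr e) ≤ V) :
    P.real {ω | h * (1 + √V) ≤ |∑ e ∈ s, (A ω e.1 e.2 - pr e)|} ≤ 2 * Real.exp (1 - h) := by
  have h1 : ∑ e ∈ s.subtype (· ∈ edgePairs n), pr e * (1 - pr e) ≤ (1 + √V) ^ 2 := by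
    rw [Finset.sum_subtype_of_mem (fun e => pr e * (1 - pr e)) fun e he => hs he]
    refine hV.trans ?_
    -- No sign is imposed on `V`; for negative `V` the value `√V` is 0 and the bound is trivial.
    rcases le_total 0 V with h0 | h0
    · nlinarith [Real.sq_sqrt h0, Real.sqrt_nonneg V]
    · exact h0.trans (sq_nonneg _)
  have h2 : P.real {ω | h * (1 + √V) ≤
      |∑ e ∈ s.subtype (· ∈ edgePairs n), (A ω e.1.1 e.1.2 - pr e.1)|} ≤ 2 * Real.exp (1 - h) :=
    bernstein_bernoulli hA.measurable hA.zero_or_one hA.prob hA.indep _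
      (le_add_of_nonneg_right (Real.sqrt_nonneg V)) h1
  have h3 := fun ω => Finset.sum_subtype_of_mem (fun e => A ω e.1 e.2 - pr e) fun e he => hs he
  simpa only [h3] using h2

/-- All the edge counts that matter deviate from their means by at most `h` times their order of
magnitude. -/
structure IsTypicalGraph (γ α : ℝ) (n : ℕ) (S : Finset ℕ) (m₀ : ℝ) (b₀ : ℕ → ℝ) (κ h : ℝ)
    (a : ℕ → ℕ → ℝ) : Prop where
  total : |∑ e ∈ edgePairs n, (a e.1 e.2 - edgeProb γ α n S m₀ b₀ e)|
    ≤ h * (1 + √(κ * (n * n * edgeRate γ α n 0 + S.card * n * edgeRate γ α n 1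
        + S.card * S.card * edgeRate γ α n 2)))
  node : ∀ i ∈ S, |∑ e ∈ incEdges n i, (a e.1 e.2 - edgeProb γ α n S m₀ b₀ e)|
    ≤ h * (1 + √(κ * (n * edgeRate γ α n 1 + S.card * edgeRate γ α n 2)))
  class_one : |∑ e ∈ classEdges n S 1, (a e.1 e.2 - edgeProb γ α n S m₀ b₀ e)|
    ≤ h * (1 + √(κ * (S.card * n * edgeRate γ α n 1)))
  class_two : |∑ e ∈ classEdges n S 2, (a e.1 e.2 - edgeProb γ α n S m₀ b₀ e)|
    ≤ h * (1 + √(κ * (S.card * S.card * edgeRate γ α n 2)))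
  node_two : ∀ i ∈ S, |∑ e ∈ incClass n S i 2, (a e.1 e.2 - edgeProb γ α n S m₀ b₀ e)|
    ≤ h * (1 + √(κ * (S.card * edgeRate γ α n 2)))

lemma classEdges_subset (n : ℕ) (S : Finset ℕ) (k : ℕ) : classEdges n S k ⊆ edgePairs n :=
  Finset.filter_subset _ _

lemma incEdges_subset (n i : ℕ) : incEdges n i ⊆ edgePairs n := Finset.filter_subset _ _

lemma card_classEdges_zero_le (hS : S ⊆ Finset.range n) : (classEdges n S 0).card ≤ n * n := by
  have h := two_mul_card_classEdges_zero hS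
  have : (n - S.card) * (n - S.card - 1) ≤ n * n :=
    Nat.mul_le_mul (Nat.sub_le _ _) ((Nat.sub_le _ _).trans (Nat.sub_le _ _))
  omega

/-- The variance p(1-p) of an edge is the logistic derivative at its log odds, hence at most the
odds. -/
lemma LinkBound.sum_var_le (hL : LinkBound γ α n S M₁ M₂ κ) (h₀ : InBox S M₁ M₂ m₀ b₀)
    (hn : 0 < n) {s : Finset (ℕ × ℕ)} {k : ℕ} {N : ℝ} (hs : ∀ e ∈ s, endsIn S e = k)
    (hN : (s.card : ℝ) ≤ N) :
    ∑ e ∈ s, edgeProb γ α n S m₀ b₀ e * (1 - edgeProb γ α n S m₀ b₀ e)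
      ≤ κ * (N * edgeRate γ α n k) := by
  have hκ := hL.pos h₀ hn
  have hr := edgeRate_pos (γ := γ) (α := α) hn k
  have h1 : ∑ e ∈ s, edgeProb γ α n S m₀ b₀ e * (1 - edgeProb γ α n S m₀ b₀ e)
      ≤ s.card • (κ * edgeRate γ α n k) := by
    refine Finset.sum_le_card_nsmul _ _ _ fun e he => ?_
    have := (hL m₀ b₀ h₀ e).1
    rw [hs e he] at this
    exact (logisticDeriv_le_exp _).trans this
  refine h1.trans ?_
  rw [nsmul_eq_mul, mul_left_comm]
  gcongr

lemma measureReal_le_of_subset_union [IsFiniteMeasure P] {B E₁ E₂ E₃ E₄ E₅ : Set Ω}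
    {x₁ x₂ x₃ x₄ x₅ : ℝ} (h₁ : P.real E₁ ≤ x₁) (h₂ : P.real E₂ ≤ x₂) (h₃ : P.real E₃ ≤ x₃)
    (h₄ : P.real E₄ ≤ x₄) (h₅ : P.real E₅ ≤ x₅) (h : B ⊆ E₁ ∪ (E₂ ∪ (E₃ ∪ (E₄ ∪ E₅)))) :
    P.real B ≤ x₁ + (x₂ + (x₃ + (x₄ + x₅))) :=
  (measureReal_mono h).trans <| (measureReal_union_le _ _).trans <| add_le_add h₁ <|
    (measureReal_union_le _ _).trans <| add_le_add h₂ <| (measureReal_union_le _ _).trans <|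
    add_le_add h₃ <| (measureReal_union_le _ _).trans <| add_le_add h₄ h₅

/-- Bernstein's inequality and a union bound over three global sums and two sums per node of `S`,
hence the factor 2n + 3. -/
lemma LinkBound.prob_not_typical_le [IsProbabilityMeasure P] (hL : LinkBound γ α n S M₁ M₂ κ)
    (h₀ : InBox S M₁ M₂ m₀ b₀) (hn : 0 < n) (hS : S ⊆ Finset.range n)
    (hA : IsBernoulliGraph P n A (edgeProb γ α n S m₀ b₀)) (h : ℝ) :
    P.real {ω | ¬ IsTypicalGraph γ α n S m₀ b₀ κ h (A ω)}
      ≤ (2 * n + 3) * (2 * Real.exp (1 - h)) := by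
  set pr := edgeProb γ α n S m₀ b₀ with hpr
  have c0 : ((classEdges n S 0).card : ℝ) ≤ n * n := by
    exact_mod_cast card_classEdges_zero_le hS
  have c1 : ((classEdges n S 1).card : ℝ) ≤ S.card * n := by
    exact_mod_cast card_classEdges_one_le hS
  have c2 : ((classEdges n S 2).card : ℝ) ≤ S.card * S.card := by
    exact_mod_cast card_classEdges_two_le
  have v0 := hL.sum_var_le h₀ hn (fun e he => classEdges_ends he) c0
  have v1 := hL.sum_var_le h₀ hn (fun e he => classEdges_ends he) c1
  have v2 := hL.sum_var_le h₀ hn (fun e he => classEdges_ends he) c2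
  have w1 : ∀ i ∈ S, ∑ e ∈ incClass n S i 1, pr e * (1 - pr e) ≤ κ * (n * edgeRate γ α n 1) := by
    intro i hi
    refine hL.sum_var_le h₀ hn (fun e he => incClass_ends he) ?_
    rw [card_incClass_one hS hi]
    exact_mod_cast Nat.sub_le _ _
  have w2 : ∀ i ∈ S, ∑ e ∈ incClass n S i 2, pr e * (1 - pr e)
      ≤ κ * (S.card * edgeRate γ α n 2) := by
    intro i hi
    refine hL.sum_var_le h₀ hn (fun e he => incClass_ends he) ?_
    exact_mod_cast card_incClass_two_le hS hi
  have p1 := hA.bernstein (h := h) (s := edgePairs n) subset_rfl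
    (V := κ * (n * n * edgeRate γ α n 0 + S.card * n * edgeRate γ α n 1
        + S.card * S.card * edgeRate γ α n 2)) (by
      rw [sum_edgePairs_eq n S]; linarith)
  have p2 : ∀ i ∈ S, _ := fun i hi => hA.bernstein (h := h) (incEdges_subset n i)
    (V := κ * (n * edgeRate γ α n 1 + S.card * edgeRate γ α n 2)) (by
      rw [sum_incEdges_eq hi]; linarith [w1 i hi, w2 i hi])
  have p3 := hA.bernstein (h := h) (classEdges_subset n S 1) v1
  have p4 := hA.bernstein (h := h) (classEdges_subset n S 2) v2
  have p5 : ∀ i ∈ S, _ := fun i hi => hA.bernstein (h := h)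
    ((incClass_subset_classEdges n S i 2).trans (classEdges_subset n S 2)) (w2 i hi)
  have q2 := (measureReal_biUnion_finset_le (μ := P) S (fun i => {ω |
    h * (1 + √(κ * (n * edgeRate γ α n 1 + S.card * edgeRate γ α n 2)))
      ≤ |∑ e ∈ incEdges n i, (A ω e.1 e.2 - pr e)|})).trans (Finset.sum_le_card_nsmul _ _ _ p2)
  have q5 := (measureReal_biUnion_finset_le (μ := P) S (fun i => {ω |
    h * (1 + √(κ * (S.card * edgeRate γ α n 2)))
      ≤ |∑ e ∈ incClass n S i 2, (A ω e.1 e.2 - pr e)|})).trans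
        (Finset.sum_le_card_nsmul _ _ _ p5)
  have hsn : (S.card : ℝ) ≤ n := by
    exact_mod_cast (by simpa using Finset.card_le_card hS : S.card ≤ n)
  rw [nsmul_eq_mul] at q2 q5
  have he : 0 < 2 * Real.exp (1 - h) := by positivity
  refine (measureReal_le_of_subset_union p1 q2 p3 p4 q5 ?_).trans (by nlinarith)
  intro ω hω
  by_contra hc
  simp only [Set.mem_union, not_or] at hc
  refine hω ⟨?_, ?_, ?_, ?_, ?_⟩
  · exact (not_le.1 hc.1).le
  · exact fun i hi => (not_le.1 fun h' => hc.2.1 (Set.mem_biUnion hi h')).le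
  · exact (not_le.1 hc.2.2.1).le
  · exact (not_le.1 hc.2.2.2.1).le
  · exact fun i hi => (not_le.1 fun h' => hc.2.2.2.2 (Set.mem_biUnion hi h')).le

end Model

/-! ### Scales, and rates of convergence on typical graphs -/

lemma LinkBound.mono {γ α M₁ M₂ κ κ' : ℝ} {n : ℕ} {S : Finset ℕ}
    (hL : LinkBound γ α n S M₁ M₂ κ) (hn : 0 < n) (hκ : 0 < κ) (h : κ ≤ κ') :
    LinkBound γ α n S M₁ M₂ κ' := by
  intro m b hb e
  have hr := edgeRate_pos (γ := γ) (α := α) hn (endsIn S e)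
  refine ⟨((hL m b hb e).1).trans (by gcongr), fun he m' b' hb' z hz => ?_⟩
  exact le_trans (by gcongr) ((hL m b hb e).2 he m' b' hb' z hz)

/-- Inverse of the standard deviation of the estimator of a node parameter. -/
noncomputable def nodeScale (γ α : ℝ) (n : ℕ) : ℝ := (n : ℝ) ^ (1 / 2 - (γ - α) / 2)

/-- Inverse of the standard deviation of the estimator of the intercept. -/
noncomputable def interceptScale (γ : ℝ) (n : ℕ) : ℝ := (n : ℝ) ^ (1 - γ / 2)

/-- Relative size of the support. -/
noncomputable def suppRatio (α : ℝ) (n : ℕ) (S : Finset ℕ) : ℝ := S.card * (n : ℝ) ^ α / n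

section Scales

variable {γ α : ℝ} {n : ℕ}

lemma nodeScale_sq (hn : 0 < n) : nodeScale γ α n ^ 2 = n * edgeRate γ α n 1 := by
  have hn' : (0 : ℝ) < n := by exact_mod_cast hn
  unfold nodeScale edgeRate
  nth_rewrite 2 [← Real.rpow_one (n : ℝ)]
  rw [← Real.rpow_natCast, ← Real.rpow_mul hn'.le, ← Real.rpow_add hn']
  congr 1; push_cast; ring

lemma interceptScale_sq (hn : 0 < n) : interceptScale γ n ^ 2 = n * n * edgeRate γ α n 0 := by
  have hn' : (0 : ℝ) < n := by exact_mod_cast hn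
  unfold interceptScale edgeRate
  rw [show (n : ℝ) * n = (n : ℝ) ^ (2 : ℝ) by rw [Real.rpow_two, sq]]
  rw [← Real.rpow_natCast, ← Real.rpow_mul hn'.le, ← Real.rpow_add hn']
  congr 1; push_cast; ring

/-- This and the next two identities express every edge-count order through the two scales and the
ratio ρ, after which the exponents γ and α drop out of the error analysis. -/
lemma card_mul_rate_two (hn : 0 < n) (S : Finset ℕ) :
    S.card * edgeRate γ α n 2 = suppRatio α n S * nodeScale γ α n ^ 2 := by
  have hn' : (n : ℝ) ≠ 0 := by exact_mod_cast hn.ne'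
  rw [nodeScale_sq hn, edgeRate_succ γ α hn 1, suppRatio]
  field_simp

lemma card_mul_rate_one (hn : 0 < n) (S : Finset ℕ) :
    S.card * n * edgeRate γ α n 1 = suppRatio α n S * interceptScale γ n ^ 2 := by
  have hn' : (n : ℝ) ≠ 0 := by exact_mod_cast hn.ne'
  rw [interceptScale_sq (α := α) hn, edgeRate_succ γ α hn 0, suppRatio]
  field_simp

lemma card_sq_mul_rate_two (hn : 0 < n) (S : Finset ℕ) :
    S.card * S.card * edgeRate γ α n 2 = suppRatio α n S ^ 2 * interceptScale γ n ^ 2 := by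
  have hn' : (n : ℝ) ≠ 0 := by exact_mod_cast hn.ne'
  rw [interceptScale_sq (α := α) hn, edgeRate_succ γ α hn 1, edgeRate_succ γ α hn 0, suppRatio]
  field_simp

lemma suppRatio_nonneg (α : ℝ) (n : ℕ) (S : Finset ℕ) : 0 ≤ suppRatio α n S := by
  unfold suppRatio; positivity

lemma card_le_suppRatio (hα : 0 ≤ α) (hn : 0 < n) (S : Finset ℕ) :
    (S.card : ℝ) ≤ suppRatio α n S * n := by
  have hn' : (0 : ℝ) < n := by exact_mod_cast hn
  have : (1 : ℝ) ≤ (n : ℝ) ^ α := Real.one_le_rpow (by exact_mod_cast hn) hα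
  unfold suppRatio
  rw [div_mul_cancel₀ _ hn'.ne']
  exact le_mul_of_one_le_right (by positivity) this

end Scales

/-- Nonasymptotic conditions under which the estimator is controlled on typical graphs. The factor
`h` bounds the deviation of typical graphs and the spread of the parameter space, and `K` absorbs
the constants. -/
structure Regime (γ α : ℝ) (n : ℕ) (S : Finset ℕ) (M₁ M₂ h K : ℝ) : Prop where
  large : 8 ≤ n
  alpha_nonneg : 0 ≤ α
  subset : S ⊆ Finset.range n
  link : LinkBound γ α n S M₁ M₂ h
  one_le : 1 ≤ h
  cube_le : 24 * h ^ 3 ≤ K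
  one_le_node : 1 ≤ nodeScale γ α n
  node_le : nodeScale γ α n ≤ interceptScale γ n
  ratio_le : suppRatio α n S ≤ 1 / 4
  sq_ratio_le : K ^ 2 * suppRatio α n S ≤ 1 / 2

section Rates

variable {γ α M₁ M₂ h K : ℝ} {n : ℕ} {S : Finset ℕ} {m m₀ : ℝ} {b b₀ : ℕ → ℝ}
  {a : ℕ → ℕ → ℝ}

lemma Regime.pos (R : Regime γ α n S M₁ M₂ h K) : 0 < n := by have := R.large; omega

lemma Regime.card_le (R : Regime γ α n S M₁ M₂ h K) : (S.card : ℝ) ≤ n / 4 := by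
  have h1 := card_le_suppRatio R.alpha_nonneg R.pos S
  have hn : (0 : ℝ) < n := by exact_mod_cast R.pos
  nlinarith [R.ratio_le]

/-- At most a quarter of the nodes lie in `S` and n ≥ 8, so the exact count (n-s)(n-s-1)/2 is at
least 3n²/16. -/
lemma Regime.card_classEdges_zero_ge (R : Regime γ α n S M₁ M₂ h K) :
    (n : ℝ) * n / 8 ≤ (classEdges n S 0).card := by
  have hs := R.card_le
  have hn : (8 : ℝ) ≤ n := by exact_mod_cast R.large
  have hsn : S.card + 1 ≤ n := by
    have : (S.card : ℝ) + 1 ≤ n := by linarith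
    exact_mod_cast this
  have h1 : (2 : ℝ) * (classEdges n S 0).card = (n - S.card) * (n - S.card - 1) := by
    have := two_mul_card_classEdges_zero R.subset
    have h2 : ((2 * (classEdges n S 0).card : ℕ) : ℝ)
      = (((n - S.card) * (n - S.card - 1) : ℕ) : ℝ) := by rw [this]
    push_cast [Nat.cast_sub (show S.card ≤ n by omega),
      Nat.cast_sub (show 1 ≤ n - S.card by omega)] at h2
    exact h2
  have h2 : (n : ℝ) * (3 / 4) * (n / 2) ≤ (n - S.card) * (n - S.card - 1) := by
    apply mul_le_mul <;> linarith
  nlinarith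

lemma sqrt_mul_sq_le {x y c : ℝ} (hy : 0 ≤ y) (hc : 0 ≤ c) (h : x ≤ c ^ 2) :
    √(x * y ^ 2) ≤ c * y := by
  rw [Real.sqrt_le_left (by positivity), mul_pow]
  gcongr

lemma Regime.node_rate (R : Regime γ α n S M₁ M₂ h K)
    (ha : ∀ e ∈ edgePairs n, a e.1 e.2 = 0 ∨ a e.1 e.2 = 1)
    (hmle : IsMLE γ α n S M₁ M₂ a m b) (h₀ : InBox S M₁ M₂ m₀ b₀)
    (hT : IsTypicalGraph γ α n S m₀ b₀ h h a) :
    nodeScale γ α n * maxAbs S (fun i => b i - b₀ i)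
      ≤ K * (1 + nodeScale γ α n * |m - m₀|) := by
  have hB := R.one_le_node
  have hh := R.one_le
  have hK : 0 ≤ K := by linarith [R.cube_le, one_le_pow₀ (n := 3) hh]
  rcases S.eq_empty_or_nonempty with rfl | hne
  · simp only [maxAbs, Finset.sup_empty, bot_eq_zero', NNReal.coe_zero, mul_zero]
    positivity
  have key := R.link.maxAbs_node_le R.subset ha hmle h₀ hne hT.node
  have hn : (0 : ℝ) < n := by exact_mod_cast R.pos
  have hs := R.card_le
  have hr := edgeRate_pos (γ := γ) (α := α) R.pos 1
  rw [card_mul_rate_two R.pos, ← nodeScale_sq R.pos] at key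
  set B := nodeScale γ α n
  set V := maxAbs S fun i => b i - b₀ i
  have hV : 0 ≤ V := maxAbs_nonneg _ _
  set ρ := suppRatio α n S
  have hρ : ρ ≤ 1 / 4 := R.ratio_le
  have hu := abs_nonneg (m - m₀)
  have hlow : 3 / 4 * B ^ 2 ≤ (n - S.card) * edgeRate γ α n 1 := by
    rw [nodeScale_sq R.pos]; nlinarith
  have hup : (n - S.card) * edgeRate γ α n 1 ≤ B ^ 2 := by
    rw [nodeScale_sq R.pos]; gcongr; linarith [(Nat.cast_nonneg S.card : (0 : ℝ) ≤ S.card)]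
  have hsq : √(h * (B ^ 2 + ρ * B ^ 2)) ≤ 2 * h * B := by
    rw [show h * (B ^ 2 + ρ * B ^ 2) = (h * (1 + ρ)) * B ^ 2 by ring]
    exact sqrt_mul_sq_le (by linarith) (by linarith) (by nlinarith)
  have k1 : 3 / 4 * B ^ 2 / h * V ≤ h * (1 + 2 * h * B) + h * (B ^ 2 + 1 / 4 * B ^ 2) * |m - m₀| := by
    calc 3 / 4 * B ^ 2 / h * V ≤ (n - S.card) * edgeRate γ α n 1 / h * V := by gcongr
      _ ≤ _ := key
      _ ≤ _ := by gcongr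
  have k2 : 3 / 4 * B ^ 2 * V ≤ h * (h * (1 + 2 * h * B) + h * (B ^ 2 + 1 / 4 * B ^ 2) * |m - m₀|) := by
    have := mul_le_mul_of_nonneg_left k1 (by linarith : 0 ≤ h)
    refine le_trans (le_of_eq ?_) this
    field_simp
  have k3 : h * (1 + 2 * h * B) ≤ 3 * h ^ 2 * B := by nlinarith [mul_le_mul hh hB (by norm_num) (by linarith), mul_pos (by linarith : 0 < h) (by linarith : 0 < B)]
  -- Clearing the curvature constant costs a factor h, so at most h³ appears; `24 * h ^ 3 ≤ K`
  -- absorbs it together with the numerical constants.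
  have k4 : B * (B * V) ≤ B * (K * (1 + B * |m - m₀|)) := by
    have h3 : h ^ 2 ≤ h ^ 3 := pow_le_pow_right₀ hh (by norm_num)
    have e1 : h * (h * (1 + 2 * h * B)) ≤ h * (3 * h ^ 2 * B) := by gcongr
    have e2 : h ^ 3 * B ≤ K / 24 * B := by gcongr; linarith [R.cube_le]
    have e3 : h ^ 2 * (B ^ 2 * |m - m₀|) ≤ K / 24 * (B ^ 2 * |m - m₀|) := by
      gcongr; linarith [R.cube_le]
    have e4 : 0 ≤ K * B := by positivity
    have e5 : 0 ≤ K * (B ^ 2 * |m - m₀|) := by positivity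
    nlinarith
  exact le_of_mul_le_mul_left k4 (by linarith)

lemma Regime.intercept_rate (R : Regime γ α n S M₁ M₂ h K)
    (ha : ∀ e ∈ edgePairs n, a e.1 e.2 = 0 ∨ a e.1 e.2 = 1)
    (hmle : IsMLE γ α n S M₁ M₂ a m b) (h₀ : InBox S M₁ M₂ m₀ b₀)
    (hT : IsTypicalGraph γ α n S m₀ b₀ h h a) :
    interceptScale γ n * |m - m₀|
      ≤ K * (1 + suppRatio α n S * interceptScale γ n * maxAbs S (fun i => b i - b₀ i)) := by
  have hU : 1 ≤ interceptScale γ n := R.one_le_node.trans R.node_le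
  have hh := R.one_le
  have hK : 0 ≤ K := by linarith [R.cube_le, one_le_pow₀ (n := 3) hh]
  have key := R.link.abs_intercept_le R.subset R.pos ha hmle h₀ hT.total
  have hn : (0 : ℝ) < n := by exact_mod_cast R.pos
  have hr := edgeRate_pos (γ := γ) (α := α) R.pos 0
  have e2 : 2 * ((S.card : ℝ) * S.card) * edgeRate γ α n 2
      = 2 * (suppRatio α n S ^ 2 * interceptScale γ n ^ 2) := by
    rw [← card_sq_mul_rate_two R.pos]; ring
  rw [e2, card_sq_mul_rate_two R.pos, card_mul_rate_one R.pos, ← interceptScale_sq R.pos] at key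
  have hlow : interceptScale γ n ^ 2 / 8 ≤ (classEdges n S 0).card * edgeRate γ α n 0 := by
    rw [interceptScale_sq (α := α) R.pos]
    have := mul_le_mul_of_nonneg_right R.card_classEdges_zero_ge hr.le
    linarith
  set U := interceptScale γ n
  set V := maxAbs S fun i => b i - b₀ i
  have hV : 0 ≤ V := maxAbs_nonneg _ _
  set ρ := suppRatio α n S
  have hρ : ρ ≤ 1 / 4 := R.ratio_le
  have hρ0 : 0 ≤ ρ := suppRatio_nonneg _ _ _
  have hu := abs_nonneg (m - m₀)
  have hsq : √(h * (U ^ 2 + ρ * U ^ 2 + ρ ^ 2 * U ^ 2)) ≤ 2 * h * U := by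
    rw [show h * (U ^ 2 + ρ * U ^ 2 + ρ ^ 2 * U ^ 2) = (h * (1 + ρ + ρ ^ 2)) * U ^ 2 by ring]
    have h2 : h * (1 + ρ + ρ ^ 2) ≤ h * 4 := by gcongr; nlinarith
    exact sqrt_mul_sq_le (by linarith) (by linarith) (by nlinarith)
  have hρ2 : ρ * U ^ 2 + 2 * (ρ ^ 2 * U ^ 2) ≤ 2 * ρ * U ^ 2 := by nlinarith [sq_nonneg U, mul_nonneg hρ0 (sq_nonneg U)]
  have k1 : U ^ 2 / 8 / h * |m - m₀| ≤ h * (1 + 2 * h * U) + h * (2 * ρ * U ^ 2) * V := by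
    calc U ^ 2 / 8 / h * |m - m₀|
        ≤ (classEdges n S 0).card * edgeRate γ α n 0 / h * |m - m₀| := by gcongr
      _ ≤ _ := key
      _ ≤ _ := by gcongr
  have k2 : U ^ 2 / 8 * |m - m₀| ≤ h * (h * (1 + 2 * h * U) + h * (2 * ρ * U ^ 2) * V) := by
    have := mul_le_mul_of_nonneg_left k1 (by linarith : 0 ≤ h)
    refine le_trans (le_of_eq ?_) this
    field_simp
  have k3 : h * (1 + 2 * h * U) ≤ 3 * h ^ 2 * U := by
    nlinarith [mul_le_mul hh hU (by norm_num) (by linarith),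
      mul_pos (by linarith : 0 < h) (by linarith : 0 < U)]
  have k4 : U * (U * |m - m₀|) ≤ U * (K * (1 + ρ * U * V)) := by
    have h3 : h ^ 2 ≤ h ^ 3 := pow_le_pow_right₀ hh (by norm_num)
    have e1 : h * (h * (1 + 2 * h * U)) ≤ h * (3 * h ^ 2 * U) := by gcongr
    have e2 : h ^ 3 * U ≤ K / 24 * U := by gcongr; linarith [R.cube_le]
    have e3 : h ^ 2 * (ρ * U ^ 2 * V) ≤ K / 24 * (ρ * U ^ 2 * V) := by
      gcongr; linarith [R.cube_le]
    have e5 : 0 ≤ K * (ρ * U ^ 2 * V) := by positivity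
    nlinarith
  exact le_of_mul_le_mul_left k4 (by linarith)

/-- Consistency with explicit rates on typical graphs. -/
lemma Regime.rates (R : Regime γ α n S M₁ M₂ h K)
    (ha : ∀ e ∈ edgePairs n, a e.1 e.2 = 0 ∨ a e.1 e.2 = 1)
    (hmle : IsMLE γ α n S M₁ M₂ a m b) (h₀ : InBox S M₁ M₂ m₀ b₀)
    (hT : IsTypicalGraph γ α n S m₀ b₀ h h a) :
    |m - m₀| ≤ 2 * K / interceptScale γ n + 2 * K ^ 2 * suppRatio α n S / nodeScale γ α n ∧
    maxAbs S (fun i => b i - b₀ i) ≤ K / nodeScale γ α n + K * |m - m₀| := by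
  have h1 := R.node_rate ha hmle h₀ hT
  have h2 := R.intercept_rate ha hmle h₀ hT
  have hB := R.one_le_node
  have hU : 1 ≤ interceptScale γ n := hB.trans R.node_le
  have hρ0 := suppRatio_nonneg α n S
  have hK : 0 ≤ K := by linarith [R.cube_le, one_le_pow₀ (n := 3) R.one_le]
  have hKρ := R.sq_ratio_le
  set U := interceptScale γ n
  set B := nodeScale γ α n
  set V := maxAbs S fun i => b i - b₀ i
  set ρ := suppRatio α n S
  set u := |m - m₀| with hu
  have hu0 : 0 ≤ u := abs_nonneg _
  have hBp : 0 < B := by linarith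
  have hUp : 0 < U := by linarith
  have v1 : V ≤ K / B + K * u := by
    have : V ≤ K * (1 + B * u) / B := by rw [le_div_iff₀ hBp]; linarith
    refine this.trans (le_of_eq ?_)
    field_simp
  have u1 : u ≤ K / U + K * ρ * V := by
    have : u ≤ K * (1 + ρ * U * V) / U := by rw [le_div_iff₀ hUp]; linarith
    refine this.trans (le_of_eq ?_)
    field_simp
  refine ⟨?_, v1⟩
  have u2 : K * ρ * V ≤ K * ρ * (K / B + K * u) := by gcongr
  have u3 : K * ρ * (K / B + K * u) = K ^ 2 * ρ / B + K ^ 2 * ρ * u := by ring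
  -- Substituting the bound for V into that for u returns a multiple of u; it is at most half of u
  -- and moves to the left side.
  have u4 : K ^ 2 * ρ * u ≤ 1 / 2 * u := by gcongr
  have u5 : 2 * K / U + 2 * K ^ 2 * ρ / B = 2 * (K / U + K ^ 2 * ρ / B) := by ring
  rw [u5]
  linarith

end Rates

/-! ### Linearization of the score equations -/

section

/-- Variance of the number of edges in `s`. -/
noncomputable def edgeVar (γ α : ℝ) (n : ℕ) (S : Finset ℕ) (m₀ : ℝ) (b₀ : ℕ → ℝ)
    (s : Finset (ℕ × ℕ)) : ℝ :=
  ∑ e ∈ s, logisticDeriv (logOdds γ α n S m₀ b₀ e)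

variable {γ α M₁ M₂ h K : ℝ} {n : ℕ} {S : Finset ℕ} {m m₀ : ℝ} {b b₀ : ℕ → ℝ}
  {a : ℕ → ℕ → ℝ}

lemma LinkBound.abs_sum_edgeProb_sub_linear_le {κ : ℝ} (hL : LinkBound γ α n S M₁ M₂ κ)
    (h : InBox S M₁ M₂ m b) (h₀ : InBox S M₁ M₂ m₀ b₀) {s : Finset (ℕ × ℕ)} {k : ℕ} {w : ℝ}
    (hs : ∀ e ∈ s, endsIn S e = k) (hw : ∀ e ∈ s, endSum S (fun i => b i - b₀ i) e = w) :
    |∑ e ∈ s, (edgeProb γ α n S m b e - edgeProb γ α n S m₀ b₀ e)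
        - edgeVar γ α n S m₀ b₀ s * ((m - m₀) + w)|
      ≤ s.card * (κ * edgeRate γ α n k * ((m - m₀) + w) ^ 2) := by
  rw [edgeVar, Finset.sum_mul, ← Finset.sum_sub_distrib]
  refine (Finset.abs_sum_le_sum_abs _ _).trans ?_
  rw [← nsmul_eq_mul]
  refine Finset.sum_le_card_nsmul _ _ _ fun e he => ?_
  have := hL.abs_edgeProb_sub_linear_le h h₀ e
  rwa [hs e he, hw e he] at this

lemma LinkBound.abs_sum_edgeProb_sub_le {κ : ℝ} (hL : LinkBound γ α n S M₁ M₂ κ)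
    (h : InBox S M₁ M₂ m b) (h₀ : InBox S M₁ M₂ m₀ b₀) (hn : 0 < n) {s : Finset (ℕ × ℕ)} {k : ℕ}
    {N : ℝ} (hs : ∀ e ∈ s, endsIn S e = k) (hN : (s.card : ℝ) ≤ N) :
    |∑ e ∈ s, (edgeProb γ α n S m b e - edgeProb γ α n S m₀ b₀ e)|
      ≤ κ * (N * edgeRate γ α n k)
        * (|m - m₀| + k * maxAbs S fun i => b i - b₀ i) := by
  have hκ := hL.pos h hn
  have hr := edgeRate_pos (γ := γ) (α := α) hn k
  have hV := maxAbs_nonneg S fun i => b i - b₀ i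
  refine (Finset.abs_sum_le_sum_abs _ _).trans ?_
  have : ∑ e ∈ s, |edgeProb γ α n S m b e - edgeProb γ α n S m₀ b₀ e|
      ≤ s.card • (κ * edgeRate γ α n k * (|m - m₀| + k * maxAbs S fun i => b i - b₀ i)) := by
    refine Finset.sum_le_card_nsmul _ _ _ fun e he => ?_
    have h1 := hL.abs_edgeProb_sub_le h h₀ e
    have h2 := abs_endSum_le (S := S) (fun i => b i - b₀ i) e
    rw [hs e he] at h1 h2
    refine h1.trans ?_
    gcongr
    exact (abs_add_le _ _).trans (by gcongr)
  refine this.trans ?_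
  rw [nsmul_eq_mul]
  have h3 : (s.card : ℝ) * (κ * edgeRate γ α n k * (|m - m₀| + k * maxAbs S fun i => b i - b₀ i))
      ≤ N * (κ * edgeRate γ α n k * (|m - m₀| + k * maxAbs S fun i => b i - b₀ i)) := by gcongr
  refine h3.trans (le_of_eq ?_)
  ring

lemma LinkBound.edgeVar_le {κ : ℝ} (hL : LinkBound γ α n S M₁ M₂ κ)
    (h₀ : InBox S M₁ M₂ m₀ b₀) (hn : 0 < n) {s : Finset (ℕ × ℕ)} {k : ℕ} {N : ℝ}
    (hs : ∀ e ∈ s, endsIn S e = k) (hN : (s.card : ℝ) ≤ N) :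
    edgeVar γ α n S m₀ b₀ s ≤ κ * (N * edgeRate γ α n k) :=
  hL.sum_var_le h₀ hn hs hN

lemma LinkBound.le_edgeVar {κ : ℝ} (hL : LinkBound γ α n S M₁ M₂ κ)
    (h₀ : InBox S M₁ M₂ m₀ b₀) {s : Finset (ℕ × ℕ)} {k : ℕ} (hk : k ≤ 1)
    (hs : ∀ e ∈ s, endsIn S e = k) :
    s.card * (edgeRate γ α n k / κ) ≤ edgeVar γ α n S m₀ b₀ s := by
  refine card_nsmul_le_sum' _ _ _ fun e he => ?_
  have := (hL m₀ b₀ h₀ e).2 (by rw [hs e he]; exact hk) m₀ b₀ h₀ _ ⟨le_rfl, le_rfl⟩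
  rwa [hs e he] at this

lemma edgeVar_nonneg (s : Finset (ℕ × ℕ)) : 0 ≤ edgeVar γ α n S m₀ b₀ s :=
  Finset.sum_nonneg fun _ _ => (logisticDeriv_pos _).le

/-- Only the edges from `i` to the complement of `S` are expanded: there the log odds depend on the
intercept and `b i` alone. Edges inside `S` are few and are bounded crudely, both their drift and
their fluctuation. -/
lemma LinkBound.node_linearization {κ : ℝ} (hL : LinkBound γ α n S M₁ M₂ κ)
    (hS : S ⊆ Finset.range n) (h : InBox S M₁ M₂ m b) (h₀ : InBox S M₁ M₂ m₀ b₀)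
    {i : ℕ} (hi : i ∈ S)
    (hscore : ∑ e ∈ incEdges n i, (a e.1 e.2 - edgeProb γ α n S m b e) = 0) :
    |∑ e ∈ incClass n S i 1, (a e.1 e.2 - edgeProb γ α n S m₀ b₀ e)
        - edgeVar γ α n S m₀ b₀ (incClass n S i 1) * (b i - b₀ i)|
      ≤ κ * (n * edgeRate γ α n 1) * |m - m₀|
        + κ * (n * edgeRate γ α n 1) * (|m - m₀| + maxAbs S fun i => b i - b₀ i) ^ 2
        + κ * (S.card * edgeRate γ α n 2) * (|m - m₀| + 2 * maxAbs S fun i => b i - b₀ i)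
        + |∑ e ∈ incClass n S i 2, (a e.1 e.2 - edgeProb γ α n S m₀ b₀ e)| := by
  have hn : 0 < n := (Nat.zero_le _).trans_lt (Finset.mem_range.1 (hS hi))
  have hκ := hL.pos h hn
  have hr := edgeRate_pos (γ := γ) (α := α) hn 1
  have hc1 : ((incClass n S i 1).card : ℝ) ≤ n := by
    rw [card_incClass_one hS hi]; exact_mod_cast Nat.sub_le _ _
  have hc2 : ((incClass n S i 2).card : ℝ) ≤ S.card := by
    exact_mod_cast card_incClass_two_le hS hi
  have l1 := hL.abs_sum_edgeProb_sub_linear_le h h₀ (s := incClass n S i 1)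
    (fun e he => incClass_ends he) (fun e he => endSum_of_mem_incClass_one hi he _)
  have l2 := hL.abs_sum_edgeProb_sub_le h h₀ hn (s := incClass n S i 2)
    (fun e he => incClass_ends he) hc2
  have l3 := hL.edgeVar_le h₀ hn (s := incClass n S i 1) (fun e he => incClass_ends he) hc1
  set Q := edgeVar γ α n S m₀ b₀ (incClass n S i 1)
  have hQ : 0 ≤ Q := edgeVar_nonneg _
  have hv : |b i - b₀ i| ≤ maxAbs S fun i => b i - b₀ i := abs_le_maxAbs (v := fun i => b i - b₀ i) hi
  have hsq : (m - m₀ + (b i - b₀ i)) ^ 2 ≤ (|m - m₀| + maxAbs S fun i => b i - b₀ i) ^ 2 := by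
    rw [← sq_abs]
    gcongr
    exact (abs_add_le _ _).trans (by gcongr)
  have l1' : |∑ e ∈ incClass n S i 1, (edgeProb γ α n S m b e - edgeProb γ α n S m₀ b₀ e)
      - Q * (m - m₀ + (b i - b₀ i))|
      ≤ κ * (n * edgeRate γ α n 1) * (|m - m₀| + maxAbs S fun i => b i - b₀ i) ^ 2 := by
    refine l1.trans ?_
    have : ((incClass n S i 1).card : ℝ) * (κ * edgeRate γ α n 1 * (m - m₀ + (b i - b₀ i)) ^ 2)
      ≤ n * (κ * edgeRate γ α n 1 * (|m - m₀| + maxAbs S fun i => b i - b₀ i) ^ 2) := by gcongr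
    refine this.trans (le_of_eq ?_)
    ring
  have l3' : |Q * (m - m₀)| ≤ κ * (n * edgeRate γ α n 1) * |m - m₀| := by
    rw [abs_mul, abs_of_nonneg hQ]; gcongr
  rw [sum_incEdges_eq hi] at hscore
  -- The vanishing score lets the observed edges be traded for fitted probabilities, up to the edges
  -- inside `S`.
  have key : ∑ e ∈ incClass n S i 1, (a e.1 e.2 - edgeProb γ α n S m₀ b₀ e)
        - Q * (b i - b₀ i)
      = Q * (m - m₀)
        + (∑ e ∈ incClass n S i 1, (edgeProb γ α n S m b e - edgeProb γ α n S m₀ b₀ e)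
            - Q * (m - m₀ + (b i - b₀ i)))
        + ∑ e ∈ incClass n S i 2, (edgeProb γ α n S m b e - edgeProb γ α n S m₀ b₀ e)
        - ∑ e ∈ incClass n S i 2, (a e.1 e.2 - edgeProb γ α n S m₀ b₀ e) := by
    simp only [Finset.sum_sub_distrib] at hscore ⊢
    linarith
  rw [key]
  refine (abs_sub _ _).trans (add_le_add ?_ le_rfl)
  refine (abs_add_le _ _).trans (add_le_add ?_ (by simpa using l2))
  exact (abs_add_le _ _).trans (add_le_add l3' l1')

/-- The same device for the intercept: only edges outside `S` are expanded, since they do not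
involve the node parameters at all. -/
lemma LinkBound.intercept_linearization {κ : ℝ} (hL : LinkBound γ α n S M₁ M₂ κ)
    (hS : S ⊆ Finset.range n) (hn : 0 < n) (h : InBox S M₁ M₂ m b) (h₀ : InBox S M₁ M₂ m₀ b₀)
    (hscore : ∑ e ∈ edgePairs n, (a e.1 e.2 - edgeProb γ α n S m b e) = 0) :
    |∑ e ∈ classEdges n S 0, (a e.1 e.2 - edgeProb γ α n S m₀ b₀ e)
        - edgeVar γ α n S m₀ b₀ (classEdges n S 0) * (m - m₀)|
      ≤ κ * (n * n * edgeRate γ α n 0) * |m - m₀| ^ 2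
        + κ * (S.card * n * edgeRate γ α n 1) * (|m - m₀| + maxAbs S fun i => b i - b₀ i)
        + κ * (S.card * S.card * edgeRate γ α n 2)
          * (|m - m₀| + 2 * maxAbs S fun i => b i - b₀ i)
        + |∑ e ∈ classEdges n S 1, (a e.1 e.2 - edgeProb γ α n S m₀ b₀ e)|
        + |∑ e ∈ classEdges n S 2, (a e.1 e.2 - edgeProb γ α n S m₀ b₀ e)| := by
  have hκ := hL.pos h hn
  have hr := edgeRate_pos (γ := γ) (α := α) hn 0
  have c0 : ((classEdges n S 0).card : ℝ) ≤ n * n := by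
    exact_mod_cast card_classEdges_zero_le hS
  have c1 : ((classEdges n S 1).card : ℝ) ≤ S.card * n := by
    exact_mod_cast card_classEdges_one_le hS
  have c2 : ((classEdges n S 2).card : ℝ) ≤ S.card * S.card := by
    exact_mod_cast card_classEdges_two_le
  have l0 := hL.abs_sum_edgeProb_sub_linear_le h h₀ (s := classEdges n S 0) (w := 0)
    (fun e he => classEdges_ends he) (fun e he => by
      have hz := endsIn_eq_zero.1 (classEdges_ends he)
      simp [endSum, hz.1, hz.2])
  have l1 := hL.abs_sum_edgeProb_sub_le h h₀ hn (s := classEdges n S 1)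
    (fun e he => classEdges_ends he) c1
  have l2 := hL.abs_sum_edgeProb_sub_le h h₀ hn (s := classEdges n S 2)
    (fun e he => classEdges_ends he) c2
  rw [add_zero] at l0
  set Q := edgeVar γ α n S m₀ b₀ (classEdges n S 0)
  have l0' : |∑ e ∈ classEdges n S 0, (edgeProb γ α n S m b e - edgeProb γ α n S m₀ b₀ e)
      - Q * (m - m₀)| ≤ κ * (n * n * edgeRate γ α n 0) * |m - m₀| ^ 2 := by
    refine l0.trans ?_
    rw [sq_abs]
    have : ((classEdges n S 0).card : ℝ) * (κ * edgeRate γ α n 0 * (m - m₀) ^ 2)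
      ≤ n * n * (κ * edgeRate γ α n 0 * (m - m₀) ^ 2) := by gcongr
    refine this.trans (le_of_eq ?_)
    ring
  rw [sum_edgePairs_eq n S] at hscore
  have key : ∑ e ∈ classEdges n S 0, (a e.1 e.2 - edgeProb γ α n S m₀ b₀ e) - Q * (m - m₀)
      = (∑ e ∈ classEdges n S 0, (edgeProb γ α n S m b e - edgeProb γ α n S m₀ b₀ e)
            - Q * (m - m₀))
        + ∑ e ∈ classEdges n S 1, (edgeProb γ α n S m b e - edgeProb γ α n S m₀ b₀ e)
        + ∑ e ∈ classEdges n S 2, (edgeProb γ α n S m b e - edgeProb γ α n S m₀ b₀ e)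
        - ∑ e ∈ classEdges n S 1, (a e.1 e.2 - edgeProb γ α n S m₀ b₀ e)
        - ∑ e ∈ classEdges n S 2, (a e.1 e.2 - edgeProb γ α n S m₀ b₀ e) := by
    simp only [Finset.sum_sub_distrib] at hscore ⊢
    linarith
  rw [key]
  refine (abs_sub _ _).trans (add_le_add ?_ le_rfl)
  refine (abs_sub _ _).trans (add_le_add ?_ le_rfl)
  refine (abs_add_le _ _).trans (add_le_add ?_ (by simpa using l2))
  exact (abs_add_le _ _).trans (add_le_add l0' (by simpa using l1))

/-- Relative size of the remainder terms in the expansion of the score equations. -/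
noncomputable def remainderRate (γ α : ℝ) (n : ℕ) (S : Finset ℕ) : ℝ :=
  1 / nodeScale γ α n + nodeScale γ α n / interceptScale γ n + √(suppRatio α n S)
    + suppRatio α n S * interceptScale γ n / nodeScale γ α n

lemma Regime.one_le_K (R : Regime γ α n S M₁ M₂ h K) : 1 ≤ K := by
  linarith [R.cube_le, one_le_pow₀ (n := 3) R.one_le]

lemma Regime.h_le_K (R : Regime γ α n S M₁ M₂ h K) : h ≤ K := by
  have : h ^ 1 ≤ h ^ 3 := pow_le_pow_right₀ R.one_le (by norm_num)
  rw [pow_one] at this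
  linarith [R.cube_le, R.one_le]

/-- The hypothesis ρU ≤ B makes the contribution ρ/B of the node errors to the intercept error no
larger than 1/U. -/
lemma Regime.fast_rates (R : Regime γ α n S M₁ M₂ h K)
    (hρ : suppRatio α n S * interceptScale γ n ≤ nodeScale γ α n)
    (ha : ∀ e ∈ edgePairs n, a e.1 e.2 = 0 ∨ a e.1 e.2 = 1)
    (hmle : IsMLE γ α n S M₁ M₂ a m b) (h₀ : InBox S M₁ M₂ m₀ b₀)
    (hT : IsTypicalGraph γ α n S m₀ b₀ h h a) :
    |m - m₀| ≤ 4 * K ^ 2 / interceptScale γ n ∧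
    maxAbs S (fun i => b i - b₀ i) ≤ 5 * K ^ 3 / nodeScale γ α n := by
  obtain ⟨h1, h2⟩ := R.rates ha hmle h₀ hT
  have hK := R.one_le_K
  have hB := R.one_le_node
  have hBU := R.node_le
  have hU : 0 < interceptScale γ n := by linarith
  have hBp : 0 < nodeScale γ α n := by linarith
  have e1 : suppRatio α n S / nodeScale γ α n ≤ 1 / interceptScale γ n := by
    rw [div_le_div_iff₀ hBp hU]; linarith
  have k2 : K ≤ K ^ 2 := by nlinarith
  have k3 : K ^ 2 ≤ K ^ 3 := pow_le_pow_right₀ hK (by norm_num)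
  have u1 : |m - m₀| ≤ 4 * K ^ 2 / interceptScale γ n := by
    calc |m - m₀| ≤ _ := h1
      _ = (2 * K) / interceptScale γ n
          + 2 * K ^ 2 * (suppRatio α n S / nodeScale γ α n) := by ring
      _ ≤ (2 * K ^ 2) / interceptScale γ n + 2 * K ^ 2 * (1 / interceptScale γ n) := by gcongr
      _ = _ := by ring
  refine ⟨u1, ?_⟩
  calc _ ≤ _ := h2
    _ ≤ K ^ 3 / nodeScale γ α n + K * (4 * K ^ 2 / interceptScale γ n) := by
      gcongr; linarith
    _ ≤ K ^ 3 / nodeScale γ α n + K * (4 * K ^ 2 / nodeScale γ α n) := by gcongr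
    _ = _ := by ring

/-- Relative to B, the intercept error contributes B/U, the quadratic term 1/B, and the edges inside
`S` contribute √ρ (using ρ ≤ √ρ) and 1/B. -/
lemma Regime.node_expansion (R : Regime γ α n S M₁ M₂ h K)
    (hρ : suppRatio α n S * interceptScale γ n ≤ nodeScale γ α n)
    (ha : ∀ e ∈ edgePairs n, a e.1 e.2 = 0 ∨ a e.1 e.2 = 1)
    (hmle : IsMLE γ α n S M₁ M₂ a m b) (h₀ : InBox S M₁ M₂ m₀ b₀)
    (hT : IsTypicalGraph γ α n S m₀ b₀ h h a) {i : ℕ} (hi : i ∈ S) (h0 : 0 < b i) (h1 : b i < M₂) :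
    |∑ e ∈ incClass n S i 1, (a e.1 e.2 - edgeProb γ α n S m₀ b₀ e)
        - edgeVar γ α n S m₀ b₀ (incClass n S i 1) * (b i - b₀ i)|
      ≤ 100 * K ^ 7 * nodeScale γ α n * remainderRate γ α n S := by
  have hscore := le_antisymm (hmle.score_node_nonpos ha hi h1) (hmle.score_node_nonneg ha hi h0)
  have key := R.link.node_linearization R.subset hmle.1 h₀ hi hscore
  have hd := hT.node_two i hi
  obtain ⟨hu, hV⟩ := R.fast_rates hρ ha hmle h₀ hT
  refine key.trans ?_
  rw [card_mul_rate_two R.pos] at hd ⊢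
  rw [← nodeScale_sq R.pos]
  have hK := R.one_le_K
  have hh := R.one_le
  have hhK := R.h_le_K
  have hB := R.one_le_node
  have hBU := R.node_le
  have hρ0 := suppRatio_nonneg α n S
  have hρ1 := R.ratio_le
  unfold remainderRate
  set ρ := suppRatio α n S
  set B := nodeScale γ α n
  set U := interceptScale γ n
  set u := |m - m₀|
  set V := maxAbs S fun i => b i - b₀ i
  have hBp : 0 < B := by linarith
  have hUp : 0 < U := by linarith
  have hu0 : 0 ≤ u := abs_nonneg _
  have hV0 : 0 ≤ V := maxAbs_nonneg _ _
  have k23 : K ^ 2 ≤ K ^ 3 := pow_le_pow_right₀ hK (by norm_num)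
  have k7 : ∀ j ≤ 7, K ^ j ≤ K ^ 7 := fun j hj => pow_le_pow_right₀ hK hj
  have hu' : u ≤ 4 * K ^ 3 / B := hu.trans (by gcongr)
  have s0 := Real.sqrt_nonneg ρ
  have sρ : ρ ≤ √ρ := by
    rw [Real.le_sqrt hρ0 hρ0]; nlinarith
  have t1 : h * B ^ 2 * u ≤ 4 * K ^ 7 * (B * (B / U)) := by
    calc h * B ^ 2 * u ≤ K * B ^ 2 * (4 * K ^ 2 / U) := by gcongr
      _ = 4 * K ^ 3 * (B * (B / U)) := by field_simp
      _ ≤ _ := by gcongr; norm_num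
  -- This term sets the power of K: one factor from h and (4K³ + 5K³)² from the squared rates.
  have t2 : h * B ^ 2 * (u + V) ^ 2 ≤ 81 * K ^ 7 * (B * (1 / B)) := by
    calc h * B ^ 2 * (u + V) ^ 2 ≤ K * B ^ 2 * (4 * K ^ 3 / B + 5 * K ^ 3 / B) ^ 2 := by gcongr
      _ = _ := by field_simp; ring
  have t3 : h * (ρ * B ^ 2) * (u + 2 * V) ≤ 14 * K ^ 7 * (B * √ρ) := by
    calc h * (ρ * B ^ 2) * (u + 2 * V)
        ≤ K * (√ρ * B ^ 2) * (4 * K ^ 3 / B + 2 * (5 * K ^ 3 / B)) := by gcongr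
      _ = 14 * K ^ 4 * (B * √ρ) := by field_simp; ring
      _ ≤ _ := by gcongr; norm_num
  have hsq : √(h * (ρ * B ^ 2)) ≤ K * √ρ * B := by
    rw [show h * (ρ * B ^ 2) = (h * ρ) * B ^ 2 by ring]
    refine sqrt_mul_sq_le hBp.le (by positivity) ?_
    rw [mul_pow, Real.sq_sqrt hρ0]
    gcongr
    nlinarith
  have t4 : h * (1 + √(h * (ρ * B ^ 2))) ≤ K ^ 7 * (B * (1 / B)) + K ^ 7 * (B * √ρ) := by
    have q1 : h ≤ K ^ 7 * (B * (1 / B)) := by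
      rw [mul_one_div_cancel hBp.ne', mul_one]
      exact hhK.trans (by simpa using k7 1 (by norm_num))
    have q2 : h * √(h * (ρ * B ^ 2)) ≤ K ^ 7 * (B * √ρ) := by
      calc h * √(h * (ρ * B ^ 2)) ≤ K * (K * √ρ * B) := by gcongr
        _ = K ^ 2 * (B * √ρ) := by ring
        _ ≤ _ := by gcongr; norm_num
    linarith
  -- The term ρU/B is not needed for a node; it is carried so that both expansions share one
  -- remainder rate.
  have p0 : 0 ≤ K ^ 7 * (B * (ρ * U / B)) := by positivity
  have p1 : 0 ≤ K ^ 7 * (B * (1 / B)) := by positivity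
  have p2 : 0 ≤ K ^ 7 * (B * (B / U)) := by positivity
  have p3 : 0 ≤ K ^ 7 * (B * √ρ) := by positivity
  have fin : 100 * K ^ 7 * B * (1 / B + B / U + √ρ + ρ * U / B)
      = 100 * (K ^ 7 * (B * (1 / B))) + 100 * (K ^ 7 * (B * (B / U))) + 100 * (K ^ 7 * (B * √ρ))
        + 100 * (K ^ 7 * (B * (ρ * U / B))) := by ring
  rw [fin]
  linarith

/-- Relative to U, the drift of the edges touching `S` contributes ρU/B, their fluctuation √ρ and
1/B, and the quadratic term 1/U ≤ 1/B. The smallness of ρU/B is where the stronger sparsity of part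
(ii) is needed. -/
lemma Regime.intercept_expansion (R : Regime γ α n S M₁ M₂ h K)
    (hρ : suppRatio α n S * interceptScale γ n ≤ nodeScale γ α n)
    (ha : ∀ e ∈ edgePairs n, a e.1 e.2 = 0 ∨ a e.1 e.2 = 1)
    (hmle : IsMLE γ α n S M₁ M₂ a m b) (h₀ : InBox S M₁ M₂ m₀ b₀)
    (hT : IsTypicalGraph γ α n S m₀ b₀ h h a) (h0 : -M₁ < m) (h1 : m < M₁) :
    |∑ e ∈ classEdges n S 0, (a e.1 e.2 - edgeProb γ α n S m₀ b₀ e)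
        - edgeVar γ α n S m₀ b₀ (classEdges n S 0) * (m - m₀)|
      ≤ 100 * K ^ 7 * interceptScale γ n * remainderRate γ α n S := by
  have hscore := le_antisymm (hmle.score_intercept_nonpos ha h1)
    (hmle.score_intercept_nonneg ha h0)
  have key := R.link.intercept_linearization R.subset R.pos hmle.1 h₀ hscore
  have hd1 := hT.class_one
  have hd2 := hT.class_two
  obtain ⟨hu, hV⟩ := R.fast_rates hρ ha hmle h₀ hT
  refine key.trans ?_
  rw [card_mul_rate_one R.pos] at hd1
  rw [card_sq_mul_rate_two R.pos] at hd2
  rw [card_mul_rate_one R.pos, card_sq_mul_rate_two R.pos, ← interceptScale_sq R.pos]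
  have hK := R.one_le_K
  have hh := R.one_le
  have hhK := R.h_le_K
  have hB := R.one_le_node
  have hBU := R.node_le
  have hρ0 := suppRatio_nonneg α n S
  have hρ1 := R.ratio_le
  unfold remainderRate
  set ρ := suppRatio α n S
  set B := nodeScale γ α n
  set U := interceptScale γ n
  set u := |m - m₀|
  set V := maxAbs S fun i => b i - b₀ i
  have hBp : 0 < B := by linarith
  have hUp : 0 < U := by linarith
  have hu0 : 0 ≤ u := abs_nonneg _
  have hV0 : 0 ≤ V := maxAbs_nonneg _ _
  have k23 : K ^ 2 ≤ K ^ 3 := pow_le_pow_right₀ hK (by norm_num)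
  have k7 : ∀ j ≤ 7, K ^ j ≤ K ^ 7 := fun j hj => pow_le_pow_right₀ hK hj
  have hu' : u ≤ 4 * K ^ 3 / B := hu.trans (by gcongr)
  have s0 := Real.sqrt_nonneg ρ
  have sρ : ρ ≤ √ρ := by
    rw [Real.le_sqrt hρ0 hρ0]; nlinarith
  have ρρ : ρ ^ 2 ≤ ρ := by nlinarith
  have t1 : h * U ^ 2 * u ^ 2 ≤ 16 * K ^ 7 * (U * (1 / B)) := by
    calc h * U ^ 2 * u ^ 2 ≤ K * U ^ 2 * (4 * K ^ 2 / U) ^ 2 := by gcongr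
      _ = 16 * K ^ 5 * (U * (1 / U)) := by field_simp; ring
      _ ≤ _ := by gcongr; norm_num
  have t2 : h * (ρ * U ^ 2) * (u + V) ≤ 9 * K ^ 7 * (U * (ρ * U / B)) := by
    calc h * (ρ * U ^ 2) * (u + V) ≤ K * (ρ * U ^ 2) * (4 * K ^ 3 / B + 5 * K ^ 3 / B) := by gcongr
      _ = 9 * K ^ 4 * (U * (ρ * U / B)) := by field_simp; ring
      _ ≤ _ := by gcongr; norm_num
  have t3 : h * (ρ ^ 2 * U ^ 2) * (u + 2 * V) ≤ 14 * K ^ 7 * (U * (ρ * U / B)) := by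
    calc h * (ρ ^ 2 * U ^ 2) * (u + 2 * V)
        ≤ K * (ρ * U ^ 2) * (4 * K ^ 3 / B + 2 * (5 * K ^ 3 / B)) := by gcongr
      _ = 14 * K ^ 4 * (U * (ρ * U / B)) := by field_simp; ring
      _ ≤ _ := by gcongr; norm_num
  have hsq : √(h * (ρ * U ^ 2)) ≤ K * √ρ * U := by
    rw [show h * (ρ * U ^ 2) = (h * ρ) * U ^ 2 by ring]
    refine sqrt_mul_sq_le hUp.le (by positivity) ?_
    rw [mul_pow, Real.sq_sqrt hρ0]
    gcongr
    nlinarith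
  have hsq2 : √(h * (ρ ^ 2 * U ^ 2)) ≤ K * √ρ * U := by
    refine le_trans ?_ hsq
    gcongr
  have q1 : h ≤ K ^ 7 * (U * (1 / B)) := by
    refine hhK.trans ((show K ≤ K ^ 7 by simpa using k7 1 (by norm_num)).trans ?_)
    refine le_mul_of_one_le_right (by positivity) ?_
    rw [mul_one_div, one_le_div hBp]
    exact hBU
  have q2 : h * (K * √ρ * U) ≤ K ^ 7 * (U * √ρ) := by
    calc h * (K * √ρ * U) ≤ K * (K * √ρ * U) := by gcongr
      _ = K ^ 2 * (U * √ρ) := by ring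
      _ ≤ _ := by gcongr; norm_num
  have t4 : h * (1 + √(h * (ρ * U ^ 2))) ≤ K ^ 7 * (U * (1 / B)) + K ^ 7 * (U * √ρ) := by
    have := mul_le_mul_of_nonneg_left hsq (by linarith : 0 ≤ h)
    linarith
  have t5 : h * (1 + √(h * (ρ ^ 2 * U ^ 2))) ≤ K ^ 7 * (U * (1 / B)) + K ^ 7 * (U * √ρ) := by
    have := mul_le_mul_of_nonneg_left hsq2 (by linarith : 0 ≤ h)
    linarith
  have p0 : 0 ≤ K ^ 7 * (U * (ρ * U / B)) := by positivity
  have p1 : 0 ≤ K ^ 7 * (U * (1 / B)) := by positivity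
  have p2 : 0 ≤ K ^ 7 * (U * (B / U)) := by positivity
  have p3 : 0 ≤ K ^ 7 * (U * √ρ) := by positivity
  have fin : 100 * K ^ 7 * U * (1 / B + B / U + √ρ + ρ * U / B)
      = 100 * (K ^ 7 * (U * (1 / B))) + 100 * (K ^ 7 * (U * (B / U))) + 100 * (K ^ 7 * (U * √ρ))
        + 100 * (K ^ 7 * (U * (ρ * U / B))) := by ring
  rw [fin]
  linarith

end

/-! ### Asymptotics in n and consistency -/

lemma tendsto_natCast_rpow_neg {c : ℝ} (hc : 0 < c) :
    Tendsto (fun n : ℕ => (n : ℝ) ^ (-c)) atTop (𝓝 0) :=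
  (tendsto_rpow_neg_atTop hc).comp tendsto_natCast_atTop_atTop

lemma tendsto_natCast_rpow {c : ℝ} (hc : 0 < c) :
    Tendsto (fun n : ℕ => (n : ℝ) ^ c) atTop atTop :=
  (tendsto_rpow_atTop hc).comp tendsto_natCast_atTop_atTop

lemma IsLittleOBar.eventually_le {a : ℕ → ℝ} {x : ℝ}
    (h : IsLittleOBar a fun n => (n : ℝ) ^ x) :
    ∃ δ : ℝ, 0 < δ ∧ ∀ᶠ n : ℕ in atTop, a n ≤ (n : ℝ) ^ (x - δ) := by
  obtain ⟨c, hc, h⟩ := h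
  obtain ⟨C, hC⟩ := h.bound
  -- Half of the exponent is spent on absorbing the implicit constant.
  refine ⟨c / 2, by positivity, ?_⟩
  filter_upwards [hC, (tendsto_natCast_rpow (half_pos hc)).eventually_ge_atTop C,
    eventually_gt_atTop 0] with n h1 h2 hn
  have hn' : (0 : ℝ) < n := by exact_mod_cast hn
  rw [Real.norm_eq_abs, ← Real.rpow_add hn', Real.norm_eq_abs,
    abs_of_pos (Real.rpow_pos_of_pos hn' _)] at h1
  refine (le_abs_self _).trans (h1.trans ?_)
  calc C * (n : ℝ) ^ (-c + x) ≤ (n : ℝ) ^ (c / 2) * (n : ℝ) ^ (-c + x) := by gcongr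
    _ = _ := by rw [← Real.rpow_add hn']; congr 1; ring

lemma suppRatio_le_of_card_le {α δ : ℝ} {n : ℕ} {S : Finset ℕ} (hn : 0 < n)
    (h : (S.card : ℝ) ≤ (n : ℝ) ^ (1 - α - δ)) : suppRatio α n S ≤ (n : ℝ) ^ (-δ) := by
  have hn' : (0 : ℝ) < n := by exact_mod_cast hn
  unfold suppRatio
  rw [div_le_iff₀ hn']
  calc (S.card : ℝ) * (n : ℝ) ^ α ≤ (n : ℝ) ^ (1 - α - δ) * (n : ℝ) ^ α := by gcongr
    _ = (n : ℝ) ^ (-δ) * (n : ℝ) ^ (1 : ℝ) := by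
      rw [← Real.rpow_add hn', ← Real.rpow_add hn']; congr 1; ring
    _ = _ := by rw [Real.rpow_one]

lemma interceptScale_eq (γ α : ℝ) {n : ℕ} (hn : 0 < n) :
    interceptScale γ n = (n : ℝ) ^ ((1 - α) / 2) * nodeScale γ α n := by
  have hn' : (0 : ℝ) < n := by exact_mod_cast hn
  unfold interceptScale nodeScale
  rw [← Real.rpow_add hn']; congr 1; ring

lemma suppRatio_mul_le_of_card_le {γ α δ : ℝ} {n : ℕ} {S : Finset ℕ} (hn : 0 < n)
    (h : (S.card : ℝ) ≤ (n : ℝ) ^ ((1 - α) / 2 - δ)) :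
    suppRatio α n S * interceptScale γ n ≤ (n : ℝ) ^ (-δ) * nodeScale γ α n := by
  have hn' : (0 : ℝ) < n := by exact_mod_cast hn
  have h2 : suppRatio α n S ≤ (n : ℝ) ^ (-(δ + (1 - α) / 2)) :=
    suppRatio_le_of_card_le hn (h.trans (le_of_eq (by congr 1; ring)))
  rw [interceptScale_eq γ α hn, ← mul_assoc]
  have hB : 0 ≤ nodeScale γ α n := Real.rpow_nonneg hn'.le _
  gcongr
  calc _ ≤ (n : ℝ) ^ (-(δ + (1 - α) / 2)) * (n : ℝ) ^ ((1 - α) / 2) := by gcongr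
    _ = _ := by rw [← Real.rpow_add hn']; congr 1; ring

lemma eventually_exp_box_le {M₁ M₂ : ℕ → ℝ}
    (hM : (fun n => max (M₁ n) (M₂ n)) =o[atTop] fun n => Real.log (n : ℝ)) {ε : ℝ} (hε : 0 < ε) :
    ∀ᶠ n : ℕ in atTop, 4 * Real.exp (3 * max (M₁ n) (M₂ n)) ^ 3 ≤ (n : ℝ) ^ ε := by
  -- The exponent to control is 9 max(M₁, M₂) + log 4; each summand gets (ε/2) log n.
  have h1 := hM.bound (show 0 < ε / 18 by positivity)
  have hlog : Tendsto (fun n : ℕ => Real.log (n : ℝ)) atTop atTop :=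
    Real.tendsto_log_atTop.comp tendsto_natCast_atTop_atTop
  filter_upwards [h1, hlog.eventually_ge_atTop (2 * Real.log 4 / ε), hlog.eventually_ge_atTop 0,
    eventually_gt_atTop 0] with n h1 h2 h3 hn
  have hn' : (0 : ℝ) < n := by exact_mod_cast hn
  rw [Real.norm_eq_abs, Real.norm_eq_abs, abs_of_nonneg h3] at h1
  have h4 := (le_abs_self _).trans h1
  rw [div_le_iff₀ hε] at h2
  rw [← Real.exp_nat_mul, Real.rpow_def_of_pos hn']
  nth_rewrite 1 [← Real.exp_log (show (0 : ℝ) < 4 by norm_num)]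
  rw [← Real.exp_add, Real.exp_le_exp]
  push_cast
  linarith

lemma one_le_nodeScale {γ α : ℝ} (hγα : γ - α ≤ 1) {n : ℕ} (hn : 0 < n) :
    1 ≤ nodeScale γ α n :=
  Real.one_le_rpow (by exact_mod_cast hn) (by linarith)

lemma nodeScale_le {γ α : ℝ} (hα : α ≤ 1) {n : ℕ} (hn : 0 < n) :
    nodeScale γ α n ≤ interceptScale γ n :=
  Real.rpow_le_rpow_of_exponent_le (by exact_mod_cast hn) (by linarith)

/-- With h = n^(ε/4) and K = n^ε there is a spare factor n^(ε/4) in K over h³, which eventually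
exceeds 24; and 2ε < δ makes K²ρ vanish. -/
lemma eventually_regime {γ α : ℝ} (hγ : 0 ≤ γ) (hα : 0 ≤ α) (hα1 : α ≤ 1) (hαγ : α ≤ γ)
    (hγα : γ - α ≤ 1) {M₁ M₂ : ℕ → ℝ} (hM₁ : ∀ n, 0 < M₁ n)
    (hM : (fun n => max (M₁ n) (M₂ n)) =o[atTop] fun n => Real.log (n : ℝ))
    {S : ℕ → Finset ℕ} (hS : ∀ n, S n ⊆ Finset.range n) {ε δ : ℝ} (hε : 0 < ε) (hεδ : 2 * ε < δ)
    (hρ : ∀ᶠ n in atTop, suppRatio α n (S n) ≤ (n : ℝ) ^ (-δ)) :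
    ∀ᶠ n : ℕ in atTop, Regime γ α n (S n) (M₁ n) (M₂ n) ((n : ℝ) ^ (ε / 4)) ((n : ℝ) ^ ε) := by
  have hδ : 0 < δ := by linarith
  filter_upwards [hρ, eventually_ge_atTop 8, eventually_exp_box_le hM (show 0 < ε / 4 by positivity),
    (tendsto_natCast_rpow_neg hδ).eventually_le_const (show (0 : ℝ) < 1 / 4 by norm_num),
    (tendsto_natCast_rpow_neg (show 0 < δ - 2 * ε by linarith)).eventually_le_const
      (show (0 : ℝ) < 1 / 2 by norm_num),
    (tendsto_natCast_rpow (show 0 < ε / 4 by positivity)).eventually_ge_atTop 24]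
    with n h1 h2 h3 h4 h5 h6
  have hn : 0 < n := by omega
  have hn' : (0 : ℝ) < n := by exact_mod_cast hn
  refine ⟨h2, hα, hS n, ?_, ?_, ?_, one_le_nodeScale hγα hn, nodeScale_le hα1 hn, h1.trans h4, ?_⟩
  · exact (linkBound_of_le hγ hαγ hn (le_max_left _ _) (le_max_right _ _)
      ((hM₁ n).le.trans (le_max_left _ _))).mono hn (by positivity) h3
  · linarith
  · calc 24 * ((n : ℝ) ^ (ε / 4)) ^ 3 ≤ (n : ℝ) ^ (ε / 4) * ((n : ℝ) ^ (ε / 4)) ^ 3 := by gcongr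
      _ = (n : ℝ) ^ ε := by
        rw [← pow_succ', ← Real.rpow_natCast, ← Real.rpow_mul hn'.le]; congr 1; push_cast; ring
  · calc ((n : ℝ) ^ ε) ^ 2 * suppRatio α n (S n) ≤ ((n : ℝ) ^ ε) ^ 2 * (n : ℝ) ^ (-δ) := by gcongr
      _ = (n : ℝ) ^ (-(δ - 2 * ε)) := by
        rw [← Real.rpow_natCast, ← Real.rpow_mul hn'.le, ← Real.rpow_add hn']
        congr 1; push_cast; ring
      _ ≤ _ := h5

lemma tendsto_atypical_bound {c : ℝ} (hc : 0 < c) :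
    Tendsto (fun n : ℕ => (2 * (n : ℝ) + 3) * (2 * Real.exp (1 - (n : ℝ) ^ c))) atTop (𝓝 0) := by
  -- This choice gives n ≤ (n^c)^k, so the claim reduces to the exponential beating a power in the
  -- variable n^c.
  obtain ⟨k, hk⟩ := exists_nat_ge (1 / c)
  have h1 := (Real.tendsto_pow_mul_exp_neg_atTop_nhds_zero k).comp (tendsto_natCast_rpow hc)
  have h2 := h1.const_mul (10 * Real.exp 1)
  rw [mul_zero] at h2
  refine squeeze_zero' (Eventually.of_forall fun n => by positivity) ?_ h2
  filter_upwards [eventually_gt_atTop 0] with n hn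
  have hn1 : (1 : ℝ) ≤ n := by exact_mod_cast hn
  have h3 : (n : ℝ) ≤ ((n : ℝ) ^ c) ^ k := by
    rw [← Real.rpow_natCast, ← Real.rpow_mul (by linarith)]
    nth_rewrite 1 [← Real.rpow_one (n : ℝ)]
    apply Real.rpow_le_rpow_of_exponent_le hn1
    rwa [div_le_iff₀' hc] at hk
  have h4 : Real.exp (1 - (n : ℝ) ^ c) = Real.exp 1 * Real.exp (-(n : ℝ) ^ c) := by
    rw [← Real.exp_add]; congr 1
  simp only [Function.comp_apply]
  rw [h4]
  calc (2 * (n : ℝ) + 3) * (2 * (Real.exp 1 * Real.exp (-(n : ℝ) ^ c)))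
      ≤ (5 * ((n : ℝ) ^ c) ^ k) * (2 * (Real.exp 1 * Real.exp (-(n : ℝ) ^ c))) := by
        gcongr; linarith
    _ = _ := by ring

lemma isLittleOBarP_of_eventually {Ω : ℕ → Type*} [∀ n, MeasurableSpace (Ω n)]
    {P : ∀ n, Measure (Ω n)} [∀ n, IsProbabilityMeasure (P n)] {X : ∀ n, Ω n → ℝ}
    {G : ∀ n, Ω n → Prop} {p : ℕ → ℝ} (hp : Tendsto p atTop (𝓝 0))
    (hG : ∀ᶠ n in atTop, (P n).real {ω | ¬ G n ω} ≤ p n) {c C : ℝ} (hc : 0 < c)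
    (hX : ∀ᶠ n : ℕ in atTop, ∀ᵐ ω ∂(P n), G n ω → |X n ω| ≤ C * (n : ℝ) ^ (-c)) :
    IsLittleOBarP P X fun _ => 1 := by
  refine ⟨c, hc, fun ε hε => ⟨C, ?_⟩⟩
  filter_upwards [hG, hX, hp.eventually_le_const hε] with n h1 h2 h3
  refine le_trans ?_ (h1.trans h3)
  -- Outer measure suffices: neither event is assumed measurable.
  refine ENNReal.toReal_mono (measure_ne_top _ _) (measure_mono_ae ?_)
  filter_upwards [h2] with ω hω (hlt : _ < _)
  intro hGω
  rw [mul_one] at hlt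
  exact absurd (hω hGω) (not_le.2 hlt)

/-- Without ρU ≤ B, the bounds ρ ≤ 1 and B ≤ U still give both errors the node rate. -/
lemma Regime.slow_rates {γ α M₁ M₂ h K : ℝ} {n : ℕ} {S : Finset ℕ} {m m₀ : ℝ} {b b₀ : ℕ → ℝ}
    {a : ℕ → ℕ → ℝ} (R : Regime γ α n S M₁ M₂ h K)
    (ha : ∀ e ∈ edgePairs n, a e.1 e.2 = 0 ∨ a e.1 e.2 = 1)
    (hmle : IsMLE γ α n S M₁ M₂ a m b) (h₀ : InBox S M₁ M₂ m₀ b₀)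
    (hT : IsTypicalGraph γ α n S m₀ b₀ h h a) :
    |m - m₀| ≤ 5 * K ^ 3 / nodeScale γ α n ∧
    maxAbs S (fun i => b i - b₀ i) ≤ 5 * K ^ 3 / nodeScale γ α n := by
  obtain ⟨h1, h2⟩ := R.rates ha hmle h₀ hT
  have hK := R.one_le_K
  have hB := R.one_le_node
  have hBp : 0 < nodeScale γ α n := by linarith
  have k2 : K ≤ K ^ 2 := by nlinarith
  have k3 : K ^ 2 ≤ K ^ 3 := pow_le_pow_right₀ hK (by norm_num)
  have u1 : |m - m₀| ≤ 4 * K ^ 2 / nodeScale γ α n := by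
    have hρ : suppRatio α n S ≤ 1 := by linarith [R.ratio_le]
    calc |m - m₀| ≤ _ := h1
      _ ≤ 2 * K ^ 2 / nodeScale γ α n + 2 * K ^ 2 * 1 / nodeScale γ α n := by
        gcongr; exact R.node_le
      _ = _ := by ring
  refine ⟨u1.trans (by gcongr; norm_num), ?_⟩
  calc _ ≤ _ := h2
    _ ≤ K ^ 3 / nodeScale γ α n + K * (4 * K ^ 2 / nodeScale γ α n) := by
      gcongr; linarith
    _ = _ := by ring

/-- Consistency of the maximum likelihood estimator. -/
theorem consistency {γ α : ℝ} (hγ : 0 ≤ γ) (hα : 0 ≤ α) (hα1 : α ≤ 1) (hαγ : α ≤ γ)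
    (hγα : γ - α < 1) {M₁ M₂ : ℕ → ℝ} (hM₁ : ∀ n, 0 < M₁ n)
    (hM : (fun n => max (M₁ n) (M₂ n)) =o[atTop] fun n => Real.log (n : ℝ))
    {S : ℕ → Finset ℕ} (hS : ∀ n, S n ⊆ Finset.range n) {m₀ : ℕ → ℝ} {b₀ : ℕ → ℕ → ℝ}
    (hbox : ∀ n, InBox (S n) (M₁ n) (M₂ n) (m₀ n) (b₀ n))
    {Ω : ℕ → Type*} [∀ n, MeasurableSpace (Ω n)]
    {P : (n : ℕ) → Measure (Ω n)} [∀ n, IsProbabilityMeasure (P n)]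
    {A : (n : ℕ) → Ω n → ℕ → ℕ → ℝ}
    (hA : ∀ n, IsBernoulliGraph (P n) n (A n) (edgeProb γ α n (S n) (m₀ n) (b₀ n)))
    {mhat : (n : ℕ) → Ω n → ℝ} {bhat : (n : ℕ) → Ω n → ℕ → ℝ}
    (hMLE : ∀ n, ∀ᵐ ω ∂(P n),
      IsMLE γ α n (S n) (M₁ n) (M₂ n) (A n ω) (mhat n ω) (bhat n ω))
    (hs : IsLittleOBar (fun n => ((S n).card : ℝ)) (fun n => (n : ℝ) ^ (1 - α))) :
    IsLittleOBarP P (fun n ω => mhat n ω - m₀ n) (fun _ => 1) ∧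
    IsLittleOBarP P (fun n ω => maxAbs (S n) fun i => bhat n ω i - b₀ n i) (fun _ => 1) := by
  obtain ⟨δ, hδ, hs⟩ := hs.eventually_le
  have hρ : ∀ᶠ n in atTop, suppRatio α n (S n) ≤ (n : ℝ) ^ (-δ) := by
    filter_upwards [hs, eventually_gt_atTop 0] with n h1 hn
    exact suppRatio_le_of_card_le hn h1
  set β := 1 / 2 - (γ - α) / 2 with hβ
  have hβ0 : 0 < β := by rw [hβ]; linarith
  -- Two needs: 2ε < δ for the regime, and 3ε ≤ β/2 so that K³/B is at most n^(-β/2).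
  set ε := min δ β / 6 with hε
  have hε0 : 0 < ε := by positivity
  have hεδ : 2 * ε < δ := by have := min_le_left δ β; rw [hε]; linarith
  have hεβ : 3 * ε ≤ β / 2 := by have := min_le_right δ β; rw [hε]; linarith
  have hR := eventually_regime hγ hα hα1 hαγ hγα.le hM₁ hM hS hε0 hεδ hρ
  have hp := tendsto_atypical_bound (show 0 < ε / 4 by positivity)
  have hG : ∀ᶠ n : ℕ in atTop, (P n).real {ω | ¬ IsTypicalGraph γ α n (S n) (m₀ n) (b₀ n)
      ((n : ℝ) ^ (ε / 4)) ((n : ℝ) ^ (ε / 4)) (A n ω)}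
      ≤ (2 * (n : ℝ) + 3) * (2 * Real.exp (1 - (n : ℝ) ^ (ε / 4))) := by
    filter_upwards [hR] with n R
    exact R.link.prob_not_typical_le (hbox n) R.pos (hS n) (hA n) _
  have hrate : ∀ n : ℕ, 0 < n → 5 * ((n : ℝ) ^ ε) ^ 3 / nodeScale γ α n
      ≤ 5 * (n : ℝ) ^ (-(β / 2)) := by
    intro n hn
    have hn' : (0 : ℝ) < n := by exact_mod_cast hn
    rw [mul_div_assoc]
    gcongr
    rw [nodeScale, ← Real.rpow_natCast, ← Real.rpow_mul hn'.le, ← Real.rpow_sub hn']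
    apply Real.rpow_le_rpow_of_exponent_le (by exact_mod_cast hn)
    push_cast
    linarith
  constructor
  · refine isLittleOBarP_of_eventually hp hG (half_pos hβ0) (C := 5) ?_
    filter_upwards [hR] with n R
    filter_upwards [hMLE n] with ω hω hT
    exact ((R.slow_rates (fun e he => (hA n).zero_or_one ⟨e, he⟩ ω) hω (hbox n) hT).1).trans
      (hrate n R.pos)
  · refine isLittleOBarP_of_eventually hp hG (half_pos hβ0) (C := 5) ?_
    filter_upwards [hR] with n R
    filter_upwards [hMLE n] with ω hω hT
    rw [abs_of_nonneg (maxAbs_nonneg _ _)]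
    exact ((R.slow_rates (fun e he => (hA n).zero_or_one ⟨e, he⟩ ω) hω (hbox n) hT).2).trans
      (hrate n R.pos)

/-! ### Comparison of characteristic functions -/

section CharFun

variable {Ω : Type*} [MeasurableSpace Ω] {P : Measure Ω} [IsProbabilityMeasure P]

lemma norm_exp_mul_I_sub_exp_mul_I_le (x y : ℝ) :
    ‖Complex.exp (x * Complex.I) - Complex.exp (y * Complex.I)‖ ≤ |x - y| := by
  have e : Complex.exp (x * Complex.I) - Complex.exp (y * Complex.I)
      = Complex.exp (y * Complex.I) * (Complex.exp (Complex.I * (x - y : ℝ)) - 1) := by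
    rw [mul_sub, ← Complex.exp_add, mul_one]
    congr 2
    push_cast
    ring
  rw [e, norm_mul, Complex.norm_exp_ofReal_mul_I, one_mul]
  exact Real.norm_exp_I_mul_ofReal_sub_one_le

lemma norm_integral_exp_sub_le {f g : Ω → ℝ} (hf : AEMeasurable f P) (hg : AEMeasurable g P)
    {r p : ℝ} {G : Ω → Prop} (hr : 0 ≤ r) (hG : P.real {ω | ¬ G ω} ≤ p)
    (h : ∀ᵐ ω ∂P, G ω → |f ω - g ω| ≤ r) :
    ‖∫ ω, Complex.exp (f ω * Complex.I) ∂P - ∫ ω, Complex.exp (g ω * Complex.I) ∂P‖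
      ≤ r + 2 * p := by
  have hint : ∀ u : Ω → ℝ, AEMeasurable u P →
      Integrable (fun ω => Complex.exp (u ω * Complex.I)) P := by
    intro u hu
    refine Integrable.of_bound (C := 1) ?_ (ae_of_all _ fun ω => ?_)
    · have : Measurable fun x : ℝ => Complex.exp (x * Complex.I) := by fun_prop
      exact (this.comp_aemeasurable hu).aestronglyMeasurable
    · rw [Complex.norm_exp_ofReal_mul_I]
  -- `G` need not be measurable; a measurable hull of its complement has the same measure, and there
  -- the integrands differ by at most 2.
  set T := toMeasurable P {ω | ¬ G ω} with hT
  have hTm : MeasurableSet T := measurableSet_toMeasurable _ _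
  have hTp : P.real T ≤ p := by
    rw [measureReal_def, hT, measure_toMeasurable]; exact hG
  rw [← integral_sub (hint f hf) (hint g hg)]
  have hi2 : Integrable (fun ω => r + T.indicator (fun _ => (2 : ℝ)) ω) P :=
    (integrable_const _).add ((integrable_const _).indicator hTm)
  refine (norm_integral_le_of_norm_le hi2 ?_).trans ?_
  · filter_upwards [h] with ω hω
    by_cases hωT : ω ∈ T
    · rw [Set.indicator_of_mem hωT]
      refine (norm_sub_le _ _).trans ?_
      rw [Complex.norm_exp_ofReal_mul_I, Complex.norm_exp_ofReal_mul_I]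
      linarith
    · rw [Set.indicator_of_notMem hωT, add_zero]
      have hGω : G ω := by
        by_contra hc
        exact hωT (subset_toMeasurable P {ω | ¬ G ω} hc)
      exact (norm_exp_mul_I_sub_exp_mul_I_le _ _).trans (hω hGω)
  · rw [integral_add (integrable_const _) ((integrable_const _).indicator hTm),
      integral_indicator_const _ hTm, integral_const, probReal_univ]
    simp only [smul_eq_mul]
    linarith

variable {n : ℕ} {A : Ω → ℕ → ℕ → ℝ} {pr : ℕ × ℕ → ℝ} {ι : Type*} [Fintype ι]
  {cell : ι → Finset (ℕ × ℕ)}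

lemma sum_sum_ite_cell (hsub : ∀ k, cell k ⊆ edgePairs n) (f : ι → ℝ) (y : ℕ × ℕ → ℝ) :
    ∑ e : edgePairs n, (∑ k, if e.1 ∈ cell k then f k else 0) * y e.1
      = ∑ k, f k * ∑ e ∈ cell k, y e := by
  rw [Finset.sum_coe_sort (edgePairs n)
    (fun e => (∑ k, if e ∈ cell k then f k else 0) * y e)]
  simp_rw [Finset.sum_mul]
  rw [Finset.sum_comm]
  refine Finset.sum_congr rfl fun k _ => ?_
  rw [Finset.mul_sum]
  simp_rw [ite_mul, zero_mul]
  rw [← Finset.sum_filter, Finset.filter_mem_eq_inter, Finset.inter_eq_right.2 (hsub k)]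

lemma sum_ite_cell_eq (hdisj : Pairwise fun k l => Disjoint (cell k) (cell l)) (f : ι → ℝ)
    {e : ℕ × ℕ} {k : ι} (he : e ∈ cell k) : (∑ l, if e ∈ cell l then f l else 0) = f k := by
  classical
  rw [Finset.sum_eq_single k, if_pos he]
  · intro l _ hl
    exact if_neg fun hel => Finset.disjoint_left.1 (hdisj hl) hel he
  · simp

/-- Joint central limit theorem for the edge counts of disjoint sets of edges, at the level of
characteristic functions. -/
lemma IsBernoulliGraph.norm_charFun_cells_sub_le (hA : IsBernoulliGraph P n A pr)
    (hsub : ∀ k, cell k ⊆ edgePairs n)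
    (hdisj : Pairwise fun k l => Disjoint (cell k) (cell l)) {w : ι → ℝ} {δ : ℝ} (hδ0 : 0 ≤ δ)
    (hδ : δ ≤ 1) (hw : ∀ k, |w k| ≤ δ) :
    ‖∫ ω, Complex.exp ((∑ k, w k * ∑ e ∈ cell k, (A ω e.1 e.2 - pr e) : ℝ) * Complex.I) ∂P
        - (Real.exp (-(∑ k, w k ^ 2 * ∑ e ∈ cell k, pr e * (1 - pr e)) / 2) : ℂ)‖
      ≤ 2 * δ * ∑ k, w k ^ 2 * ∑ e ∈ cell k, pr e * (1 - pr e) := by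
  have hc : ∀ e : edgePairs n, |∑ k, if e.1 ∈ cell k then w k else 0| ≤ δ := by
    intro e
    by_cases he : ∃ k, e.1 ∈ cell k
    · obtain ⟨k, hk⟩ := he
      rw [sum_ite_cell_eq hdisj w hk]
      exact hw k
    · simp only [not_exists] at he
      simpa [he] using hδ0
  -- Disjointness kills the cross terms, so the total variance is a weighted sum of cell variances.
  have hsq : ∀ e : edgePairs n, (∑ k, if e.1 ∈ cell k then w k else 0) ^ 2
      = ∑ k, if e.1 ∈ cell k then w k ^ 2 else 0 := by
    intro e
    by_cases he : ∃ k, e.1 ∈ cell k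
    · obtain ⟨k, hk⟩ := he
      rw [sum_ite_cell_eq hdisj w hk, sum_ite_cell_eq hdisj (fun k => w k ^ 2) hk]
    · simp only [not_exists] at he
      simp [he]
  have key := norm_integral_exp_sum_sub_le hA.measurable hA.zero_or_one hA.prob hA.indep hδ hc
  have e1 : ∀ ω, ∑ e : edgePairs n, (∑ k, if e.1 ∈ cell k then w k else 0)
      * (A ω e.1.1 e.1.2 - pr e.1) = ∑ k, w k * ∑ e ∈ cell k, (A ω e.1 e.2 - pr e) :=
    fun ω => sum_sum_ite_cell hsub w fun e => A ω e.1 e.2 - pr e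
  have e2 : ∑ e : edgePairs n, (∑ k, if e.1 ∈ cell k then w k else 0) ^ 2
      * (pr e.1 * (1 - pr e.1)) = ∑ k, w k ^ 2 * ∑ e ∈ cell k, pr e * (1 - pr e) := by
    simp_rw [hsq]
    exact sum_sum_ite_cell hsub (fun k => w k ^ 2) fun e => pr e * (1 - pr e)
  rw [e2] at key
  simp_rw [e1] at key
  exact key

end CharFun

/-! ### Linear approximation of the normalized estimators -/

section Cells

variable {γ α M₁ M₂ h K : ℝ} {n : ℕ} {S F : Finset ℕ} {m m₀ : ℝ} {b b₀ : ℕ → ℝ}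
  {a : ℕ → ℕ → ℝ}

/-- The edges that determine the limit distribution of each estimated parameter. -/
def paramEdges (n : ℕ) (S F : Finset ℕ) : Option F → Finset (ℕ × ℕ)
  | none => classEdges n S 0
  | some i => incClass n S i 1

/-- Normalization of each estimated parameter. -/
noncomputable def paramScale (γ α : ℝ) (n : ℕ) (F : Finset ℕ) : Option F → ℝ
  | none => interceptScale γ n
  | some _ => nodeScale γ α n

/-- Estimation error of each parameter. -/
def paramError (F : Finset ℕ) (x : ℝ) (y : ℕ → ℝ) : Option F → ℝ
  | none => x
  | some i => y i

lemma scaledError_eq (γ α : ℝ) (n : ℕ) (F : Finset ℕ) (x : ℝ) (y : ℕ → ℝ) (k : Option F) :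
    scaledError γ α n F x y k = paramScale γ α n F k * paramError F x y k := by
  cases k <;> rfl

lemma paramEdges_subset (k : Option F) : paramEdges n S F k ⊆ edgePairs n := by
  cases k with
  | none => exact classEdges_subset n S 0
  | some i => exact (incClass_subset_classEdges n S i 1).trans (classEdges_subset n S 1)

/-- An edge shared by two distinct nodes of `F` would join them, hence have both end points in `S`,
whereas node cells contain only edges with one end point there. -/
lemma pairwise_disjoint_paramEdges (hF : F ⊆ S) :
    Pairwise fun k l => Disjoint (paramEdges n S F k) (paramEdges n S F l) := by
  have h01 : ∀ i, Disjoint (classEdges n S 0) (incClass n S i 1) := by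
    intro i
    rw [Finset.disjoint_left]
    intro e h0 h1
    have := classEdges_ends h0
    have := incClass_ends h1
    omega
  intro k l hkl
  cases k with
  | none =>
    cases l with
    | none => exact absurd rfl hkl
    | some j => exact h01 j
  | some i =>
    cases l with
    | none => exact (h01 i).symm
    | some j =>
      change Disjoint (incClass n S i 1) (incClass n S j 1)
      rw [Finset.disjoint_left]
      intro e hi hj
      have hij : i.1 ≠ j.1 := fun hij => hkl (congrArg some (Subtype.ext hij))
      have hi' : i.1 ∈ S := hF i.2
      have hj' : j.1 ∈ S := hF j.2
      have h1 := incClass_ends hi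
      simp only [incClass, incEdges, Finset.mem_filter] at hi hj
      have h2 : endsIn S e = 2 := by
        rw [endsIn_eq_two]
        rcases hi.1.2 with h | h <;> rcases hj.1.2 with h' | h'
        · exact absurd (h.symm.trans h') hij
        · exact ⟨h ▸ hi', h' ▸ hj'⟩
        · exact ⟨h' ▸ hj', h ▸ hi'⟩
        · exact absurd (h.symm.trans h') hij
      omega

lemma Regime.paramScale_sq_le (R : Regime γ α n S M₁ M₂ h K) (h₀ : InBox S M₁ M₂ m₀ b₀)
    (hF : F ⊆ S) (k : Option F) :
    paramScale γ α n F k ^ 2 ≤ 8 * h * edgeVar γ α n S m₀ b₀ (paramEdges n S F k) := by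
  have hh := R.one_le
  have hhp : 0 < h := by linarith
  cases k with
  | none =>
    have h1 := R.link.le_edgeVar h₀ (s := classEdges n S 0) zero_le_one
      fun e he => classEdges_ends he
    have h2 := R.card_classEdges_zero_ge
    have hr := edgeRate_pos (γ := γ) (α := α) R.pos 0
    change interceptScale γ n ^ 2 ≤ 8 * h * edgeVar γ α n S m₀ b₀ (classEdges n S 0)
    rw [interceptScale_sq (α := α) R.pos]
    calc (n : ℝ) * n * edgeRate γ α n 0
        = 8 * h * ((n : ℝ) * n / 8 * (edgeRate γ α n 0 / h)) := by field_simp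
      _ ≤ 8 * h * ((classEdges n S 0).card * (edgeRate γ α n 0 / h)) := by gcongr
      _ ≤ _ := by gcongr
  | some i =>
    have h1 := R.link.le_edgeVar h₀ (s := incClass n S i 1) le_rfl
      fun e he => incClass_ends he
    have hs := R.card_le
    have hr := edgeRate_pos (γ := γ) (α := α) R.pos 1
    have hsn : S.card ≤ n := by simpa using Finset.card_le_card R.subset
    have hn : (0 : ℝ) ≤ n := Nat.cast_nonneg n
    change nodeScale γ α n ^ 2 ≤ 8 * h * edgeVar γ α n S m₀ b₀ (incClass n S i 1)
    rw [card_incClass_one R.subset (hF i.2), Nat.cast_sub hsn] at h1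
    rw [nodeScale_sq R.pos]
    calc (n : ℝ) * edgeRate γ α n 1
        = 8 * h * ((n : ℝ) / 8 * (edgeRate γ α n 1 / h)) := by field_simp
      _ ≤ 8 * h * ((n - S.card) * (edgeRate γ α n 1 / h)) := by gcongr; linarith
      _ ≤ _ := by gcongr

lemma Regime.nodeScale_le_paramScale (R : Regime γ α n S M₁ M₂ h K) (k : Option F) :
    nodeScale γ α n ≤ paramScale γ α n F k := by
  cases k with
  | none => exact R.node_le
  | some i => exact le_rfl

lemma Regime.param_expansion (R : Regime γ α n S M₁ M₂ h K)
    (hρ : suppRatio α n S * interceptScale γ n ≤ nodeScale γ α n)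
    (ha : ∀ e ∈ edgePairs n, a e.1 e.2 = 0 ∨ a e.1 e.2 = 1)
    (hmle : IsMLE γ α n S M₁ M₂ a m b) (h₀ : InBox S M₁ M₂ m₀ b₀)
    (hT : IsTypicalGraph γ α n S m₀ b₀ h h a) (hm0 : -M₁ < m) (hm1 : m < M₁)
    (hb : ∀ i ∈ S, 0 < b i ∧ b i < M₂) (hF : F ⊆ S) (k : Option F) :
    |∑ e ∈ paramEdges n S F k, (a e.1 e.2 - edgeProb γ α n S m₀ b₀ e)
        - edgeVar γ α n S m₀ b₀ (paramEdges n S F k)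
          * paramError F (m - m₀) (fun i => b i - b₀ i) k|
      ≤ 100 * K ^ 7 * paramScale γ α n F k * remainderRate γ α n S := by
  cases k with
  | none => exact R.intercept_expansion hρ ha hmle h₀ hT hm0 hm1
  | some i => exact R.node_expansion hρ ha hmle h₀ hT (hF i.2) (hb i (hF i.2)).1 (hb i (hF i.2)).2

/-- Weight of the edges of each cell in the linear approximation of the normalized estimators. -/
noncomputable def paramWeight (γ α : ℝ) (n : ℕ) (S F : Finset ℕ) (m₀ : ℝ) (b₀ : ℕ → ℝ)
    (k : Option F) : ℝ :=
  paramScale γ α n F k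
    / (√(asymVar γ α m₀ b₀ F k) * edgeVar γ α n S m₀ b₀ (paramEdges n S F k))

lemma exp_neg_le_asymVar {M : ℝ} (h₀ : InBox S M₁ M₂ m₀ b₀) (h1 : M₁ ≤ M) (h2 : M₂ ≤ M)
    (hM : 0 ≤ M) (hF : F ⊆ S) (k : Option F) :
    Real.exp (-(2 * M)) ≤ asymVar γ α m₀ b₀ F k := by
  have hm := h₀.1.2
  cases k with
  | none =>
    have e : Real.exp (-(2 * M)) ≤ Real.exp (-m₀) := Real.exp_le_exp.2 (by linarith)
    have p1 := Real.exp_pos (-m₀)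
    have p2 := Real.exp_pos m₀
    unfold asymVar
    split_ifs <;> linarith
  | some i =>
    have hb := (h₀.2 i (hF i.2)).2
    have e : Real.exp (-(2 * M)) ≤ Real.exp (-m₀ - b₀ i) := Real.exp_le_exp.2 (by linarith)
    have p2 := Real.exp_pos (m₀ + b₀ i)
    unfold asymVar
    split_ifs <;> linarith

/-- The cell variance is at least the squared scale divided by 8h, so a weight is of order 1/scale
up to powers of h. This makes single edges negligible in the limit theorem and keeps the remainder
small after normalization. -/
lemma Regime.paramWeight_mul_scale_le (R : Regime γ α n S M₁ M₂ h K) (h₀ : InBox S M₁ M₂ m₀ b₀)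
    (hF : F ⊆ S) {k : Option F} (hv : 1 / h ≤ asymVar γ α m₀ b₀ F k) :
    0 ≤ paramWeight γ α n S F m₀ b₀ k ∧
    paramWeight γ α n S F m₀ b₀ k * paramScale γ α n F k ≤ 8 * h ^ 2 := by
  have hh := R.one_le
  have hhp : 0 < h := by linarith
  have hs : 1 ≤ paramScale γ α n F k := R.one_le_node.trans (R.nodeScale_le_paramScale k)
  have h1 := R.paramScale_sq_le h₀ hF k
  have hQ : 0 < edgeVar γ α n S m₀ b₀ (paramEdges n S F k) := by
    by_contra hc
    nlinarith [mul_nonneg hhp.le (sub_nonneg.2 (not_lt.1 hc))]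
  have h2 : 1 / h ≤ √(asymVar γ α m₀ b₀ F k) := by
    apply Real.le_sqrt_of_sq_le
    refine le_trans ?_ hv
    rw [div_pow, one_pow]
    exact one_div_le_one_div_of_le hhp (by nlinarith)
  have h3 : 0 < √(asymVar γ α m₀ b₀ F k) := lt_of_lt_of_le (by positivity) h2
  unfold paramWeight
  refine ⟨by positivity, ?_⟩
  rw [div_mul_eq_mul_div, div_le_iff₀ (by positivity), ← sq]
  have h4 : 1 ≤ h * √(asymVar γ α m₀ b₀ F k) := by
    rw [div_le_iff₀ hhp] at h2; linarith
  calc _ ≤ 8 * h * edgeVar γ α n S m₀ b₀ (paramEdges n S F k) * 1 := by rw [mul_one]; exact h1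
    _ ≤ 8 * h * edgeVar γ α n S m₀ b₀ (paramEdges n S F k) * (h * √(asymVar γ α m₀ b₀ F k)) := by
      gcongr
    _ = _ := by ring

lemma Regime.edgeVar_paramEdges_pos (R : Regime γ α n S M₁ M₂ h K) (h₀ : InBox S M₁ M₂ m₀ b₀)
    (hF : F ⊆ S) (k : Option F) : 0 < edgeVar γ α n S m₀ b₀ (paramEdges n S F k) := by
  have hhp : 0 < h := by linarith [R.one_le]
  have hs : 1 ≤ paramScale γ α n F k := R.one_le_node.trans (R.nodeScale_le_paramScale k)
  have h1 := R.paramScale_sq_le h₀ hF k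
  by_contra hc
  nlinarith [mul_nonneg hhp.le (sub_nonneg.2 (not_lt.1 hc))]

/-- The difference is exactly the weight times the expansion error; weight times scale costs 8h² ≤
8K², which turns K⁷ into K⁹. -/
lemma Regime.abs_normalized_sub_le (R : Regime γ α n S M₁ M₂ h K) (h₀ : InBox S M₁ M₂ m₀ b₀)
    (hF : F ⊆ S) {k : Option F} (hv : 1 / h ≤ asymVar γ α m₀ b₀ F k) {x D r : ℝ}
    (hD : |D - edgeVar γ α n S m₀ b₀ (paramEdges n S F k) * x|
      ≤ 100 * K ^ 7 * paramScale γ α n F k * r) (hr : 0 ≤ r) :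
    |(√(asymVar γ α m₀ b₀ F k))⁻¹ * (paramScale γ α n F k * x)
        - paramWeight γ α n S F m₀ b₀ k * D| ≤ 800 * (K ^ 9 * r) := by
  obtain ⟨hw, hws⟩ := R.paramWeight_mul_scale_le h₀ hF hv
  have hQ := R.edgeVar_paramEdges_pos h₀ hF k
  have hK := R.one_le_K
  have hhK := R.h_le_K
  have hh := R.one_le
  have hv0 : 0 < √(asymVar γ α m₀ b₀ F k) :=
    Real.sqrt_pos.2 (lt_of_lt_of_le (by positivity) hv)
  have e : (√(asymVar γ α m₀ b₀ F k))⁻¹ * (paramScale γ α n F k * x)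
        - paramWeight γ α n S F m₀ b₀ k * D
      = -(paramWeight γ α n S F m₀ b₀ k
        * (D - edgeVar γ α n S m₀ b₀ (paramEdges n S F k) * x)) := by
    have : (√(asymVar γ α m₀ b₀ F k))⁻¹ * paramScale γ α n F k
        = paramWeight γ α n S F m₀ b₀ k * edgeVar γ α n S m₀ b₀ (paramEdges n S F k) := by
      unfold paramWeight
      field_simp
    rw [← mul_assoc, this]
    ring
  rw [e, abs_neg, abs_mul, abs_of_nonneg hw]
  calc _ ≤ paramWeight γ α n S F m₀ b₀ k * (100 * K ^ 7 * paramScale γ α n F k * r) := by gcongr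
    _ = (paramWeight γ α n S F m₀ b₀ k * paramScale γ α n F k) * (100 * K ^ 7 * r) := by ring
    _ ≤ 8 * h ^ 2 * (100 * K ^ 7 * r) := by gcongr
    _ ≤ 8 * K ^ 2 * (100 * K ^ 7 * r) := by gcongr
    _ = _ := by ring

lemma Regime.paramWeight_le (R : Regime γ α n S M₁ M₂ h K) (h₀ : InBox S M₁ M₂ m₀ b₀)
    (hF : F ⊆ S) {k : Option F} (hv : 1 / h ≤ asymVar γ α m₀ b₀ F k) :
    |paramWeight γ α n S F m₀ b₀ k| ≤ 8 * K ^ 2 / nodeScale γ α n := by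
  obtain ⟨hw, hws⟩ := R.paramWeight_mul_scale_le h₀ hF hv
  have hB := R.one_le_node
  have hhK := R.h_le_K
  have hh := R.one_le
  rw [abs_of_nonneg hw, le_div_iff₀ (by linarith)]
  calc _ ≤ paramWeight γ α n S F m₀ b₀ k * paramScale γ α n F k := by
        gcongr; exact R.nodeScale_le_paramScale k
    _ ≤ 8 * h ^ 2 := hws
    _ ≤ _ := by gcongr

end Cells

/-! ### Exact variances and their limits -/

lemma edgeVar_eq_card_mul {γ α m₀ w : ℝ} {n k : ℕ} {S : Finset ℕ} {b₀ : ℕ → ℝ}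
    {s : Finset (ℕ × ℕ)} (hn : 0 < n) (hs : ∀ e ∈ s, endsIn S e = k)
    (hw : ∀ e ∈ s, endSum S b₀ e = w) :
    edgeVar γ α n S m₀ b₀ s = s.card * (edgeRate γ α n k * Real.exp (m₀ + w)
      / (1 + edgeRate γ α n k * Real.exp (m₀ + w)) ^ 2) := by
  have hn' : (0 : ℝ) < n := by exact_mod_cast hn
  rw [edgeVar, ← nsmul_eq_mul]
  refine Finset.sum_eq_card_nsmul fun e he => ?_
  have e1 : Real.exp (logOdds γ α n S m₀ b₀ e) = edgeRate γ α n k * Real.exp (m₀ + w) := by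
    rw [logOdds_eq, hs e he, hw e he, edgeRate, Real.rpow_def_of_pos hn', ← Real.exp_add]
    congr 1; ring
  rw [logisticDeriv_eq, e1]

lemma paramWeight_sq_mul {γ α m₀ : ℝ} {n : ℕ} {S F : Finset ℕ} {b₀ : ℕ → ℝ} {k : Option F}
    (hv : 0 < asymVar γ α m₀ b₀ F k) (hQ : edgeVar γ α n S m₀ b₀ (paramEdges n S F k) ≠ 0) :
    paramWeight γ α n S F m₀ b₀ k ^ 2 * edgeVar γ α n S m₀ b₀ (paramEdges n S F k)
      = paramScale γ α n F k ^ 2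
        / (asymVar γ α m₀ b₀ F k * edgeVar γ α n S m₀ b₀ (paramEdges n S F k)) := by
  unfold paramWeight
  rw [div_pow, mul_pow, Real.sq_sqrt hv.le]
  field_simp

lemma asymVar_pos (γ α m : ℝ) (b : ℕ → ℝ) (F : Finset ℕ) (k : Option F) :
    0 < asymVar γ α m b F k := by
  cases k <;> unfold asymVar <;> split_ifs <;> positivity

/-- The ratio between the exact and the asymptotic variance function of an edge. -/
lemma node_variance_ratio {γ α m₀ : ℝ} (hαγ : α ≤ γ) {n : ℕ} (hn : 0 < n) {S F : Finset ℕ}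
    {b₀ : ℕ → ℝ} (hS : S ⊆ Finset.range n) (hsn : S.card < n) (hF : F ⊆ S) (i : F) :
    paramWeight γ α n S F m₀ b₀ (some i) ^ 2
        * edgeVar γ α n S m₀ b₀ (paramEdges n S F (some i))
      = (1 - (S.card : ℝ) / n)⁻¹ * (if α < γ then
          (1 + edgeRate γ α n 1 * Real.exp (m₀ + b₀ i)) ^ 2 else 1) := by
  have hn' : (0 : ℝ) < n := by exact_mod_cast hn
  have hsn' : (0 : ℝ) < n - S.card := by
    have : (S.card : ℝ) < n := by exact_mod_cast hsn
    linarith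
  have hr := edgeRate_pos (γ := γ) (α := α) hn 1
  have hQ : edgeVar γ α n S m₀ b₀ (paramEdges n S F (some i))
      = (n - S.card) * (edgeRate γ α n 1 * Real.exp (m₀ + b₀ i)
        / (1 + edgeRate γ α n 1 * Real.exp (m₀ + b₀ i)) ^ 2) := by
    change edgeVar γ α n S m₀ b₀ (incClass n S i 1) = _
    rw [edgeVar_eq_card_mul hn (fun e he => incClass_ends he)
      (fun e he => endSum_of_mem_incClass_one (hF i.2) he b₀), card_incClass_one hS (hF i.2),
      Nat.cast_sub hsn.le]
  rw [paramWeight_sq_mul (asymVar_pos _ _ _ _ _ _) (by rw [hQ]; positivity), hQ]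
  change nodeScale γ α n ^ 2 / _ = _
  rw [nodeScale_sq hn]
  have hne : (1 : ℝ) - S.card / n = (n - S.card) / n := by field_simp
  rw [hne]
  have hexp : -m₀ - b₀ i = -(m₀ + b₀ i) := by ring
  by_cases h : α < γ
  · have hv : asymVar γ α m₀ b₀ F (some i) = Real.exp (-m₀ - b₀ i) := if_pos h
    rw [if_pos h, hv, hexp, Real.exp_neg]
    field_simp
  -- Now α = γ, the edges of the cell are not sparse, and the asymptotic variance is the exact
  -- reciprocal (1 + x)²/x at x = exp(m₀ + b₀ i).
  · have hr1 : edgeRate γ α n 1 = 1 := by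
      have : α = γ := le_antisymm hαγ (not_lt.1 h)
      simp [edgeRate, this]
    have hv : asymVar γ α m₀ b₀ F (some i)
      = 2 + Real.exp (-m₀ - b₀ i) + Real.exp (m₀ + b₀ i) := if_neg h
    rw [if_neg h, hv, hr1, hexp, Real.exp_neg]
    have := Real.exp_pos (m₀ + b₀ i)
    field_simp
    ring

lemma intercept_variance_ratio {γ α m₀ : ℝ} (hα : 0 ≤ α) (hαγ : α ≤ γ) {n : ℕ} (hn : 0 < n)
    {S F : Finset ℕ} {b₀ : ℕ → ℝ} (hS : S ⊆ Finset.range n) (hsn : S.card + 1 < n) :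
    paramWeight γ α n S F m₀ b₀ none ^ 2
        * edgeVar γ α n S m₀ b₀ (paramEdges n S F none)
      = ((1 - (S.card : ℝ) / n) * (1 - (S.card : ℝ) / n - 1 / n))⁻¹ * (if 0 < γ then
          (1 + edgeRate γ α n 0 * Real.exp m₀) ^ 2 else 1) := by
  have hn' : (0 : ℝ) < n := by exact_mod_cast hn
  have hsn' : (0 : ℝ) < n - S.card - 1 := by
    have : (S.card : ℝ) + 1 < n := by exact_mod_cast hsn
    linarith
  have hsn2 : (0 : ℝ) < n - S.card := by linarith
  have hr := edgeRate_pos (γ := γ) (α := α) hn 0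
  have hcard : ((classEdges n S 0).card : ℝ) = (n - S.card) * (n - S.card - 1) / 2 := by
    have := two_mul_card_classEdges_zero hS
    have h2 : ((2 * (classEdges n S 0).card : ℕ) : ℝ)
      = (((n - S.card) * (n - S.card - 1) : ℕ) : ℝ) := by rw [this]
    push_cast [Nat.cast_sub (show S.card ≤ n by omega),
      Nat.cast_sub (show 1 ≤ n - S.card by omega)] at h2
    linarith
  have hQ : edgeVar γ α n S m₀ b₀ (paramEdges n S F none)
      = (n - S.card) * (n - S.card - 1) / 2 * (edgeRate γ α n 0 * Real.exp m₀
        / (1 + edgeRate γ α n 0 * Real.exp m₀) ^ 2) := by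
    change edgeVar γ α n S m₀ b₀ (classEdges n S 0) = _
    rw [edgeVar_eq_card_mul hn (w := 0) (fun e he => classEdges_ends he) (fun e he => by
      have hz := endsIn_eq_zero.1 (classEdges_ends he)
      simp [endSum, hz.1, hz.2]), hcard, add_zero]
  rw [paramWeight_sq_mul (asymVar_pos _ _ _ _ _ _) (by rw [hQ]; positivity), hQ]
  change interceptScale γ n ^ 2 / _ = _
  rw [interceptScale_sq (α := α) hn]
  have hne : (1 : ℝ) - S.card / n = (n - S.card) / n := by field_simp
  have hne2 : (n - S.card) / n - 1 / n = ((n : ℝ) - S.card - 1) / n := by field_simp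
  rw [hne, hne2]
  by_cases h : 0 < γ
  -- For the intercept the first two cases of the theorem agree: edges outside `S` are sparse as
  -- soon as γ > 0.
  · have hv : asymVar γ α m₀ b₀ F none = 2 * Real.exp (-m₀) := by
      unfold asymVar; split_ifs <;> rfl
    rw [if_pos h, hv, Real.exp_neg]
    field_simp
  · have hγ0 : γ = 0 := le_antisymm (not_lt.1 h) (hα.trans hαγ)
    have hα0 : α = 0 := le_antisymm (hαγ.trans hγ0.le) hα
    have hr1 : edgeRate γ α n 0 = 1 := by simp [edgeRate, hγ0]
    have hv : asymVar γ α m₀ b₀ F none = 4 + 2 * Real.exp (-m₀) + 2 * Real.exp m₀ := by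
      simp [asymVar, hγ0, hα0]
    rw [if_neg h, hv, hr1, Real.exp_neg]
    have := Real.exp_pos m₀
    field_simp
    ring

section Limits

variable {γ α : ℝ} {M₁ M₂ : ℕ → ℝ} {S : ℕ → Finset ℕ} {m₀ : ℕ → ℝ} {b₀ : ℕ → ℕ → ℝ}
  {F : Finset ℕ}

/-- The parameter space grows like o(log n), so its exponential is below n^(c/2) and cannot offset
n^(-c). -/
lemma tendsto_rate_mul_exp {c : ℝ} (hc : 0 < c) {r y : ℕ → ℝ} (hr : ∀ᶠ n : ℕ in atTop, r n = (n : ℝ) ^ (-c))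
    (hM : (fun n => max (M₁ n) (M₂ n)) =o[atTop] fun n => Real.log (n : ℝ))
    (hM₁ : ∀ n, 0 < M₁ n)
    (hy : ∀ᶠ n in atTop, y n ≤ 2 * max (M₁ n) (M₂ n)) :
    Tendsto (fun n => r n * Real.exp (y n)) atTop (𝓝 0) := by
  refine squeeze_zero' ?_ ?_ (tendsto_natCast_rpow_neg (half_pos hc))
  · filter_upwards [hr] with n h
    rw [h]; positivity
  · filter_upwards [hr, hy, eventually_exp_box_le hM (half_pos hc), eventually_gt_atTop 0]
      with n h1 h2 h3 hn
    have hn' : (0 : ℝ) < n := by exact_mod_cast hn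
    have hmax : 0 < max (M₁ n) (M₂ n) := (hM₁ n).trans_le (le_max_left _ _)
    have h4 : Real.exp (y n) ≤ (n : ℝ) ^ (c / 2) := by
      refine le_trans ?_ h3
      rw [← Real.exp_nat_mul]
      have : Real.exp (y n) ≤ Real.exp ((3 : ℕ) * (3 * max (M₁ n) (M₂ n))) := by
        rw [Real.exp_le_exp]; push_cast; linarith
      linarith [Real.exp_pos ((3 : ℕ) * (3 * max (M₁ n) (M₂ n)))]
    calc r n * Real.exp (y n) ≤ (n : ℝ) ^ (-c) * (n : ℝ) ^ (c / 2) := by rw [h1]; gcongr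
      _ = _ := by rw [← Real.rpow_add hn']; congr 1; ring

lemma tendsto_card_div (hα : 0 ≤ α) (hρ : Tendsto (fun n => suppRatio α n (S n)) atTop (𝓝 0)) :
    Tendsto (fun n : ℕ => ((S n).card : ℝ) / n) atTop (𝓝 0) := by
  refine squeeze_zero' (Eventually.of_forall fun n => by positivity) ?_ hρ
  filter_upwards [eventually_gt_atTop 0] with n hn
  rw [div_le_iff₀ (by exact_mod_cast hn)]
  exact card_le_suppRatio hα hn _

lemma tendsto_variance_ratio (hα : 0 ≤ α) (hαγ : α ≤ γ)
    (hM₁ : ∀ n, 0 < M₁ n)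
    (hM : (fun n => max (M₁ n) (M₂ n)) =o[atTop] fun n => Real.log (n : ℝ))
    (hS : ∀ n, S n ⊆ Finset.range n) (hbox : ∀ n, InBox (S n) (M₁ n) (M₂ n) (m₀ n) (b₀ n))
    (hρ : Tendsto (fun n => suppRatio α n (S n)) atTop (𝓝 0))
    (hF : ∀ᶠ n in atTop, F ⊆ S n) (k : Option F) :
    Tendsto (fun n => paramWeight γ α n (S n) F (m₀ n) (b₀ n) k ^ 2
      * edgeVar γ α n (S n) (m₀ n) (b₀ n) (paramEdges n (S n) F k)) atTop (𝓝 1) := by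
  have hs := tendsto_card_div hα hρ
  have h1n : Tendsto (fun n : ℕ => (1 : ℝ) / n) atTop (𝓝 0) := tendsto_one_div_atTop_nhds_zero_nat
  have hlt : ∀ᶠ n : ℕ in atTop, (S n).card + 1 < n := by
    filter_upwards [(hs.add h1n).eventually_lt_const (by norm_num : (0 : ℝ) + 0 < 1),
      eventually_gt_atTop 0] with n h hn
    have hn' : (0 : ℝ) < n := by exact_mod_cast hn
    rw [← add_div, div_lt_one hn'] at h
    exact_mod_cast h
  cases k with
  | some i =>
    have hlim : Tendsto (fun n : ℕ => (1 - ((S n).card : ℝ) / n)⁻¹ * (if α < γ then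
          (1 + edgeRate γ α n 1 * Real.exp (m₀ n + b₀ n i)) ^ 2 else 1)) atTop (𝓝 1) := by
      have l1 : Tendsto (fun n : ℕ => (1 - ((S n).card : ℝ) / n)⁻¹) atTop (𝓝 1) := by
        simpa using ((tendsto_const_nhds (x := (1 : ℝ))).sub hs).inv₀ (by norm_num)
      split_ifs with h
      · have l2 := tendsto_rate_mul_exp (show 0 < γ - α by linarith)
          (r := fun n => edgeRate γ α n 1) (y := fun n => m₀ n + b₀ n i)
          (Eventually.of_forall fun n => by unfold edgeRate; congr 1; push_cast; ring) hM hM₁ (by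
            filter_upwards [hF] with n hFn
            linarith [(hbox n).1.2, ((hbox n).2 i (hFn i.2)).2, le_max_left (M₁ n) (M₂ n),
              le_max_right (M₁ n) (M₂ n)])
        simpa using l1.mul (((tendsto_const_nhds (x := (1 : ℝ))).add l2).pow 2)
      · simpa using l1
    refine hlim.congr' ?_
    filter_upwards [hF, hlt] with n hFn hn
    exact (node_variance_ratio hαγ (by omega) (hS n) (by omega) hFn i).symm
  | none =>
    have hlim : Tendsto (fun n : ℕ => ((1 - ((S n).card : ℝ) / n)
          * (1 - ((S n).card : ℝ) / n - 1 / n))⁻¹ * (if 0 < γ then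
          (1 + edgeRate γ α n 0 * Real.exp (m₀ n)) ^ 2 else 1)) atTop (𝓝 1) := by
      have l0 := (tendsto_const_nhds (x := (1 : ℝ))).sub hs
      have l1 : Tendsto (fun n : ℕ => ((1 - ((S n).card : ℝ) / n)
          * (1 - ((S n).card : ℝ) / n - 1 / n))⁻¹) atTop (𝓝 1) := by
        simpa using (l0.mul (l0.sub h1n)).inv₀ (by norm_num)
      split_ifs with h
      · have l2 := tendsto_rate_mul_exp h
          (r := fun n => edgeRate γ α n 0) (y := fun n => m₀ n)
          (Eventually.of_forall fun n => by unfold edgeRate; congr 1; push_cast; ring) hM hM₁ (by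
            filter_upwards with n
            linarith [(hbox n).1.2, le_max_left (M₁ n) (M₂ n), hM₁ n])
        simpa using l1.mul (((tendsto_const_nhds (x := (1 : ℝ))).add l2).pow 2)
      · simpa using l1
    refine hlim.congr' ?_
    filter_upwards [hlt] with n hn
    exact (intercept_variance_ratio hα hαγ (by omega) (hS n) hn).symm

end Limits

/-! ### Asymptotic normality -/

section Normality

variable {γ α : ℝ} {M₁ M₂ : ℕ → ℝ} {S : ℕ → Finset ℕ} {m₀ : ℕ → ℝ} {b₀ : ℕ → ℕ → ℝ}
  {F : Finset ℕ} {Ω : ℕ → Type*} [∀ n, MeasurableSpace (Ω n)]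
  {P : (n : ℕ) → Measure (Ω n)}
  {A : (n : ℕ) → Ω n → ℕ → ℕ → ℝ} {mhat : (n : ℕ) → Ω n → ℝ} {bhat : (n : ℕ) → Ω n → ℕ → ℝ}

/-- The exponent `z` is chosen so that each of the four terms of the remainder rate is at most
n^(-z); the factor K⁹ costs only n^(9ε). -/
lemma tendsto_pow_mul_remainderRate {δ ε z : ℝ} (hδz : z ≤ δ / 2) (hδ : 0 < δ)
    (hBz : z ≤ 1 / 2 - (γ - α) / 2) (hUz : z ≤ (1 - α) / 2) (hεz : 9 * ε < z)
    (hρ : ∀ᶠ n in atTop, suppRatio α n (S n) ≤ (n : ℝ) ^ (-δ))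
    (hρU : ∀ᶠ n in atTop, suppRatio α n (S n) * interceptScale γ n
      ≤ (n : ℝ) ^ (-δ) * nodeScale γ α n) :
    Tendsto (fun n : ℕ => ((n : ℝ) ^ ε) ^ 9 * remainderRate γ α n (S n)) atTop (𝓝 0) := by
  have hlim := (tendsto_natCast_rpow_neg (show 0 < z - 9 * ε by linarith)).const_mul 4
  rw [mul_zero] at hlim
  refine squeeze_zero' ?_ ?_ hlim
  · filter_upwards [eventually_gt_atTop 0] with n hn
    have hB : 0 ≤ nodeScale γ α n := Real.rpow_nonneg (Nat.cast_nonneg n) _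
    have hU : 0 ≤ interceptScale γ n := Real.rpow_nonneg (Nat.cast_nonneg n) _
    have hs := suppRatio_nonneg α n (S n)
    unfold remainderRate
    positivity
  · filter_upwards [eventually_gt_atTop 0, hρ, hρU] with n hn h1 h2
    have hn1 : (1 : ℝ) ≤ n := by exact_mod_cast hn
    have hn' : (0 : ℝ) < n := by exact_mod_cast hn
    have hB : 0 < nodeScale γ α n := Real.rpow_pos_of_pos hn' _
    have hmono : ∀ x, z ≤ x → (n : ℝ) ^ (-x) ≤ (n : ℝ) ^ (-z) := fun x hx =>
      Real.rpow_le_rpow_of_exponent_le hn1 (by linarith)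
    have r1 : 1 / nodeScale γ α n ≤ (n : ℝ) ^ (-z) := by
      rw [nodeScale, one_div, ← Real.rpow_neg hn'.le]
      exact hmono _ hBz
    have r2 : nodeScale γ α n / interceptScale γ n ≤ (n : ℝ) ^ (-z) := by
      rw [nodeScale, interceptScale, ← Real.rpow_sub hn']
      refine le_trans (le_of_eq ?_) (hmono _ hUz)
      congr 1; ring
    have r3 : √(suppRatio α n (S n)) ≤ (n : ℝ) ^ (-z) := by
      rw [Real.sqrt_le_left (by positivity)]
      refine (h1.trans (Real.rpow_le_rpow_of_exponent_le hn1 (y := -δ) (z := -z * 2) (by linarith))).trans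
        (le_of_eq ?_)
      rw [Real.rpow_mul hn'.le, Real.rpow_two]
    have r4 : suppRatio α n (S n) * interceptScale γ n / nodeScale γ α n ≤ (n : ℝ) ^ (-z) := by
      rw [div_le_iff₀ hB]
      refine h2.trans ?_
      gcongr
      linarith
    have r5 : remainderRate γ α n (S n) ≤ 4 * (n : ℝ) ^ (-z) := by
      unfold remainderRate; linarith
    calc ((n : ℝ) ^ ε) ^ 9 * remainderRate γ α n (S n)
        ≤ ((n : ℝ) ^ ε) ^ 9 * (4 * (n : ℝ) ^ (-z)) := by gcongr
      _ = 4 * (((n : ℝ) ^ ε) ^ 9 * (n : ℝ) ^ (-z)) := by ring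
      _ = _ := by
        rw [← Real.rpow_natCast, ← Real.rpow_mul hn'.le, ← Real.rpow_add hn']
        congr 2; push_cast; ring

lemma tendsto_pow_div_nodeScale {ε : ℝ} (j : ℕ) (h : j * ε < 1 / 2 - (γ - α) / 2) :
    Tendsto (fun n : ℕ => ((n : ℝ) ^ ε) ^ j / nodeScale γ α n) atTop (𝓝 0) := by
  refine (tendsto_natCast_rpow_neg (sub_pos.2 h)).congr' ?_
  filter_upwards [eventually_gt_atTop 0] with n hn
  have hn' : (0 : ℝ) < n := by exact_mod_cast hn
  rw [nodeScale, ← Real.rpow_natCast, ← Real.rpow_mul hn'.le, ← Real.rpow_sub hn']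
  congr 1; ring

/-- The normalized estimation error. -/
noncomputable def normalizedError (γ α : ℝ) (n : ℕ) (F : Finset ℕ) (m₀ : ℝ) (b₀ : ℕ → ℝ) (x : ℝ)
    (y : ℕ → ℝ) : EuclideanSpace ℝ (Option F) :=
  WithLp.toLp 2 (diagInvSqrt (asymVar γ α m₀ b₀ F) *ᵥ
    scaledError γ α n F (x - m₀) (fun i => y i - b₀ i))

lemma normalizedError_apply (γ α : ℝ) (n : ℕ) (F : Finset ℕ) (m : ℝ) (b : ℕ → ℝ) (x : ℝ)
    (y : ℕ → ℝ) (k : Option F) :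
    normalizedError γ α n F m b x y k = (√(asymVar γ α m b F k))⁻¹
      * (paramScale γ α n F k * paramError F (x - m) (fun i => y i - b i) k) := by
  simp [normalizedError, diagInvSqrt, Matrix.mulVec_diagonal, scaledError_eq]

lemma aemeasurable_normalizedError {n : ℕ} (hm : AEMeasurable (mhat n) (P n))
    (hb : ∀ i, AEMeasurable (fun ω => bhat n ω i) (P n)) :
    AEMeasurable (fun ω => normalizedError γ α n F (m₀ n) (b₀ n) (mhat n ω) (bhat n ω)) (P n) := by
  have h : ∀ k : Option F, AEMeasurable (fun ω =>
      normalizedError γ α n F (m₀ n) (b₀ n) (mhat n ω) (bhat n ω) k) (P n) := by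
    intro k
    simp only [normalizedError_apply]
    refine AEMeasurable.const_mul (AEMeasurable.const_mul ?_ _) _
    cases k with
    | none => exact hm.sub_const _
    | some i => exact (hb i).sub_const _
  exact (WithLp.measurable_toLp 2 _).comp_aemeasurable (aemeasurable_pi_lambda _ h)

/-- Asymptotic normality of the maximum likelihood estimator. -/
theorem asymptotic_normality [∀ n, IsProbabilityMeasure (P n)] (hγ : 0 ≤ γ) (hα : 0 ≤ α) (hα1 : α < 1) (hαγ : α ≤ γ)
    (hγα : γ - α < 1) (hM₁ : ∀ n, 0 < M₁ n)
    (hM : (fun n => max (M₁ n) (M₂ n)) =o[atTop] fun n => Real.log (n : ℝ))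
    (hS : ∀ n, S n ⊆ Finset.range n)
    (hbox : ∀ n, InBox (S n) (M₁ n) (M₂ n) (m₀ n) (b₀ n))
    (hA : ∀ n, IsBernoulliGraph (P n) n (A n) (edgeProb γ α n (S n) (m₀ n) (b₀ n)))
    (hmhat : ∀ n, AEMeasurable (mhat n) (P n))
    (hbhat : ∀ n i, AEMeasurable (fun ω => bhat n ω i) (P n))
    (hMLE : ∀ n, ∀ᵐ ω ∂(P n),
      IsMLE γ α n (S n) (M₁ n) (M₂ n) (A n ω) (mhat n ω) (bhat n ω))
    {η : ℝ} (hη : 0 < η) (hm₀ : ∀ n, |m₀ n| ≤ M₁ n - η)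
    (hb₀ : ∀ n, ∀ i ∈ S n, η ≤ b₀ n i ∧ b₀ n i ≤ M₂ n - η)
    (hs : IsLittleOBar (fun n => ((S n).card : ℝ)) (fun n => (n : ℝ) ^ ((1 - α) / 2)))
    (hF : ∀ᶠ n in atTop, F ⊆ S n) :
    TendstoInDistribution
      (fun n ω => normalizedError γ α n F (m₀ n) (b₀ n) (mhat n ω) (bhat n ω)) atTop
      (id : EuclideanSpace ℝ (Option F) → EuclideanSpace ℝ (Option F))
      P (stdGaussian (EuclideanSpace ℝ (Option F))) := by
  obtain ⟨δ, hδ, hs⟩ := hs.eventually_le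
  have hρU : ∀ᶠ n in atTop, suppRatio α n (S n) * interceptScale γ n
      ≤ (n : ℝ) ^ (-δ) * nodeScale γ α n := by
    filter_upwards [hs, eventually_gt_atTop 0] with n h1 hn
    exact suppRatio_mul_le_of_card_le hn h1
  have hρ : ∀ᶠ n in atTop, suppRatio α n (S n) ≤ (n : ℝ) ^ (-δ) := by
    filter_upwards [hs, eventually_gt_atTop 0] with n h1 hn
    refine suppRatio_le_of_card_le hn (h1.trans ?_)
    exact Real.rpow_le_rpow_of_exponent_le (by exact_mod_cast hn) (by linarith)
  have hρ0 : Tendsto (fun n => suppRatio α n (S n)) atTop (𝓝 0) :=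
    squeeze_zero' (Eventually.of_forall fun n => suppRatio_nonneg _ _ _) hρ
      (tendsto_natCast_rpow_neg hδ)
  set z := min (min (δ / 2) (1 / 2 - (γ - α) / 2)) ((1 - α) / 2) with hz
  have hz0 : 0 < z := lt_min (lt_min (by linarith) (by linarith)) (by linarith)
  have hz1 : z ≤ δ / 2 := (min_le_left _ _).trans (min_le_left _ _)
  have hz2 : z ≤ 1 / 2 - (γ - α) / 2 := (min_le_left _ _).trans (min_le_right _ _)
  have hz3 : z ≤ (1 - α) / 2 := min_le_right _ _
  -- Small enough for 9ε < z in the remainder, 2ε < δ in the regime, and K²/B → 0 and K³/B → 0.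
  set ε := z / 20 with hε
  have hε0 : 0 < ε := by positivity
  have hR := eventually_regime hγ hα hα1.le hαγ hγα.le hM₁ hM hS hε0
    (show 2 * ε < δ by linarith) hρ
  have hrem := tendsto_pow_mul_remainderRate (ε := ε) hz1 hδ hz2 hz3 (by linarith) hρ hρU
  have hK2 := tendsto_pow_div_nodeScale (γ := γ) (α := α) (ε := ε) 2 (by push_cast; linarith)
  have hK3 := tendsto_pow_div_nodeScale (γ := γ) (α := α) (ε := ε) 3 (by push_cast; linarith)
  have hp := tendsto_atypical_bound (show 0 < ε / 4 by positivity)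
  refine ⟨fun n => aemeasurable_normalizedError (hmhat n) (hbhat n), aemeasurable_id, ?_⟩
  -- Lévy's continuity theorem; for fixed `t` the target is exp(-‖t‖²/2).
  refine ProbabilityMeasure.tendsto_iff_tendsto_charFun.2 fun t => ?_
  simp only [ProbabilityMeasure.coe_mk, Measure.map_id, charFun_stdGaussian]
  set T : ℝ := ∑ k, |t k| with hT
  have hT0 : 0 ≤ T := Finset.sum_nonneg fun _ _ => abs_nonneg _
  have htT : ∀ k, |t k| ≤ T := fun k =>
    Finset.single_le_sum (f := fun k => |t k|) (fun _ _ => abs_nonneg _) (Finset.mem_univ k)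
  set w : ℕ → Option F → ℝ := fun n k => t k * paramWeight γ α n (S n) F (m₀ n) (b₀ n) k with hw
  set v : ℕ → ℝ := fun n => ∑ k, w n k ^ 2
    * edgeVar γ α n (S n) (m₀ n) (b₀ n) (paramEdges n (S n) F k) with hv
  have hvlim : Tendsto v atTop (𝓝 (‖t‖ ^ 2)) := by
    have e : ‖t‖ ^ 2 = ∑ k, t k ^ 2 * 1 := by
      rw [EuclideanSpace.real_norm_sq_eq]; simp
    rw [e]
    refine tendsto_finsetSum _ fun k _ => ?_
    refine ((tendsto_variance_ratio hα hαγ hM₁ hM hS hbox hρ0 hF k).const_mul (t k ^ 2)).congr ?_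
    intro n
    simp only [hw]
    ring
  -- `B` bounds the cost of replacing the normalized error by its linear approximation, atypical
  -- graphs included; `d` bounds the weight of a single edge.
  set B : ℕ → ℝ := fun n => T * (800 * (((n : ℝ) ^ ε) ^ 9 * remainderRate γ α n (S n)))
    + 2 * ((2 * (n : ℝ) + 3) * (2 * Real.exp (1 - (n : ℝ) ^ (ε / 4)))) with hB
  set d : ℕ → ℝ := fun n => T * (8 * (((n : ℝ) ^ ε) ^ 2 / nodeScale γ α n)) with hd
  have hBlim : Tendsto B atTop (𝓝 0) := by
    simpa using ((hrem.const_mul 800).const_mul T).add (hp.const_mul 2)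
  have hdlim : Tendsto d atTop (𝓝 0) := by
    simpa using (hK2.const_mul 8).const_mul T
  have hclose : Tendsto (fun n => charFun ((P n).map fun ω =>
      normalizedError γ α n F (m₀ n) (b₀ n) (mhat n ω) (bhat n ω)) t
        - (Real.exp (-(v n) / 2) : ℂ)) atTop (𝓝 0) := by
    have hbound : Tendsto (fun n => B n + 2 * d n * v n) atTop (𝓝 0) := by
      simpa using hBlim.add ((hdlim.const_mul 2).mul hvlim)
    refine squeeze_zero_norm' ?_ hbound
    -- The consistency rate 5K³/B eventually drops below η; on typical graphs the estimate is then
    -- interior and every score vanishes.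
    have h5 := (hK3.const_mul 5)
    rw [mul_zero] at h5
    filter_upwards [hR, hF, hρU, eventually_exp_box_le hM (show 0 < ε / 4 by positivity),
      h5.eventually_lt_const hη, hdlim.eventually_le_const zero_lt_one] with n R hFn hρn hboxn h5n hdn
    have hn' : (0 : ℝ) < n := by exact_mod_cast R.pos
    have hn1 : (1 : ℝ) ≤ n := by exact_mod_cast R.pos
    have hBp : 0 < nodeScale γ α n := by linarith [R.one_le_node]
    have hUp : 0 < interceptScale γ n := by linarith [R.node_le]
    have hρB : suppRatio α n (S n) * interceptScale γ n ≤ nodeScale γ α n := by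
      refine hρn.trans (mul_le_of_le_one_left hBp.le ?_)
      exact Real.rpow_le_one_of_one_le_of_nonpos hn1 (by linarith)
    set M := max (M₁ n) (M₂ n)
    have hM0 : 0 < M := (hM₁ n).trans_le (le_max_left _ _)
    have havar : ∀ k, 1 / (n : ℝ) ^ (ε / 4) ≤ asymVar γ α (m₀ n) (b₀ n) F k := by
      intro k
      refine le_trans ?_ (exp_neg_le_asymVar (γ := γ) (α := α) (hbox n) (le_max_left _ _)
        (le_max_right _ _) hM0.le hFn k)
      rw [Real.exp_neg, one_div]
      refine inv_anti₀ (Real.exp_pos _) (le_trans ?_ hboxn)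
      rw [← Real.exp_nat_mul]
      have : Real.exp (2 * M) ≤ Real.exp ((3 : ℕ) * (3 * M)) := by
        rw [Real.exp_le_exp]; push_cast; linarith
      linarith [Real.exp_pos ((3 : ℕ) * (3 * M))]
    have hr0 : 0 ≤ remainderRate γ α n (S n) := by
      have := suppRatio_nonneg α n (S n)
      unfold remainderRate
      positivity
    set W : Ω n → ℝ := fun ω => ∑ k, w n k * ∑ e ∈ paramEdges n (S n) F k,
      (A n ω e.1 e.2 - edgeProb γ α n (S n) (m₀ n) (b₀ n) e) with hW
    have hWm : AEMeasurable W (P n) := by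
      refine (Finset.measurable_sum _ fun k _ => (Finset.measurable_sum _ fun e he =>
        ?_).const_mul _).aemeasurable
      exact ((hA n).measurable ⟨e, paramEdges_subset k he⟩).sub_const _
    have hXm := aemeasurable_normalizedError (γ := γ) (α := α) (F := F) (m₀ := m₀) (b₀ := b₀)
      (hmhat n) (hbhat n)
    have hcf : charFun ((P n).map fun ω =>
        normalizedError γ α n F (m₀ n) (b₀ n) (mhat n ω) (bhat n ω)) t
        = ∫ ω, Complex.exp ((inner ℝ (normalizedError γ α n F (m₀ n) (b₀ n) (mhat n ω)
            (bhat n ω)) t : ℝ) * Complex.I) ∂(P n) := by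
      rw [charFun_apply, integral_map hXm]
      exact Continuous.aestronglyMeasurable (by fun_prop)
    have hstep1 := norm_integral_exp_sub_le (P := P n)
      (f := fun ω => inner ℝ (normalizedError γ α n F (m₀ n) (b₀ n) (mhat n ω) (bhat n ω)) t)
      (g := W) (hXm.inner_const) hWm
      (r := T * (800 * (((n : ℝ) ^ ε) ^ 9 * remainderRate γ α n (S n))))
      (G := fun ω => IsTypicalGraph γ α n (S n) (m₀ n) (b₀ n)
        ((n : ℝ) ^ (ε / 4)) ((n : ℝ) ^ (ε / 4)) (A n ω)) (by positivity)
      (R.link.prob_not_typical_le (hbox n) R.pos (hS n) (hA n) _) (by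
        filter_upwards [hMLE n] with ω hω hG
        have ha : ∀ e ∈ edgePairs n, A n ω e.1 e.2 = 0 ∨ A n ω e.1 e.2 = 1 :=
          fun e he => (hA n).zero_or_one ⟨e, he⟩ ω
        obtain ⟨hu, hV⟩ := R.slow_rates ha hω (hbox n) hG
        rw [mul_div_assoc] at hu hV
        have hu' := abs_lt.1 (hu.trans_lt h5n)
        have hm' := abs_le.1 (hm₀ n)
        have hint : ∀ i ∈ S n, 0 < bhat n ω i ∧ bhat n ω i < M₂ n := by
          intro i hi
          have hvi := abs_lt.1 (((abs_le_maxAbs (v := fun i => bhat n ω i - b₀ n i) hi).trans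
            hV).trans_lt h5n)
          have := hb₀ n i hi
          constructor <;> linarith [hvi.1, hvi.2, this.1, this.2]
        have hexp := fun k => R.abs_normalized_sub_le (hbox n) hFn (havar k)
          (R.param_expansion hρB ha hω (hbox n) hG (by linarith [hu'.1, hm'.1])
            (by linarith [hu'.2, hm'.2]) hint hFn k) hr0
        rw [PiLp.inner_apply, hW, ← Finset.sum_sub_distrib]
        refine (Finset.abs_sum_le_sum_abs _ _).trans ?_
        rw [hT, Finset.sum_mul]
        refine Finset.sum_le_sum fun k _ => ?_
        have e : inner ℝ (normalizedError γ α n F (m₀ n) (b₀ n) (mhat n ω) (bhat n ω) k) (t k)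
            = t k * normalizedError γ α n F (m₀ n) (b₀ n) (mhat n ω) (bhat n ω) k := by
          simp
        rw [e, normalizedError_apply, hw]
        simp only
        rw [mul_assoc, ← mul_sub, abs_mul]
        gcongr
        exact hexp k)
    have hd0 : 0 ≤ d n := by simp only [hd]; positivity
    have hstep2 := (hA n).norm_charFun_cells_sub_le (cell := paramEdges n (S n) F)
      (w := w n) (fun k => paramEdges_subset k) (pairwise_disjoint_paramEdges hFn) hd0 hdn (by
        intro k
        simp only [hw, hd]
        rw [abs_mul, ← mul_div_assoc]
        gcongr
        · exact htT k
        · exact R.paramWeight_le (hbox n) hFn (havar k))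
    rw [hcf]
    -- The linear approximation `W` is the bridge between the estimator and the Gaussian with the
    -- exact variance `v n`.
    refine (norm_sub_le_norm_sub_add_norm_sub _ (∫ ω, Complex.exp (W ω * Complex.I) ∂(P n)) _).trans ?_
    exact add_le_add hstep1 hstep2
  have hexp : Tendsto (fun n => (Real.exp (-(v n) / 2) : ℂ)) atTop
      (𝓝 (Complex.exp (-(‖t‖ : ℂ) ^ 2 / 2))) := by
    have h1 : Tendsto (fun n => Real.exp (-(v n) / 2)) atTop (𝓝 (Real.exp (-(‖t‖ ^ 2) / 2))) :=
      (Real.continuous_exp.tendsto _).comp ((hvlim.neg).div_const 2)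
    have h2 := (Complex.continuous_ofReal.tendsto _).comp h1
    push_cast at h2
    exact h2
  simpa using hclose.add hexp

end Normality

end SparseBeta

theorem theorem1
    -- sparsity exponents
    (γ α : ℝ) (hγ : γ ∈ Set.Ico (0 : ℝ) 2) (hα : α ∈ Set.Ico (0 : ℝ) 1)
    (hγα : γ - α ∈ Set.Ico (0 : ℝ) 1)
    -- the parameter space
    (M₁ M₂ : ℕ → ℝ) (hM₁ : ∀ n, 0 < M₁ n) (hM₂ : ∀ n, 0 < M₂ n)
    (hM : (fun n => max (M₁ n) (M₂ n)) =o[atTop] fun n => Real.log (n : ℝ))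
    -- the true parameters `(μ₀, β₀)`, their scale-invariant versions `(m₀, b₀)`, the support `S`
    (μ₀ : ℕ → ℝ) (β₀ : ℕ → ℕ → ℝ) (m₀ : ℕ → ℝ) (b₀ : ℕ → ℕ → ℝ)
    (S : ℕ → Finset ℕ) (hS : ∀ n, S n = SparseBeta.supp n (β₀ n))
    (hμ₀ : ∀ n : ℕ, μ₀ n = -γ * Real.log n + m₀ n)
    (hβ₀ : ∀ n : ℕ, ∀ i ∈ S n, β₀ n i = α * Real.log n + b₀ n i)
    (hbox : ∀ n, SparseBeta.InBox (S n) (M₁ n) (M₂ n) (m₀ n) (b₀ n))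
    -- for each `n`, a network with `n` nodes from the model with the true parameters
    (Ω : ℕ → Type*) [∀ n, MeasurableSpace (Ω n)]
    (P : (n : ℕ) → Measure (Ω n)) [∀ n, IsProbabilityMeasure (P n)]
    (A : (n : ℕ) → Ω n → ℕ → ℕ → ℝ)
    (hA : ∀ n, SparseBeta.IsSparseBetaModel (P n) n (μ₀ n) (β₀ n) (A n))
    -- a maximum likelihood estimator of the scale-invariant parameters
    (mhat : (n : ℕ) → Ω n → ℝ) (bhat : (n : ℕ) → Ω n → ℕ → ℝ)
    (hmhat : ∀ n, AEMeasurable (mhat n) (P n))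
    (hbhat : ∀ n i, AEMeasurable (fun ω => bhat n ω i) (P n))
    (hMLE : ∀ n, ∀ᵐ ω ∂(P n),
      SparseBeta.IsMLE γ α n (S n) (M₁ n) (M₂ n) (A n ω) (mhat n ω) (bhat n ω)) :
    -- (i) uniform consistency
    (SparseBeta.IsLittleOBar (fun n => ((S n).card : ℝ)) (fun n => (n : ℝ) ^ (1 - α)) →
      SparseBeta.IsLittleOBarP P (fun n ω => mhat n ω - m₀ n) (fun _ => 1) ∧
      SparseBeta.IsLittleOBarP P
        (fun n ω => SparseBeta.maxAbs (S n) fun i => bhat n ω i - b₀ n i) (fun _ => 1)) ∧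
    -- (ii) asymptotic normality
    (∀ η : ℝ, 0 < η → (∀ n, η < min (M₁ n) (M₂ n)) →
      (∀ n, |m₀ n| ≤ M₁ n - η) →
      (∀ n, ∀ i ∈ S n, η ≤ b₀ n i ∧ b₀ n i ≤ M₂ n - η) →
      SparseBeta.IsLittleOBar (fun n => ((S n).card : ℝ)) (fun n => (n : ℝ) ^ ((1 - α) / 2)) →
      ∀ F : Finset ℕ, (∀ᶠ n in atTop, F ⊆ S n) →
        TendstoInDistribution
          (fun n ω => WithLp.toLp 2
            (SparseBeta.diagInvSqrt (SparseBeta.asymVar γ α (m₀ n) (b₀ n) F) *ᵥ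
              SparseBeta.scaledError γ α n F (mhat n ω - m₀ n)
                (fun i => bhat n ω i - b₀ n i)))
          atTop
          (id : EuclideanSpace ℝ (Option F) → EuclideanSpace ℝ (Option F))
          P (stdGaussian (EuclideanSpace ℝ (Option F)))) := by
  have hsub : ∀ n, S n ⊆ Finset.range n := fun n => hS n ▸ Finset.filter_subset _ _
  have hgraph := fun n => (hA n).isBernoulliGraph (hS n) (hμ₀ n) (hβ₀ n)
  have hαγ : α ≤ γ := by linarith [hγα.1]
  exact ⟨SparseBeta.consistency hγ.1 hα.1 hα.2.le hαγ hγα.2 hM₁ hM hsub hbox hgraph hMLE,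
    fun η hη _ hm hb hs F hF => SparseBeta.asymptotic_normality hγ.1 hα.1 hα.2 hαγ hγα.2 hM₁ hM
      hsub hbox hgraph hmhat hbhat hMLE hη hm hb hs hF⟩
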